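/- **Setting.** Let $d\ge1$ and let $\mathsf Y\subset\mathbb R^d$ be a bounded convex Borel set. Let $\mathbb P_0,\mathbb P_1$ be two probability measures on the space of $\mathsf Y$-valued sequences $(y_k)_{k\in\mathbb Z}$ under each of which the coordinate process $(Y_k)_{k\in\mathbb Z}$ is stationary and ergodic; $\mathbb E_0$ is the expectation under $\mathbb P_0$. Write $Y_{a:b}=(Y_a,\dots,Y_b)$. For $i\in\{0,1\}$ and $n\ge1$ let $p_i(y_{1:n})$ be a density of $Y_{1:n}$ under $\mathbb P_i$ with respect to Lebesgue measure on $\mathsf Y^n$, and $p_i(y_{a+1:a+b}\mid y_{1:a})=p_i(y_{1:a+b})/p_i(y_{1:a})$, where the density of a void block is $1$. For each $N\ge2$ let $C_{N,1},\dots,C_{N,N}$ be a partition of $\mathsf Y$ into Borel sets of non-zero volume, and let $Z_{N,k}$ be the index of the cell that contains $Y_k$. Let $p_{i,N}(j_{1:n})=\mathbb P_i[Y_1\in C_{N,j_1},\dots,Y_n\in C_{N,j_n}]$, with conditional versions defined as quotients as above. Let $V_{N,j}$ and $\xi_{N,j}$ be the volume and the centroid of $C_{N,j}$, and for $y\in C_{N,j}$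 put $$\zeta_N(y)=\frac1{NV_{N,j}},\qquad M_N(y)=\frac1{V_{N,j}^{1+2/d}}\int_{C_{N,j}}(x-\xi_{N,j})(x-\xi_{N,j})^{T}dx .$$ For $m\ge0$ define $$\eta_i(m)=\sup_{m'\ge m}\mathbb E_0\bigl|\log p_i(Y_0|Y_{-m:-1})-\log p_i(Y_0|Y_{-m':-1})\bigr|,$$ $$\eta_{i,N}(m)=\sup_{m'\ge m}\mathbb E_0\bigl|\log p_{i,N}(Z_{N,0}|Z_{N,-m:-1})-\log p_{i,N}(Z_{N,0}|Z_{N,-m':-1})\bigr|.$$ **Assumptions.** (A) For $i\in\{0,1\}$: $p_i>0$ on $\mathsf Y^n$ for all $n\ge1$, and $\mathbb E_0|\log p_i(Y_0)|<\infty$. (B) As $N\to\infty$, $\zeta_N$ converges uniformly on $\mathsf Y$ to a continuous function $\zeta$ with $\inf_{\mathsf Y}\zeta>0$, and $M_N$ converges uniformly on $\mathsf Y$ to a bounded continuous matrix-valued function $M$; there is a constant $C_d$ such that every cell $C_{N,j}$ has diameter at most $C_dN^{-1/d}$. (C) For $i\in\{0,1\}$ and all $n\ge1$, $p_i$ is of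 class $C^3$ on $\mathsf Y^n$, and all third-order partial derivatives of $\log p_i(y_{1:n})$ are bounded on $\mathsf Y^n$ by a constant that does not depend on $n$. (D) There are constants $C_e$ and $\epsilon>0$ such that $\max(\eta_i(m),\eta_{i,N}(m))\le C_e(1+m)^{-(6+\epsilon)}$ for all $i\in\{0,1\}$, $N\ge2$, $m\ge0$. (E) There are summable non-negative sequences $(\varphi_m)_{m\ge0}$ and $(\psi_k)_{k\ge0}$ such that for all $i\in\{0,1\}$, $m'\ge m\ge0$ and $k\ge0$, $$\mathbb E_0\bigl\|\nabla_{y_0}\log p_i(Y_{0:k}|Y_{-m:-1})-\nabla_{y_0}\log p_i(Y_{0:k}|Y_{-m':-1})\bigr\|\le\varphi_m,\qquad \mathbb E_0\bigl\|\nabla_{y_0}\log p_i(Y_k|Y_{-m:k-1})\bigr\|\le\psi_k .$$ **Theorem.** Under (A)–(E) the following finite limits, which are the error exponents of the Neyman–Pearson test without and with quantization, exist (for every $N\ge2$): $$K=\lim_{m\to\infty}\mathbb E_0\Bigl[\log\frac{p_0}{p_1}(Y_0|Y_{-m:-1})\Bigr],\qquad K_N=\lim_{m\to\infty}\mathbb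 E_0\Bigl[\log\frac{p_{0,N}}{p_{1,N}}(Z_{N,0}|Z_{N,-m:-1})\Bigr].$$ The sequence $\bigl(\nabla_{y_0}\log\frac{p_0}{p_1}(Y_{-k:k})\bigr)_{k\ge0}$ converges in $L^2(\mathbb P_0)$ to some random vector $\ell$, and with $F(y)=\mathbb E_0\bigl[\ell^{T}M(Y_0)\,\ell\,\big|\,Y_0=y\bigr]$, $$\lim_{N\to\infty}N^{2/d}(K-K_N)=D_e:=\frac12\int_{\mathsf Y}\frac{p_0(y)F(y)}{\zeta(y)^{2/d}}\,dy<\infty .$$ -/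

import Mathlib

open MeasureTheory Filter Topology
open scoped ENNReal NNReal

noncomputable section

namespace QuantNP

/-- The space `ℝ^d` with its Euclidean norm and Lebesgue measure. -/
abbrev E (d : ℕ) : Type := EuclideanSpace ℝ (Fin d)

/-- Bi-infinite sequences; the process is the coordinate process `Y_k(ω) = ω k`. -/
abbrev Traj (d : ℕ) : Type := ℤ → E d

variable {d : ℕ}

/-- The time shift on sequences. -/
def shift (ω : Traj d) : Traj d := fun k => ω (k + 1)

/-- The finite block `(Y_a, Y_{a+1}, …, Y_{a+n-1})`. -/
def window (ω : Traj d) (a : ℤ) (n : ℕ) : Fin n → E d := fun k => ω (a + (k : ℕ))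

/-- The product set `Y^n`. -/
def box (Y : Set (E d)) (n : ℕ) : Set (Fin n → E d) := Set.univ.pi fun _ => Y

/-- The density of the last `b` variables of a block given its first `a` variables, for a family
`p n` of densities of blocks of length `n`: `p(y_{1:a+b}) / p(y_{1:a})`. -/
def condDens (p : (n : ℕ) → (Fin n → E d) → ℝ) (a b : ℕ) (y : Fin (a + b) → E d) : ℝ :=
  p (a + b) y / p a (fun j => y (Fin.castAdd b j))

/-- The gradient at `y`, with respect to the block variable `y_j ∈ Y`, of a function on `Y^n`. -/
def partialGrad (Y : Set (E d)) {n : ℕ} (f : (Fin n → E d) → ℝ) (j : Fin n)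
    (y : Fin n → E d) : E d :=
  gradientWithin (fun x => f (Function.update y j x)) Y (y j)

/-- The canonical basis vector of `(ℝ^d)^n` in the direction of the coordinate `y_k^{(h)}`. -/
def basisVec {n : ℕ} (k : Fin n) (h : Fin d) : Fin n → E d :=
  Pi.single k (EuclideanSpace.single h (1 : ℝ))

/-! ### The observation model -/

/-- The observation model: under each of the two hypotheses `i`, the coordinate process is a
stationary ergodic process with values in the bounded convex set `Y`. -/
structure IsModel (Y : Set (E d)) (P : Fin 2 → Measure (Traj d)) : Prop where
  convex : Convex ℝ Y
  bounded : Bornology.IsBounded Y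
  prob : ∀ i, IsProbabilityMeasure (P i)
  mem : ∀ i, ∀ᵐ ω ∂P i, ∀ k, ω k ∈ Y
  ergodic : ∀ i, Ergodic shift (P i)

/-- The laws of finite blocks have densities `p i n`, positive on `Y^n`, with respect to the
Lebesgue measure restricted to `Y^n`, and `log p_i(Y_0)` is integrable under `P 0`.
For `n = 0` the first clause is the convention that the density of the void block is `1`. -/
structure HasDensities (Y : Set (E d)) (P : Fin 2 → Measure (Traj d))
    (p : Fin 2 → (n : ℕ) → (Fin n → E d) → ℝ) : Prop where
  density : ∀ i n, (P i).map (fun ω => window ω 1 n) =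
    (Measure.pi fun _ : Fin n => (volume : Measure (E d)).restrict Y).withDensity
      (fun y => ENNReal.ofReal (p i n y))
  pos : ∀ i n, ∀ y ∈ box Y n, 0 < p i n y
  log_integrable : ∀ i, Integrable (fun ω => Real.log (p i 1 (window ω 0 1))) (P 0)

/-- `log p_i(Y_0 | Y_{-m:-1})`. -/
def logCond (p : Fin 2 → (n : ℕ) → (Fin n → E d) → ℝ) (i : Fin 2) (m : ℕ) (ω : Traj d) : ℝ :=
  Real.log (condDens (p i) m 1 (window ω (-(m : ℤ)) (m + 1)))

/-- `η_i(m) = sup_{m' ≥ m} 𝔼_0 |log p_i(Y_0 | Y_{-m:-1}) - log p_i(Y_0 | Y_{-m':-1})|`. -/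
def eta (P : Fin 2 → Measure (Traj d)) (p : Fin 2 → (n : ℕ) → (Fin n → E d) → ℝ)
    (i : Fin 2) (m : ℕ) : ℝ≥0∞ :=
  ⨆ (m' : ℕ) (_ : m ≤ m'), ∫⁻ ω, ‖logCond p i m ω - logCond p i m' ω‖ₑ ∂P 0

/-! ### Quantizers -/

/-- The cell with label `j` of the quantizer `q`. -/
def cell (Y : Set (E d)) (q : E d → ℕ) (j : ℕ) : Set (E d) := {y | y ∈ Y ∧ q y = j}

/-- `q` is an `N`-point quantizer of `Y`: its output alphabet is `{0, …, N-1}` (the choice of the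
`N` distinct output symbols is immaterial), and its `N` cells, which partition `Y`, are Borel sets
of non-zero volume. Values of `q` off `Y` play no role. -/
structure IsQuantizer (Y : Set (E d)) (N : ℕ) (q : E d → ℕ) : Prop where
  lt : ∀ y ∈ Y, q y < N
  measurable_cell : ∀ j < N, MeasurableSet (cell Y q j)
  volume_ne_zero : ∀ j < N, volume (cell Y q j) ≠ 0

/-- The volume of a cell. -/
def cellVol (Y : Set (E d)) (q : E d → ℕ) (j : ℕ) : ℝ := (volume : Measure (E d)).real (cell Y q j)

/-- The centroid of a cell. -/
def centroid (Y : Set (E d)) (q : E d → ℕ) (j : ℕ) : E d :=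
  (cellVol Y q j)⁻¹ • ∫ x in cell Y q j, x

/-- The specific point density `ζ_N` of an `N`-point quantizer. -/
def pointDensity (Y : Set (E d)) (N : ℕ) (q : E d → ℕ) (y : E d) : ℝ :=
  1 / ((N : ℝ) * cellVol Y q (q y))

/-- The specific covariation profile `M_N` of a quantizer. -/
def covProfile (Y : Set (E d)) (q : E d → ℕ) (y : E d) : Matrix (Fin d) (Fin d) ℝ :=
  fun a b => 1 / (cellVol Y q (q y)) ^ (1 + 2 / (d : ℝ)) *
    ∫ x in cell Y q (q y), (x a - centroid Y q (q y) a) * (x b - centroid Y q (q y) b)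

/-- `p_{i,N}(z_{1:n})`: the probability that `Y_1, …, Y_n` fall into the cells labelled
`z_1, …, z_n`. -/
def quantProb (Y : Set (E d)) (P : Fin 2 → Measure (Traj d)) (q : E d → ℕ) (i : Fin 2) (n : ℕ)
    (z : Fin n → ℕ) : ℝ :=
  (P i).real {ω | ∀ k, window ω 1 n k ∈ cell Y q (z k)}

/-- `log p_{i,N}(Z_{N,0} | Z_{N,-m:-1})`. -/
def logCondQ (Y : Set (E d)) (P : Fin 2 → Measure (Traj d)) (q : E d → ℕ) (i : Fin 2) (m : ℕ)
    (ω : Traj d) : ℝ :=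
  Real.log (quantProb Y P q i (m + 1) (fun k => q (window ω (-(m : ℤ)) (m + 1) k)) /
    quantProb Y P q i m (fun k => q (window ω (-(m : ℤ)) m k)))

/-- `η_{i,N}(m)`, the analogue of `η_i(m)` for the quantized process. -/
def etaQ (Y : Set (E d)) (P : Fin 2 → Measure (Traj d)) (q : E d → ℕ) (i : Fin 2) (m : ℕ) :
    ℝ≥0∞ :=
  ⨆ (m' : ℕ) (_ : m ≤ m'), ∫⁻ ω, ‖logCondQ Y P q i m ω - logCondQ Y P q i m' ω‖ₑ ∂P 0

/-- High-rate family `q N`, `N ≥ 2`, of quantizers with model point density `ζ` and model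
covariation profile `M`. Uniform convergence, continuity and boundedness of matrix-valued functions
are expressed entrywise. -/
structure IsHighRate (Y : Set (E d)) (q : ℕ → E d → ℕ) (ζ : E d → ℝ)
    (M : E d → Matrix (Fin d) (Fin d) ℝ) : Prop where
  quantizer : ∀ N, 2 ≤ N → IsQuantizer Y N (q N)
  tendsto_pointDensity : TendstoUniformlyOn (fun N => pointDensity Y N (q N)) ζ atTop Y
  continuousOn_ζ : ContinuousOn ζ Y
  ζ_lower : ∃ c, 0 < c ∧ ∀ y ∈ Y, c ≤ ζ y
  tendsto_covProfile : ∀ a b, TendstoUniformlyOn (fun N y => covProfile Y (q N) y a b)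
    (fun y => M y a b) atTop Y
  continuousOn_M : ∀ a b, ContinuousOn (fun y => M y a b) Y
  M_bounded : ∃ B : ℝ, ∀ y ∈ Y, ∀ a b, |M y a b| ≤ B
  diam_le : ∃ Cd : ℝ, ∀ N, 2 ≤ N → ∀ j < N,
    Metric.diam (cell Y (q N) j) ≤ Cd / (N : ℝ) ^ (1 / (d : ℝ))

/-! ### Smoothness and forgetting -/

/-- `∇_{y_0} log p_i(Y_{0:k} | Y_{-m:-1})`. -/
def gradBlock (Y : Set (E d)) (p : Fin 2 → (n : ℕ) → (Fin n → E d) → ℝ) (i : Fin 2)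
    (m k : ℕ) (ω : Traj d) : E d :=
  partialGrad Y (fun y => Real.log (condDens (p i) m (k + 1) y)) ⟨m, by omega⟩
    (window ω (-(m : ℤ)) (m + (k + 1)))

/-- `∇_{y_0} log p_i(Y_k | Y_{-m:k-1})`. -/
def gradLast (Y : Set (E d)) (p : Fin 2 → (n : ℕ) → (Fin n → E d) → ℝ) (i : Fin 2)
    (m k : ℕ) (ω : Traj d) : E d :=
  partialGrad Y (fun y => Real.log (condDens (p i) (m + k) 1 y)) ⟨m, by omega⟩
    (window ω (-(m : ℤ)) ((m + k) + 1))

/-- `∇_{y_0} log (p_0 / p_1) (Y_{-k:k})`. -/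
def gradRatio (Y : Set (E d)) (p : Fin 2 → (n : ℕ) → (Fin n → E d) → ℝ) (k : ℕ)
    (ω : Traj d) : E d :=
  partialGrad Y (fun y => Real.log (p 0 (2 * k + 1) y / p 1 (2 * k + 1) y)) ⟨k, by omega⟩
    (window ω (-(k : ℤ)) (2 * k + 1))

/-- Smoothness of the densities, uniform bound on the third partial derivatives of their logarithms,
polynomial forgetting of the log-densities, summable forgetting of their gradients. -/
structure IsSmoothForgetting (Y : Set (E d)) (P : Fin 2 → Measure (Traj d))
    (p : Fin 2 → (n : ℕ) → (Fin n → E d) → ℝ) (q : ℕ → E d → ℕ) : Prop where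
  contDiffOn : ∀ i, ∀ n, 1 ≤ n → ContDiffOn ℝ 3 (p i n) (box Y n)
  third_bounded : ∃ C : ℝ, ∀ i, ∀ n, 1 ≤ n → ∀ y ∈ box Y n,
    ∀ k l r : Fin n, ∀ a b c : Fin d,
      |iteratedFDerivWithin ℝ 3 (fun y => Real.log (p i n y)) (box Y n) y
        ![basisVec k a, basisVec l b, basisVec r c]| ≤ C
  forgetting : ∃ Ce ε : ℝ, 0 < ε ∧ ∀ i, ∀ N, 2 ≤ N → ∀ m : ℕ,
    max (eta P p i m) (etaQ Y P (q N) i m) ≤ ENNReal.ofReal (Ce / (1 + (m : ℝ)) ^ (6 + ε))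
  grad_forgetting : ∃ φ ψ : ℕ → ℝ≥0, Summable φ ∧ Summable ψ ∧ ∀ i, ∀ m m' k : ℕ, m ≤ m' →
    ∫⁻ ω, ‖gradBlock Y p i m k ω - gradBlock Y p i m' k ω‖ₑ ∂P 0 ≤ φ m ∧
    ∫⁻ ω, ‖gradLast Y p i m k ω‖ₑ ∂P 0 ≤ ψ k

/-! ### Error exponents and the limiting quadratic form -/

/-- `K` is the error exponent of the unquantized test:
`K = lim_m 𝔼_0[log (p_0/p_1)(Y_0 | Y_{-m:-1})]`. -/
def IsExponent (P : Fin 2 → Measure (Traj d)) (p : Fin 2 → (n : ℕ) → (Fin n → E d) → ℝ)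
    (K : ℝ) : Prop :=
  (∀ m, Integrable (fun ω => logCond p 0 m ω - logCond p 1 m ω) (P 0)) ∧
  Tendsto (fun m => ∫ ω, (logCond p 0 m ω - logCond p 1 m ω) ∂P 0) atTop (𝓝 K)

/-- `K` is the error exponent of the test on the data quantized by `q`:
`K = lim_m 𝔼_0[log (p_{0,N}/p_{1,N})(Z_{N,0} | Z_{N,-m:-1})]`. -/
def IsExponentQ (Y : Set (E d)) (P : Fin 2 → Measure (Traj d)) (q : E d → ℕ) (K : ℝ) : Prop :=
  (∀ m, Integrable (fun ω => logCondQ Y P q 0 m ω - logCondQ Y P q 1 m ω) (P 0)) ∧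
  Tendsto (fun m => ∫ ω, (logCondQ Y P q 0 m ω - logCondQ Y P q 1 m ω) ∂P 0) atTop (𝓝 K)

/-- The quadratic form `vᵀ A v`. -/
def quadForm (A : Matrix (Fin d) (Fin d) ℝ) (v : E d) : ℝ := ∑ a, ∑ b, v a * A a b * v b

/-- `F` is a version of `y ↦ 𝔼_μ[X | Y_0 = y]`, for an integrable random variable `X`. -/
def IsCondExpGivenZero (μ : Measure (Traj d)) (X : Traj d → ℝ) (F : E d → ℝ) : Prop :=
  Integrable X μ ∧ Measurable F ∧
    (fun ω => F (ω 0)) =ᵐ[μ]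
      μ[X | MeasurableSpace.comap (fun ω : Traj d => ω 0) inferInstance]

end QuantNP

end

open QuantNP

open MeasureTheory Filter Topology
open scoped ENNReal NNReal

noncomputable section

namespace QuantNP

/-! ### One-variable Taylor estimates -/

/-! By the chain rule and stationarity, `K` is the limit of the increments D(m+1) − D(m), where D(n)
is the relative entropy of a block of length n, and `K_N` is the limit of the increments of the
quantized entropies D_N(n). Forgetting makes the error of both approximations O(m^{-(6+ε)}),
uniformly in N. Hence K − K_N is, up to that error, the increment at n = 2t of the loss G(n) = D(n)
− D_N(n) (`blockGap`), where t = t(N) is still to be chosen.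

The loss of one block. If exp a and exp b are averaged over a probability space on which a and b
have size τ, relative entropy drops by half the variance of a − b, up to O(τ³), relative to the mass
(`abs_entropy_expansion`). On a product of cells of diameter δ ~ N^{-1/d} both log-densities are
almost affine in each variable, and the chain rule over the variables adds up the one-variable
losses (`abs_divergenceGap_pi_sub_le`). So G(n) is half the sum over j of the mean of a quadratic
form in the gradient of log(p_0/p_1) at y_j, whose coefficients are the cell covariances, up to
O(n³δ³) (`abs_integral_sub_quantLogRatio_le`, `integral_gapError_le`). By stationarity the j-th mean
is w(j, n−1−j), where w(a,b) refers to the gradient at y_0 in a block with a variables before and b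
after it (`centerLoss`).

The increment. In G(2t+1) − G(2t) every w except w(t,t) is paired with one for a block that is
shorter by one variable at distance at least t from y_0. The pairs nearly cancel, leaving w(t,t)/2
(`exists_abs_blockGap_sub_le`).

Control of the gradients. The hypotheses bound gradients only in mean, but bound third derivatives
uniformly. Three devices bridge the distance to what is needed. (a) Contracting one variable towards
a fixed point of the domain changes the law of the block by a bounded factor if the step is short.
Comparing the mean gradients after contraction towards two different points bounds the Hessian
somewhere, and the third-derivative bound spreads this over the domain: Hessian entries are O(n),
gradients O(n²) (`exists_hasBlockBounds`). (b) A finite difference with step of order s^{-2} turns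
forgetting of log-densities into forgetting of gradients in mean, at rate s^{-(3+ε)}
(`exists_integral_abs_dirDeriv_sub_le`). (c) The sup bound s² times this mean bound makes squared L²
increments O(1/s) between scales s and 2s. Summation over dyadic scales yields the limit ℓ and
uniform second moments (`exists_norm_gradCoord_sub_le`, `exists_integral_sq_gradCoord_le`).

The balance. Multiplied by N^{2/d}, the errors are t³N^{-1/d}, t^{-ε} and N^{2/d}t^{-(6+ε)}. They
all vanish for t = N^{α/d} with 2/(6+ε) < α < 1/3, a range that is nonempty because the forgetting
exponent exceeds 6 (`exists_block_length`). Finally N^{2/d} times the cell covariance tends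
uniformly to ζ^{-2/d}M (`rescaled_cellCov_eq`), and conditioning on Y_0 turns the limit of w(t,t)
into the integral D_e. The frontier of a convex set is null, so everything takes place on the open
set `interior Y`. -/

theorem abs_sub_le_of_hasDerivAt {φ φ' : ℝ → ℝ} {r K : ℝ} (hr : 0 ≤ r)
    (h : ∀ s ∈ Set.Icc 0 r, HasDerivAt φ (φ' s) s) (hb : ∀ s ∈ Set.Icc 0 r, |φ' s| ≤ K) :
    |φ r - φ 0| ≤ K * r := by
  have := (convex_Icc 0 r).norm_image_sub_le_of_norm_hasDerivWithin_le
    (fun s hs => (h s hs).hasDerivWithinAt) (fun s hs => by simpa using hb s hs)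
    (Set.left_mem_Icc.2 hr) (Set.right_mem_Icc.2 hr)
  simpa [abs_of_nonneg hr] using this

theorem taylor_one {φ φ₁ φ₂ : ℝ → ℝ} {r K : ℝ} (hr : 0 ≤ r)
    (h : ∀ s ∈ Set.Icc 0 r, HasDerivAt φ (φ₁ s) s)
    (h₁ : ∀ s ∈ Set.Icc 0 r, HasDerivAt φ₁ (φ₂ s) s) (hb : ∀ s ∈ Set.Icc 0 r, |φ₂ s| ≤ K) :
    |φ r - φ 0 - r * φ₁ 0| ≤ K * r ^ 2 := by
  have hK : 0 ≤ K := (abs_nonneg _).trans (hb 0 (Set.left_mem_Icc.2 hr))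
  have key : ∀ s ∈ Set.Icc 0 r, |φ₁ s - φ₁ 0| ≤ K * r := fun s hs =>
    (abs_sub_le_of_hasDerivAt hs.1 (fun t ht => h₁ t ⟨ht.1, ht.2.trans hs.2⟩)
      (fun t ht => hb t ⟨ht.1, ht.2.trans hs.2⟩)).trans (by gcongr; exact hs.2)
  have := abs_sub_le_of_hasDerivAt (φ := fun s => φ s - s * φ₁ 0) hr
    (fun s hs => (h s hs).sub ((hasDerivAt_id s).mul_const (φ₁ 0)))
    (K := K * r) (fun s hs => by simpa using key s hs)
  calc _ = |(φ r - r * φ₁ 0) - (φ 0 - 0 * φ₁ 0)| := by congr 1; ring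
    _ ≤ K * r * r := this
    _ = _ := by ring

theorem taylor_two {φ φ₁ φ₂ φ₃ : ℝ → ℝ} {r K : ℝ} (hr : 0 ≤ r)
    (h : ∀ s ∈ Set.Icc 0 r, HasDerivAt φ (φ₁ s) s)
    (h₁ : ∀ s ∈ Set.Icc 0 r, HasDerivAt φ₁ (φ₂ s) s)
    (h₂ : ∀ s ∈ Set.Icc 0 r, HasDerivAt φ₂ (φ₃ s) s) (hb : ∀ s ∈ Set.Icc 0 r, |φ₃ s| ≤ K) :
    |φ r - φ 0 - r * φ₁ 0 - r ^ 2 / 2 * φ₂ 0| ≤ K * r ^ 3 := by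
  have hK : 0 ≤ K := (abs_nonneg _).trans (hb 0 (Set.left_mem_Icc.2 hr))
  have key : ∀ s ∈ Set.Icc 0 r, |φ₁ s - φ₁ 0 - s * φ₂ 0| ≤ K * r ^ 2 := fun s hs =>
    (taylor_one hs.1 (fun t ht => h₁ t ⟨ht.1, ht.2.trans hs.2⟩)
      (fun t ht => h₂ t ⟨ht.1, ht.2.trans hs.2⟩)
      (fun t ht => hb t ⟨ht.1, ht.2.trans hs.2⟩)).trans (by
        have := hs.1
        gcongr; exact hs.2)
  have := abs_sub_le_of_hasDerivAt (φ := fun s => φ s - s * φ₁ 0 - s ^ 2 / 2 * φ₂ 0) hr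
    (φ' := fun s => φ₁ s - φ₁ 0 - s * φ₂ 0)
    (fun s hs => (((h s hs).sub ((hasDerivAt_id s).mul_const (φ₁ 0))).sub
      ((((hasDerivAt_id s).pow 2).div_const 2).mul_const (φ₂ 0))).congr_deriv (by
        simp only [id]; push_cast; ring))
    (K := K * r ^ 2) (fun s hs => key s hs)
  calc _ = |(φ r - r * φ₁ 0 - r ^ 2 / 2 * φ₂ 0) - (φ 0 - 0 * φ₁ 0 - 0 ^ 2 / 2 * φ₂ 0)| := by
        congr 1; ring
    _ ≤ K * r ^ 2 * r := this
    _ = _ := by ring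

/-- The weights −3, 4, −1 at 0, r/2, r annihilate constants and quadratic terms and reproduce r
times the slope, so the error is of third order before division by r. The scheme is one-sided
because the segment is only known to stay in the domain on one side, towards an interior point. -/
theorem deriv_zero_finite_difference {φ φ₁ φ₂ φ₃ : ℝ → ℝ} {r K : ℝ} (hr : 0 < r)
    (h : ∀ s ∈ Set.Icc 0 r, HasDerivAt φ (φ₁ s) s)
    (h₁ : ∀ s ∈ Set.Icc 0 r, HasDerivAt φ₁ (φ₂ s) s)
    (h₂ : ∀ s ∈ Set.Icc 0 r, HasDerivAt φ₂ (φ₃ s) s) (hb : ∀ s ∈ Set.Icc 0 r, |φ₃ s| ≤ K) :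
    |φ₁ 0 - (-3 * φ 0 + 4 * φ (r / 2) - φ r) / r| ≤ 2 * K * r ^ 2 := by
  have hK : 0 ≤ K := (abs_nonneg _).trans (hb 0 (Set.left_mem_Icc.2 hr.le))
  have hsub : ∀ t ∈ Set.Icc 0 (r / 2), t ∈ Set.Icc 0 r := fun t ht => ⟨ht.1, by linarith [ht.2]⟩
  have e1 := taylor_two hr.le h h₁ h₂ hb
  have e2 := taylor_two (half_pos hr).le (fun t ht => h t (hsub t ht))
    (fun t ht => h₁ t (hsub t ht)) (fun t ht => h₂ t (hsub t ht)) (fun t ht => hb t (hsub t ht))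
  have hrw : φ₁ 0 - (-3 * φ 0 + 4 * φ (r / 2) - φ r) / r =
      ((φ r - φ 0 - r * φ₁ 0 - r ^ 2 / 2 * φ₂ 0) -
        4 * (φ (r / 2) - φ 0 - r / 2 * φ₁ 0 - (r / 2) ^ 2 / 2 * φ₂ 0)) / r := by
    field_simp; ring
  rw [hrw, abs_div, abs_of_pos hr, div_le_iff₀ hr]
  rw [abs_le] at *
  have : 0 ≤ K * r ^ 3 := by positivity
  constructor <;> nlinarith [e1.1, e1.2, e2.1, e2.2]

/-! ### Functions of blocks with bounded third partial derivatives -/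

variable {d : ℕ}

theorem isOpen_box {U : Set (E d)} (hU : IsOpen U) (n : ℕ) : IsOpen (box U n) :=
  isOpen_set_pi Set.finite_univ fun _ _ => hU

theorem convex_box {U : Set (E d)} (hU : Convex ℝ U) (n : ℕ) : Convex ℝ (box U n) :=
  convex_pi fun _ _ => hU

theorem update_mem_box {U : Set (E d)} {n : ℕ} {y : Fin n → E d} (hy : y ∈ box U n) (k : Fin n)
    {x : E d} (hx : x ∈ U) : Function.update y k x ∈ box U n := by
  intro j _
  rcases eq_or_ne j k with rfl | h
  · simpa using hx
  · simpa [h] using hy j trivial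

theorem update_eq_add_single {n : ℕ} (y : Fin n → E d) (k : Fin n) (x : E d) :
    Function.update y k x = y + Pi.single k (x - y k) := by
  ext1 j
  rcases eq_or_ne j k with rfl | h
  · simp
  · simp [h]

/-- Functions of class `C³` on `Uⁿ` whose third partial derivatives are bounded by `C`. -/
structure HasBoundedThird (U : Set (E d)) (n : ℕ) (C : ℝ) (F : (Fin n → E d) → ℝ) : Prop where
  contDiffOn : ContDiffOn ℝ 3 F (box U n)
  third : ∀ y ∈ box U n, ∀ (k l r : Fin n) (x x' x'' : E d),
    |fderiv ℝ (fderiv ℝ (fderiv ℝ F)) y (Pi.single k x) (Pi.single l x') (Pi.single r x'')| ≤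
      C * ‖x‖ * ‖x'‖ * ‖x''‖

/-- The second derivative of a function of a block. -/
abbrev hess {n : ℕ} (F : (Fin n → E d) → ℝ) (y : Fin n → E d) :=
  fderiv ℝ (fderiv ℝ F) y

/-- Blocks carry the sup norm, so passing from single variables to all of them costs a factor n. The
powers of n in the later bounds come from here. -/
theorem abs_apply_le_of_single {n : ℕ} (L : (Fin n → E d) →L[ℝ] ℝ) {B : ℝ} (hB : 0 ≤ B)
    (h : ∀ (k : Fin n) (x : E d), |L (Pi.single k x)| ≤ B * ‖x‖) (v : Fin n → E d) :
    |L v| ≤ n * B * ‖v‖ := by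
  have hv : v = ∑ k, Pi.single k (v k) := (Finset.univ_sum_single v).symm
  calc |L v| = |∑ k, L (Pi.single k (v k))| := by conv_lhs => rw [hv, map_sum]
    _ ≤ ∑ k, |L (Pi.single k (v k))| := Finset.abs_sum_le_sum_abs _ _
    _ ≤ ∑ _k : Fin n, B * ‖v‖ := Finset.sum_le_sum fun k _ =>
        (h k (v k)).trans (by gcongr; exact norm_le_pi_norm v k)
    _ = n * B * ‖v‖ := by simp; ring

namespace HasBoundedThird

variable {U : Set (E d)} {n : ℕ} {C : ℝ} {F : (Fin n → E d) → ℝ}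

theorem contDiffAt (hF : HasBoundedThird U n C F) (hU : IsOpen U) {y : Fin n → E d}
    (hy : y ∈ box U n) : ContDiffAt ℝ 3 F y :=
  hF.contDiffOn.contDiffAt ((isOpen_box hU n).mem_nhds hy)

theorem hasFDerivAt (hF : HasBoundedThird U n C F) (hU : IsOpen U) {y : Fin n → E d}
    (hy : y ∈ box U n) : HasFDerivAt F (fderiv ℝ F y) y :=
  ((hF.contDiffAt hU hy).differentiableAt (by norm_num)).hasFDerivAt

theorem hasFDerivAt_fderiv (hF : HasBoundedThird U n C F) (hU : IsOpen U) {y : Fin n → E d}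
    (hy : y ∈ box U n) : HasFDerivAt (fderiv ℝ F) (hess F y) y :=
  (((hF.contDiffAt hU hy).fderiv_right (m := 2) (by norm_num)).differentiableAt
    (by norm_num)).hasFDerivAt

theorem hasFDerivAt_hess (hF : HasBoundedThird U n C F) (hU : IsOpen U) {y : Fin n → E d}
    (hy : y ∈ box U n) :
    HasFDerivAt (fderiv ℝ (fderiv ℝ F)) (fderiv ℝ (fderiv ℝ (fderiv ℝ F)) y) y :=
  ((((hF.contDiffAt hU hy).fderiv_right (m := 2) (by norm_num)).fderiv_right (m := 1)
    (by norm_num)).differentiableAt (by norm_num)).hasFDerivAt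

theorem hasDerivAt_line {G : Type*} [NormedAddCommGroup G] [NormedSpace ℝ G]
    {Φ : (Fin n → E d) → G} {Φ' : (Fin n → E d) →L[ℝ] G} {y v : Fin n → E d} {s : ℝ}
    (h : HasFDerivAt Φ Φ' (y + s • v)) : HasDerivAt (fun s : ℝ => Φ (y + s • v)) (Φ' v) s := by
  have h1 : HasDerivAt (fun s : ℝ => y + s • v) v s := by
    simpa using ((hasDerivAt_id s).smul_const v).const_add y
  exact h.comp_hasDerivAt s h1

theorem line_mem (hc : Convex ℝ U) {y z : Fin n → E d} (hy : y ∈ box U n) (hz : z ∈ box U n)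
    {s : ℝ} (hs : s ∈ Set.Icc (0 : ℝ) 1) : y + s • (z - y) ∈ box U n :=
  (convex_box hc n).add_smul_sub_mem hy hz hs

theorem abs_third_le (hF : HasBoundedThird U n C F) (hC : 0 ≤ C) {y : Fin n → E d}
    (hy : y ∈ box U n) (v : Fin n → E d) (k l : Fin n) (x x' : E d) :
    |fderiv ℝ (fderiv ℝ (fderiv ℝ F)) y v (Pi.single k x) (Pi.single l x')| ≤
      n * (C * ‖x‖ * ‖x'‖) * ‖v‖ := by
  have := abs_apply_le_of_single (((ContinuousLinearMap.apply ℝ ℝ (Pi.single l x')).comp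
    (ContinuousLinearMap.apply ℝ ((Fin n → E d) →L[ℝ] ℝ) (Pi.single k x))).comp
    (fderiv ℝ (fderiv ℝ (fderiv ℝ F)) y)) (B := C * ‖x‖ * ‖x'‖) (by positivity)
    (fun r z => by
      have := hF.third y hy r k l z x x'
      simp only [ContinuousLinearMap.comp_apply, ContinuousLinearMap.apply_apply]
      calc _ ≤ _ := this
        _ = _ := by ring) v
  simpa using this

/-- The entries of the Hessian are Lipschitz. -/
theorem abs_hess_sub_le (hF : HasBoundedThird U n C F) (hC : 0 ≤ C) (hU : IsOpen U)
    (hc : Convex ℝ U) {y z : Fin n → E d} (hy : y ∈ box U n) (hz : z ∈ box U n) (k l : Fin n)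
    (x x' : E d) :
    |hess F z (Pi.single k x) (Pi.single l x') - hess F y (Pi.single k x) (Pi.single l x')| ≤
      n * C * ‖z - y‖ * ‖x‖ * ‖x'‖ := by
  have := abs_sub_le_of_hasDerivAt (r := 1) zero_le_one
    (φ := fun s => hess F (y + s • (z - y)) (Pi.single k x) (Pi.single l x'))
    (φ' := fun s => fderiv ℝ (fderiv ℝ (fderiv ℝ F)) (y + s • (z - y)) (z - y)
      (Pi.single k x) (Pi.single l x'))
    (K := n * C * ‖z - y‖ * ‖x‖ * ‖x'‖)
    (fun s hs => by
      have h1 := hasDerivAt_line (v := z - y)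
        (Φ := fderiv ℝ (fderiv ℝ F)) (y := y) (hF.hasFDerivAt_hess hU (line_mem hc hy hz hs))
      have h2 := h1.clm_apply (hasDerivAt_const s (Pi.single k x))
      have h3 := h2.clm_apply (hasDerivAt_const s (Pi.single l x'))
      simpa using h3)
    (fun s hs => (hF.abs_third_le hC (line_mem hc hy hz hs) _ k l x x').trans (by
      apply le_of_eq; ring))
  simpa using this

/-- A bound on the entries of the Hessian bounds the increments of the partial gradients. -/
theorem abs_fderiv_sub_le (hF : HasBoundedThird U n C F) (hU : IsOpen U) (hc : Convex ℝ U)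
    {B : ℝ} {y v : Fin n → E d} {k : Fin n} {x : E d} (hy : y ∈ box U n)
    (hz : y + v ∈ box U n)
    (hB : ∀ w ∈ box U n, |hess F w v (Pi.single k x)| ≤ B) :
    |fderiv ℝ F (y + v) (Pi.single k x) - fderiv ℝ F y (Pi.single k x)| ≤ B := by
  have hv : y + v - y = v := by abel
  have := abs_sub_le_of_hasDerivAt (r := 1) zero_le_one
    (φ := fun s => fderiv ℝ F (y + s • v) (Pi.single k x))
    (φ' := fun s => hess F (y + s • v) v (Pi.single k x)) (K := B)
    (fun s hs => by
      have h1 := hasDerivAt_line (v := v)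
        (hF.hasFDerivAt_fderiv hU (hv ▸ line_mem hc hy hz hs))
      simpa using h1.clm_apply (hasDerivAt_const s (Pi.single k x)))
    (fun s hs => hB _ (hv ▸ line_mem hc hy hz hs))
  simpa using this

/-- First-order expansion of a partial gradient in one block variable. -/
theorem abs_fderiv_taylor (hF : HasBoundedThird U n C F) (hU : IsOpen U) (hc : Convex ℝ U)
    {y : Fin n → E d} (hy : y ∈ box U n) {l k : Fin n} {u x : E d} (hu : u ∈ U) {r : ℝ}
    (hr : r ∈ Set.Icc (0 : ℝ) 1) :
    |fderiv ℝ F (Function.update y l (y l + r • (u - y l))) (Pi.single k x) -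
        fderiv ℝ F y (Pi.single k x) - r * hess F y (Pi.single l (u - y l)) (Pi.single k x)| ≤
      C * ‖u - y l‖ ^ 2 * ‖x‖ * r ^ 2 := by
  set v : Fin n → E d := Pi.single l (u - y l) with hv
  have hz : y + v ∈ box U n := by
    rw [hv, ← update_eq_add_single]; exact update_mem_box hy l hu
  have hvv : y + v - y = v := by abel
  have hmem : ∀ s ∈ Set.Icc 0 r, y + s • v ∈ box U n := fun s hs => by
    have := line_mem hc hy hz ⟨hs.1, hs.2.trans hr.2⟩
    rwa [hvv] at this
  have key := taylor_one hr.1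
    (φ := fun s => fderiv ℝ F (y + s • v) (Pi.single k x))
    (φ₁ := fun s => hess F (y + s • v) v (Pi.single k x))
    (φ₂ := fun s => fderiv ℝ (fderiv ℝ (fderiv ℝ F)) (y + s • v) v v (Pi.single k x))
    (K := C * ‖u - y l‖ ^ 2 * ‖x‖)
    (fun s hs => by
      have h1 := hasDerivAt_line (v := v) (hF.hasFDerivAt_fderiv hU (hmem s hs))
      simpa using h1.clm_apply (hasDerivAt_const s (Pi.single k x)))
    (fun s hs => by
      have h1 := hasDerivAt_line (v := v) (y := y) (Φ := fderiv ℝ (fderiv ℝ F))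
        (hF.hasFDerivAt_hess hU (hmem s hs))
      simpa using (h1.clm_apply (hasDerivAt_const s v)).clm_apply
        (hasDerivAt_const s (Pi.single k x)))
    (fun s hs => by
      refine (hF.third _ (hmem s hs) l l k (u - y l) (u - y l) x).trans (le_of_eq (by ring)))
  have e : Function.update y l (y l + r • (u - y l)) = y + r • v := by
    rw [update_eq_add_single, hv, ← Pi.single_smul]; simp
  rw [e]
  simpa using key

/-- A three-point finite difference approximates a directional derivative in one variable. -/
theorem abs_fderiv_sub_finite_difference (hF : HasBoundedThird U n C F) (hU : IsOpen U)
    (hc : Convex ℝ U) {y : Fin n → E d} (hy : y ∈ box U n) {k : Fin n} {u : E d} (hu : u ∈ U)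
    {r : ℝ} (hr : 0 < r) (hr1 : r ≤ 1) :
    |fderiv ℝ F y (Pi.single k (u - y k)) -
        (-3 * F y + 4 * F (Function.update y k (y k + (r / 2) • (u - y k))) -
          F (Function.update y k (y k + r • (u - y k)))) / r| ≤
      2 * (C * ‖u - y k‖ ^ 3) * r ^ 2 := by
  set v : Fin n → E d := Pi.single k (u - y k) with hv
  have hz : y + v ∈ box U n := by
    rw [hv, ← update_eq_add_single]; exact update_mem_box hy k hu
  have hvv : y + v - y = v := by abel
  have hmem : ∀ s ∈ Set.Icc 0 r, y + s • v ∈ box U n := fun s hs => by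
    have := line_mem hc hy hz ⟨hs.1, hs.2.trans hr1⟩
    rwa [hvv] at this
  have key := deriv_zero_finite_difference hr
    (φ := fun s => F (y + s • v))
    (φ₁ := fun s => fderiv ℝ F (y + s • v) v)
    (φ₂ := fun s => hess F (y + s • v) v v)
    (φ₃ := fun s => fderiv ℝ (fderiv ℝ (fderiv ℝ F)) (y + s • v) v v v)
    (K := C * ‖u - y k‖ ^ 3)
    (fun s hs => hasDerivAt_line (v := v) (hF.hasFDerivAt hU (hmem s hs)))
    (fun s hs => by
      have h1 := hasDerivAt_line (v := v) (hF.hasFDerivAt_fderiv hU (hmem s hs))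
      simpa using h1.clm_apply (hasDerivAt_const s v))
    (fun s hs => by
      have h1 := hasDerivAt_line (v := v) (y := y) (Φ := fderiv ℝ (fderiv ℝ F))
        (hF.hasFDerivAt_hess hU (hmem s hs))
      simpa using (h1.clm_apply (hasDerivAt_const s v)).clm_apply (hasDerivAt_const s v))
    (fun s hs => by
      refine (hF.third _ (hmem s hs) k k k _ _ _).trans (le_of_eq (by ring)))
  have e : ∀ s : ℝ, Function.update y k (y k + s • (u - y k)) = y + s • v := fun s => by
    rw [update_eq_add_single, hv, ← Pi.single_smul]; simp
  rw [e, e]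
  simpa using key

/-- First-order expansion in one block variable. -/
theorem abs_taylor_update (hF : HasBoundedThird U n C F) (hU : IsOpen U)
    (hc : Convex ℝ U) {y : Fin n → E d} (hy : y ∈ box U n) {k : Fin n} {u : E d} (hu : u ∈ U)
    {B : ℝ} (hB : ∀ w ∈ box U n, ∀ x, |hess F w (Pi.single k x) (Pi.single k x)| ≤ B * ‖x‖ ^ 2)
    {r : ℝ} (hr : r ∈ Set.Icc (0 : ℝ) 1) :
    |F (Function.update y k (y k + r • (u - y k))) - F y -
        r * fderiv ℝ F y (Pi.single k (u - y k))| ≤ B * ‖u - y k‖ ^ 2 * r ^ 2 := by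
  set v : Fin n → E d := Pi.single k (u - y k) with hv
  have hz : y + v ∈ box U n := by
    rw [hv, ← update_eq_add_single]; exact update_mem_box hy k hu
  have hvv : y + v - y = v := by abel
  have hmem : ∀ s ∈ Set.Icc 0 r, y + s • v ∈ box U n := fun s hs => by
    have := line_mem hc hy hz ⟨hs.1, hs.2.trans hr.2⟩
    rwa [hvv] at this
  have key := taylor_one hr.1
    (φ := fun s => F (y + s • v))
    (φ₁ := fun s => fderiv ℝ F (y + s • v) v)
    (φ₂ := fun s => hess F (y + s • v) v v)
    (K := B * ‖u - y k‖ ^ 2)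
    (fun s hs => hasDerivAt_line (v := v) (hF.hasFDerivAt hU (hmem s hs)))
    (fun s hs => by
      have h1 := hasDerivAt_line (v := v) (hF.hasFDerivAt_fderiv hU (hmem s hs))
      simpa using h1.clm_apply (hasDerivAt_const s v))
    (fun s hs => hB _ (hmem s hs) _)
  have e : ∀ s : ℝ, Function.update y k (y k + s • (u - y k)) = y + s • v := fun s => by
    rw [update_eq_add_single, hv, ← Pi.single_smul]; simp
  rw [e]
  simpa using key

end HasBoundedThird

/-! ### Contraction of one block variable towards a point -/

/-- Move the block variable `y_k` towards `u` by the fraction `r` of the way. -/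
def contract {n : ℕ} (k : Fin n) (r : ℝ) (u : E d) (y : Fin n → E d) : Fin n → E d :=
  Function.update y k (y k + r • (u - y k))

theorem contract_mem_box {U : Set (E d)} (hc : Convex ℝ U) {n : ℕ} {y : Fin n → E d}
    (hy : y ∈ box U n) (k : Fin n) {r : ℝ} (hr : r ∈ Set.Icc (0 : ℝ) 1) {u : E d} (hu : u ∈ U) :
    contract k r u y ∈ box U n :=
  update_mem_box hy k (hc.add_smul_sub_mem (hy k trivial) hu hr)

theorem measurable_contract {n : ℕ} (k : Fin n) (r : ℝ) (u : E d) :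
    Measurable (contract k r u : (Fin n → E d) → _) := by
  refine measurable_pi_lambda _ fun j => ?_
  by_cases h : j = k
  · subst h; simp only [contract, Function.update_self]; fun_prop
  · simp only [contract, Function.update_of_ne h]; fun_prop

/-- The map is a homothety of ratio 1 − r ≥ 1/2, so its inverse Jacobian is at most 2^d. -/
theorem lintegral_homothety_le {r : ℝ} (hr : r ∈ Set.Icc (0 : ℝ) (1 / 2)) (u : E d)
    {H : E d → ℝ≥0∞} (hH : Measurable H) :
    ∫⁻ x, H (x + r • (u - x)) ≤ 2 ^ d * ∫⁻ x, H x := by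
  have h1 : (0 : ℝ) < 1 - r := by linarith [hr.2]
  have e : ∀ x : E d, x + r • (u - x) = (1 - r) • x + r • u := fun x => by
    simp only [smul_sub, sub_smul, one_smul]; abel
  calc ∫⁻ x, H (x + r • (u - x)) = ∫⁻ x, H ((1 - r) • x + r • u) := by simp only [e]
    _ = ∫⁻ x, H (x + r • u) ∂(Measure.map ((1 - r) • ·) volume) := by
        rw [lintegral_map (by fun_prop) (measurable_const_smul _)]
    _ = ENNReal.ofReal |((1 - r) ^ d)⁻¹| * ∫⁻ x, H (x + r • u) := by
        rw [Measure.map_addHaar_smul _ h1.ne']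
        simp
    _ = ENNReal.ofReal |((1 - r) ^ d)⁻¹| * ∫⁻ x, H x := by rw [lintegral_add_right_eq_self]
    _ ≤ 2 ^ d * ∫⁻ x, H x := by
        gcongr
        rw [abs_of_pos (by positivity), ← inv_pow,
          show (2 : ℝ≥0∞) ^ d = ENNReal.ofReal (2 ^ d) by
            rw [ENNReal.ofReal_pow (by norm_num)]; simp]
        apply ENNReal.ofReal_le_ofReal
        gcongr
        rw [inv_le_comm₀ h1 (by norm_num)]
        norm_num
        linarith [hr.2]

theorem lintegral_contract_le {n : ℕ} (k : Fin n) {r : ℝ} (hr : r ∈ Set.Icc (0 : ℝ) (1 / 2))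
    (u : E d) {H : (Fin n → E d) → ℝ≥0∞} (hH : Measurable H) :
    ∫⁻ y, H (contract k r u y) ≤ 2 ^ d * ∫⁻ y, H y := by
  rw [← lintegral_const_mul _ hH]
  refine lintegral_le_of_lmarginal_le {k} (hH.comp (measurable_contract k r u))
    (hH.const_mul _) fun y => ?_
  rw [lmarginal_singleton, lmarginal_singleton]
  have hm : Measurable fun x => H (Function.update y k x) := hH.comp (measurable_update y)
  beta_reduce
  rw [lintegral_const_mul _ hm]
  refine le_trans (le_of_eq ?_) (lintegral_homothety_le hr u hm)
  simp [contract]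

/-! ### The law of a block -/

/-- The law of a block with density `exp F` on `Uⁿ`. -/
def blockLaw (U : Set (E d)) {n : ℕ} (F : (Fin n → E d) → ℝ) : Measure (Fin n → E d) :=
  (volume.restrict (box U n)).withDensity fun y => ENNReal.ofReal (Real.exp (F y))

theorem ae_blockLaw_mem {U : Set (E d)} (hU : IsOpen U) {n : ℕ} (F : (Fin n → E d) → ℝ) :
    ∀ᵐ y ∂blockLaw U F, y ∈ box U n :=
  (withDensity_absolutelyContinuous _ _).ae_le
    (ae_restrict_mem (isOpen_box hU n).measurableSet)

/-- Change of variables: on A the density at y is at most exp c times the density at the contracted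
point, which stays in the convex domain, and the inverse Jacobian is at most 2^d. No lower bound on
the density is needed. -/
theorem lintegral_contract_blockLaw_le {U : Set (E d)} (hU : IsOpen U) (hc : Convex ℝ U) {n : ℕ}
    {F : (Fin n → E d) → ℝ} (hF : Measurable F) {k : Fin n} {r : ℝ}
    (hr : r ∈ Set.Icc (0 : ℝ) (1 / 2)) {u : E d} (hu : u ∈ U) {A : Set (Fin n → E d)} {c : ℝ}
    (hA : MeasurableSet A) (hAc : ∀ y ∈ box U n, y ∈ A → F y - F (contract k r u y) ≤ c)
    {G : (Fin n → E d) → ℝ≥0∞} (hG : Measurable G) :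
    ∫⁻ y in A, G (contract k r u y) ∂blockLaw U F ≤
      ENNReal.ofReal (Real.exp c * 2 ^ d) * ∫⁻ y, G y ∂blockLaw U F := by
  have hdens : Measurable fun y => ENNReal.ofReal (Real.exp (F y)) := by fun_prop
  have hbox : MeasurableSet (box U n) := (isOpen_box hU n).measurableSet
  have hT := measurable_contract (d := d) k r u
  set H : (Fin n → E d) → ℝ≥0∞ :=
    (box U n).indicator fun y => ENNReal.ofReal (Real.exp (F y)) * G y with hH
  have hHm : Measurable H := (hdens.mul hG).indicator hbox
  have hr1 : r ∈ Set.Icc (0 : ℝ) 1 := ⟨hr.1, hr.2.trans (by norm_num)⟩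
  have hGT : Measurable fun y => G (contract k r u y) := hG.comp hT
  rw [← lintegral_indicator hA, blockLaw,
    lintegral_withDensity_eq_lintegral_mul _ hdens (hGT.indicator hA),
    lintegral_withDensity_eq_lintegral_mul _ hdens hG, ← lintegral_indicator hbox,
    ← lintegral_indicator hbox]
  calc _ ≤ ∫⁻ y, ENNReal.ofReal (Real.exp c) * H (contract k r u y) := by
        refine lintegral_mono fun y => ?_
        by_cases hy : y ∈ box U n
        · rw [Set.indicator_of_mem hy]
          have hTy := contract_mem_box hc hy k hr1 hu
          simp only [Pi.mul_apply, hH, Set.indicator_of_mem hTy]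
          by_cases hyA : y ∈ A
          · rw [Set.indicator_of_mem hyA, ← mul_assoc, ← ENNReal.ofReal_mul (Real.exp_nonneg _),
              ← Real.exp_add]
            gcongr
            linarith [hAc y hy hyA]
          · simp [Set.indicator_of_notMem hyA]
        · simp [Set.indicator_of_notMem hy]
    _ = ENNReal.ofReal (Real.exp c) * ∫⁻ y, H (contract k r u y) :=
        lintegral_const_mul _ (hHm.comp hT)
    _ ≤ ENNReal.ofReal (Real.exp c) * (2 ^ d * ∫⁻ y, H y) := by
        gcongr; exact lintegral_contract_le k hr u hHm
    _ = _ := by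
        rw [ENNReal.ofReal_mul (Real.exp_nonneg _), ENNReal.ofReal_pow (by norm_num), mul_assoc]
        simp [hH, Pi.mul_def]

theorem integral_contract_blockLaw_le {U : Set (E d)} (hU : IsOpen U) (hc : Convex ℝ U) {n : ℕ}
    {F : (Fin n → E d) → ℝ} (hF : Measurable F) {k : Fin n} {r : ℝ}
    (hr : r ∈ Set.Icc (0 : ℝ) (1 / 2)) {u : E d} (hu : u ∈ U) {A : Set (Fin n → E d)} {c : ℝ}
    (hA : MeasurableSet A) (hAc : ∀ y ∈ box U n, y ∈ A → F y - F (contract k r u y) ≤ c)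
    {G : (Fin n → E d) → ℝ} (hG : Measurable G) (hGi : Integrable G (blockLaw U F)) :
    IntegrableOn (fun y => |G (contract k r u y)|) A (blockLaw U F) ∧
    ∫ y in A, |G (contract k r u y)| ∂blockLaw U F ≤
      Real.exp c * 2 ^ d * ∫ y, |G y| ∂blockLaw U F := by
  have hT := measurable_contract (d := d) k r u
  have hGm : Measurable fun y => ‖G y‖ₑ := hG.enorm
  have key := lintegral_contract_blockLaw_le hU hc hF hr hu hA hAc hGm
  have hfin : ∫⁻ y, ‖G y‖ₑ ∂blockLaw U F ≠ ∞ := hGi.2.ne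
  have hfin' : ENNReal.ofReal (Real.exp c * 2 ^ d) * ∫⁻ y, ‖G y‖ₑ ∂blockLaw U F ≠ ∞ :=
    ENNReal.mul_ne_top ENNReal.ofReal_ne_top hfin
  have hint : Integrable (fun y => |G (contract k r u y)|) ((blockLaw U F).restrict A) := by
    refine ⟨(hG.comp hT).abs.aestronglyMeasurable, ?_⟩
    rw [HasFiniteIntegral]
    simp only [Real.enorm_eq_ofReal_abs, abs_abs] at key hfin' ⊢
    exact key.trans_lt hfin'.lt_top
  refine ⟨hint, ?_⟩
  rw [integral_eq_lintegral_of_nonneg_ae (Eventually.of_forall fun _ => abs_nonneg _)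
    hint.1, integral_eq_lintegral_of_nonneg_ae (Eventually.of_forall fun _ => abs_nonneg _)
    hG.abs.aestronglyMeasurable]
  simp only [Real.enorm_eq_ofReal_abs] at key hfin hfin'
  calc _ ≤ _ := ENNReal.toReal_mono hfin' key
    _ = _ := by rw [ENNReal.toReal_mul, ENNReal.toReal_ofReal (by positivity)]

/-! ### A priori bounds for the log-densities of blocks -/

theorem abs_apply_le_of_basis {L : E d →L[ℝ] ℝ} {B : ℝ}
    (h : ∀ a, |L (EuclideanSpace.single a 1)| ≤ B) (x : E d) : |L x| ≤ d * B * ‖x‖ := by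
  have hx : x = ∑ a, x a • (EuclideanSpace.single a (1 : ℝ) : E d) := by
    have := (EuclideanSpace.basisFun (Fin d) ℝ).sum_repr x
    simpa using this.symm
  calc |L x| = |∑ a, x a * L (EuclideanSpace.single a 1)| := by
        conv_lhs => rw [hx, map_sum]
        simp
    _ ≤ ∑ a, |x a * L (EuclideanSpace.single a 1)| := Finset.abs_sum_le_sum_abs _ _
    _ ≤ ∑ _a : Fin d, ‖x‖ * B := Finset.sum_le_sum fun a _ => by
        rw [abs_mul]
        have hxa : |x a| ≤ ‖x‖ := by simpa using PiLp.norm_apply_le x a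
        gcongr
        exact h a
    _ = d * B * ‖x‖ := by simp; ring

/-- Two families of log-densities of blocks of length `n`: the first is the log-density of a
probability measure, under which all partial gradients have mean at most `C₁`. -/
structure IsBlockPair (U : Set (E d)) (C D C₁ : ℝ) (n : ℕ) (f : Fin 2 → (Fin n → E d) → ℝ) :
    Prop where
  measurable : ∀ i, Measurable (f i)
  third : ∀ i, HasBoundedThird U n C (f i)
  prob : IsProbabilityMeasure (blockLaw U (f 0))
  grad : ∀ i (k : Fin n) (x : E d),
    Integrable (fun y => fderiv ℝ (f i) y (Pi.single k x)) (blockLaw U (f 0)) ∧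
      ∫ y, |fderiv ℝ (f i) y (Pi.single k x)| ∂blockLaw U (f 0) ≤ C₁ * ‖x‖

/-- A bounded open convex set that contains the closed ball of radius `ρ` around `u₀`. -/
structure IsConvexDomain (U : Set (E d)) (D ρ : ℝ) (u₀ : E d) : Prop where
  isOpen : IsOpen U
  convex : Convex ℝ U
  diam : ∀ x ∈ U, ∀ y ∈ U, ‖x - y‖ ≤ D
  one_le_D : 1 ≤ D
  ρ_pos : 0 < ρ
  ball : ∀ v : E d, ‖v‖ ≤ ρ → u₀ + v ∈ U

theorem IsConvexDomain.center_mem {U : Set (E d)} {D ρ : ℝ} {u₀ : E d}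
    (h : IsConvexDomain U D ρ u₀) : u₀ ∈ U := by
  simpa using h.ball 0 (by simpa using h.ρ_pos.le)

theorem IsConvexDomain.norm_sub_le {U : Set (E d)} {D ρ : ℝ} {u₀ : E d}
    (h : IsConvexDomain U D ρ u₀) {n : ℕ} {y z : Fin n → E d} (hy : y ∈ box U n)
    (hz : z ∈ box U n) : ‖y - z‖ ≤ D :=
  (pi_norm_le_iff_of_nonneg (zero_le_one.trans h.one_le_D)).2 fun k =>
    h.diam _ (hy k trivial) _ (hz k trivial)

section

variable {U : Set (E d)} {C D C₁ ρ : ℝ} {u₀ : E d} {n : ℕ} {f : Fin 2 → (Fin n → E d) → ℝ}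

theorem measurable_fderiv_apply_single (F : (Fin n → E d) → ℝ) (v : Fin n → E d) :
    Measurable fun y => fderiv ℝ F y v :=
  measurable_fderiv_apply_const ℝ F v

/-- If the density does not grow much under contractions of the variable `y_l`, then some entry
of the Hessian is bounded in terms of the mean of the partial gradient. -/
theorem IsBlockPair.exists_abs_hess_le (hU : IsConvexDomain U D ρ u₀)
    (hf : IsBlockPair U C D C₁ n f) (hC : 0 ≤ C) {l k : Fin n}
    {r c : ℝ} (hr : 0 < r) (hr2 : r ≤ 1 / 2) {A : Set (Fin n → E d)} (hA : MeasurableSet A)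
    (hAp : 1 / 2 ≤ (blockLaw U (f 0)).real A)
    (hAc : ∀ u ∈ U, ∀ y ∈ box U n, y ∈ A → f 0 y - f 0 (contract l r u y) ≤ c)
    (i : Fin 2) (a b : Fin d) :
    ∃ y ∈ box U n, |hess (f i) y (Pi.single l (EuclideanSpace.single b 1))
      (Pi.single k (EuclideanSpace.single a 1))| ≤
        (4 * (Real.exp c * 2 ^ d * C₁) + 4 * (C * D ^ 2) + 1) / (ρ * r) := by
  have := hf.prob
  by_contra! hcon
  set eb : E d := EuclideanSpace.single b 1 with heb
  set ea : E d := EuclideanSpace.single a 1 with hea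
  have hebn : ‖eb‖ = 1 := by simp [heb]
  have hean : ‖ea‖ = 1 := by simp [hea]
  set K := (4 * (Real.exp c * 2 ^ d * C₁) + 4 * (C * D ^ 2) + 1) / (ρ * r) with hK
  have hρ := hU.ρ_pos
  have hu1 : u₀ + ρ • eb ∈ U := hU.ball _ (by rw [norm_smul, hebn]; simp [abs_of_pos hρ])
  have hu0 := hU.center_mem
  set G : (Fin n → E d) → ℝ := fun y => fderiv ℝ (f i) y (Pi.single k ea) with hG
  have hGm : Measurable G := measurable_fderiv_apply_single _ _
  obtain ⟨hGi, hGle⟩ := hf.grad i k ea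
  rw [hean, mul_one] at hGle
  have hrI : r ∈ Set.Icc (0 : ℝ) (1 / 2) := ⟨hr.le, hr2⟩
  have hrI1 : r ∈ Set.Icc (0 : ℝ) 1 := ⟨hr.le, hr2.trans (by norm_num)⟩
  obtain ⟨hi0, hle0⟩ := integral_contract_blockLaw_le hU.isOpen hU.convex (hf.measurable 0) hrI hu0
    hA (hAc _ hu0) hGm hGi
  obtain ⟨hi1, hle1⟩ := integral_contract_blockLaw_le hU.isOpen hU.convex (hf.measurable 0) hrI hu1
    hA (hAc _ hu1) hGm hGi
  -- Contractions towards u₀ + ρ e_b and towards u₀ move y_l to points that differ by ρ r e_b. The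
  -- gradients there differ by ρ r times the Hessian entry, up to two Taylor remainders of size at
  -- most C D², so a large entry makes one of the two gradients large.
  have hpt : ∀ y ∈ box U n, K * (ρ * r) - 2 * (C * D ^ 2) ≤
      |G (contract l r (u₀ + ρ • eb) y)| + |G (contract l r u₀ y)| := by
    intro y hy
    have e1 := (hf.third i).abs_fderiv_taylor hU.isOpen hU.convex hy (l := l) (k := k) (x := ea)
      hu1 hrI1
    have e0 := (hf.third i).abs_fderiv_taylor hU.isOpen hU.convex hy (l := l) (k := k) (x := ea)
      hu0 hrI1
    have bd : ∀ u ∈ U, C * ‖u - y l‖ ^ 2 * ‖ea‖ * r ^ 2 ≤ C * D ^ 2 := fun u hu => by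
      have h1 : ‖u - y l‖ ≤ D := hU.diam _ hu _ (hy l trivial)
      have h2 : r ^ 2 ≤ 1 := pow_le_one₀ hr.le hrI1.2
      calc _ ≤ C * D ^ 2 * 1 * 1 := by rw [hean]; gcongr
        _ = _ := by ring
    have hlin : hess (f i) y (Pi.single l (u₀ + ρ • eb - y l)) (Pi.single k ea) =
        hess (f i) y (Pi.single l (u₀ - y l)) (Pi.single k ea) +
          ρ * hess (f i) y (Pi.single l eb) (Pi.single k ea) := by
      rw [show u₀ + ρ • eb - y l = (u₀ - y l) + ρ • eb by abel, Pi.single_add, Pi.single_smul]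
      simp
    have hH := (hcon y hy).le
    rw [hlin] at e1
    have e1' := e1.trans (bd _ hu1)
    have e0' := e0.trans (bd _ hu0)
    set X := hess (f i) y (Pi.single l eb) (Pi.single k ea)
    set X0 := hess (f i) y (Pi.single l (u₀ - y l)) (Pi.single k ea)
    have hKX : K * (ρ * r) ≤ |ρ * r * X| := by
      rw [abs_mul, abs_of_pos (by positivity : 0 < ρ * r), mul_comm]
      gcongr
    have : ρ * r * X = (G (contract l r (u₀ + ρ • eb) y)) - (G (contract l r u₀ y))
        - (G (contract l r (u₀ + ρ • eb) y) - G y - r * (X0 + ρ * X))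
        + (G (contract l r u₀ y) - G y - r * X0) := by ring
    rw [this] at hKX
    have t1 := abs_add_le ((G (contract l r (u₀ + ρ • eb) y)) - (G (contract l r u₀ y))
        - (G (contract l r (u₀ + ρ • eb) y) - G y - r * (X0 + ρ * X)))
        (G (contract l r u₀ y) - G y - r * X0)
    have t2 := abs_sub ((G (contract l r (u₀ + ρ • eb) y)) - (G (contract l r u₀ y)))
      (G (contract l r (u₀ + ρ • eb) y) - G y - r * (X0 + ρ * X))
    have t3 := abs_sub (G (contract l r (u₀ + ρ • eb) y)) (G (contract l r u₀ y))
    simp only [contract, hG] at *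
    linarith
  -- Integrate over A, of mass at least 1/2: contraction raises the means of the gradients by the
  -- factor exp c · 2^d at most, so K ρ r ≤ 4 exp c 2^d C₁ + 2 C D², which the choice of K excludes.
  have hint : (K * (ρ * r) - 2 * (C * D ^ 2)) * (blockLaw U (f 0)).real A ≤
      Real.exp c * 2 ^ d * C₁ + Real.exp c * 2 ^ d * C₁ := by
    calc _ = ∫ _y in A, (K * (ρ * r) - 2 * (C * D ^ 2)) ∂blockLaw U (f 0) := by
          simp [mul_comm]
      _ ≤ ∫ y in A, (|G (contract l r (u₀ + ρ • eb) y)| + |G (contract l r u₀ y)|)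
            ∂blockLaw U (f 0) := by
          refine integral_mono_ae (integrable_const _) (hi1.add hi0) ?_
          filter_upwards [ae_restrict_of_ae (ae_blockLaw_mem hU.isOpen (f 0))] with y hy
          exact hpt y hy
      _ ≤ _ := by
          rw [integral_add hi1 hi0]
          gcongr
          · exact hle1.trans (by gcongr)
          · exact hle0.trans (by gcongr)
  have hKρ : K * (ρ * r) = 4 * (Real.exp c * 2 ^ d * C₁) + 4 * (C * D ^ 2) + 1 := by
    rw [hK, div_mul_cancel₀]; positivity
  have hC₁ : 0 ≤ C₁ := by
    refine le_trans ?_ hGle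
    exact integral_nonneg fun _ => abs_nonneg _
  have hp1 : 0 ≤ Real.exp c * 2 ^ d * C₁ := by positivity
  have hp2 : 0 ≤ C * D ^ 2 := by positivity
  rw [hKρ] at hint
  nlinarith

/-- The event that the partial gradient of the log-density is moderate. -/
def moderate (F : (Fin n → E d) → ℝ) (l : Fin n) (B : ℝ) : Set (Fin n → E d) :=
  {y | ∑ a : Fin d, |fderiv ℝ F y (Pi.single l (EuclideanSpace.single a 1))| ≤ B}

theorem measurableSet_moderate (F : (Fin n → E d) → ℝ) (l : Fin n) (B : ℝ) :
    MeasurableSet (moderate F l B) :=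
  measurableSet_le (Finset.measurable_sum _ fun _ _ =>
    (measurable_fderiv_apply_single _ _).abs) measurable_const

/-- Markov's inequality: the sum of d absolute partial derivatives has mean at most d C₁, and the
threshold is twice that. -/
theorem IsBlockPair.half_le_moderate (hf : IsBlockPair U C D C₁ n f) (hC₁ : 1 ≤ C₁) (hd : 1 ≤ d)
    (l : Fin n) : 1 / 2 ≤ (blockLaw U (f 0)).real (moderate (f 0) l (2 * d * C₁)) := by
  have := hf.prob
  set S : (Fin n → E d) → ℝ :=
    fun y => ∑ a : Fin d, |fderiv ℝ (f 0) y (Pi.single l (EuclideanSpace.single a 1))| with hS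
  have hSi : Integrable S (blockLaw U (f 0)) :=
    integrable_finsetSum _ fun a _ => (hf.grad 0 l _).1.abs
  have hSle : ∫ y, S y ∂blockLaw U (f 0) ≤ d * C₁ := by
    rw [hS, integral_finsetSum _ fun a _ => (hf.grad 0 l _).1.abs]
    calc _ ≤ ∑ _a : Fin d, C₁ := Finset.sum_le_sum fun a _ => by
          simpa using (hf.grad 0 l (EuclideanSpace.single a 1)).2
      _ = _ := by simp
  have hd' : (1 : ℝ) ≤ d := by exact_mod_cast hd
  have hpos : 0 < 2 * d * C₁ := by positivity
  have hM := mul_meas_ge_le_integral_of_nonneg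
    (Eventually.of_forall fun y => Finset.sum_nonneg fun _ _ => abs_nonneg _) hSi (2 * d * C₁)
  have hcompl : (moderate (f 0) l (2 * d * C₁))ᶜ ⊆ {y | 2 * d * C₁ ≤ S y} := fun y hy => by
    simp only [moderate, Set.mem_compl_iff, Set.mem_ofPred_eq, not_le] at hy
    exact hy.le
  have h1 : (blockLaw U (f 0)).real (moderate (f 0) l (2 * d * C₁))ᶜ ≤ 1 / 2 := by
    have h2 := measureReal_mono (μ := blockLaw U (f 0)) hcompl
    have h3 : 2 * d * C₁ * (blockLaw U (f 0)).real {y | 2 * d * C₁ ≤ S y} ≤ d * C₁ := hM.trans hSle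
    have h4 : (blockLaw U (f 0)).real {y | 2 * d * C₁ ≤ S y} ≤ 1 / 2 := by
      by_contra! h
      nlinarith
    linarith
  rw [probReal_compl_eq_one_sub (measurableSet_moderate _ _ _)] at h1
  linarith

theorem abs_fderiv_le_of_mem_moderate {F : (Fin n → E d) → ℝ} {l : Fin n} {B : ℝ}
    {y : Fin n → E d} (hy : y ∈ moderate F l B) (x : E d) :
    |fderiv ℝ F y (Pi.single l x)| ≤ d * B * ‖x‖ := by
  refine abs_apply_le_of_basis (L := (fderiv ℝ F y).comp
    (ContinuousLinearMap.single ℝ (fun _ : Fin n => E d) l)) (fun a => ?_) x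
  refine le_trans ?_ hy
  simp only [ContinuousLinearMap.comp_apply, ContinuousLinearMap.single_apply]
  exact Finset.single_le_sum (f := fun a =>
    |fderiv ℝ F y (Pi.single l (EuclideanSpace.single a 1))|) (fun _ _ => abs_nonneg _)
    (Finset.mem_univ a)

theorem abs_hess_le_of_basis {F : (Fin n → E d) → ℝ} {y : Fin n → E d} {l k : Fin n} {B : ℝ}
    (h : ∀ a b, |hess F y (Pi.single l (EuclideanSpace.single b 1))
      (Pi.single k (EuclideanSpace.single a 1))| ≤ B) (x x' : E d) :
    |hess F y (Pi.single l x) (Pi.single k x')| ≤ d ^ 2 * B * ‖x‖ * ‖x'‖ := by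
  have h1 : ∀ b, |hess F y (Pi.single l (EuclideanSpace.single b 1)) (Pi.single k x')| ≤
      d * B * ‖x'‖ := fun b => abs_apply_le_of_basis
    (L := (hess F y (Pi.single l (EuclideanSpace.single b 1))).comp
      (ContinuousLinearMap.single ℝ (fun _ : Fin n => E d) k)) (fun a => by simpa using h a b) x'
  have h2 := abs_apply_le_of_basis
    (L := (((ContinuousLinearMap.apply ℝ ℝ (Pi.single k x' : Fin n → E d))).comp (hess F y)).comp
      (ContinuousLinearMap.single ℝ (fun _ : Fin n => E d) l)) (fun b => by simpa using h1 b) x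
  calc _ ≤ _ := by simpa using h2
    _ = _ := by ring

/-- The density changes by a bounded factor under small contractions. -/
theorem IsBlockPair.sub_contract_le (hU : IsConvexDomain U D ρ u₀)
    {F : (Fin n → E d) → ℝ} (hF : HasBoundedThird U n C F) {l : Fin n} {B H r : ℝ}
    (hB0 : 0 ≤ B) (hH0 : 0 ≤ H)
    (hr : r ∈ Set.Icc (0 : ℝ) 1) (hH : ∀ w ∈ box U n, ∀ x,
      |hess F w (Pi.single l x) (Pi.single l x)| ≤ H * ‖x‖ ^ 2)
    {u : E d} (hu : u ∈ U) {y : Fin n → E d} (hy : y ∈ box U n)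
    (hB : ∀ x, |fderiv ℝ F y (Pi.single l x)| ≤ B * ‖x‖) :
    F y - F (contract l r u y) ≤ B * D * r + H * D ^ 2 * r ^ 2 := by
  have h1 := hF.abs_taylor_update hU.isOpen hU.convex hy hu hH hr
  have h2 := hB (u - y l)
  have h3 : ‖u - y l‖ ≤ D := hU.diam _ hu _ (hy l trivial)
  have h4 : r * |fderiv ℝ F y (Pi.single l (u - y l))| ≤ B * D * r := by
    calc _ ≤ r * (B * ‖u - y l‖) := by gcongr; exact hr.1
      _ ≤ r * (B * D) := by have := hr.1; gcongr
      _ = _ := by ring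
  have h5 : H * ‖u - y l‖ ^ 2 * r ^ 2 ≤ H * D ^ 2 * r ^ 2 := by gcongr
  rw [abs_le] at h1
  have h6 := neg_abs_le (fderiv ℝ F y (Pi.single l (u - y l)))
  have h7 : -(r * |fderiv ℝ F y (Pi.single l (u - y l))|) ≤
      r * fderiv ℝ F y (Pi.single l (u - y l)) := by
    have := mul_le_mul_of_nonneg_left h6 hr.1
    linarith
  rw [contract]
  linarith [h1.1]

end

/-- The diagonal blocks of the Hessian of the log-density are bounded by a multiple of `n`. -/
theorem exists_diag_hess_bound {U : Set (E d)} {C D C₁ ρ : ℝ} {u₀ : E d} (hd : 1 ≤ d)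
    (hU : IsConvexDomain U D ρ u₀) (hC : 0 ≤ C) (hC₁ : 1 ≤ C₁) :
    ∃ Λ : ℝ, 0 ≤ Λ ∧ ∀ (n : ℕ) (f : Fin 2 → (Fin n → E d) → ℝ), IsBlockPair U C D C₁ n f →
      ∀ (l : Fin n), ∀ y ∈ box U n, ∀ x x',
        |hess (f 0) y (Pi.single l x) (Pi.single l x')| ≤ Λ * n * ‖x‖ * ‖x'‖ := by
  have hD := hU.one_le_D
  have hρ := hU.ρ_pos
  have hd' : (1 : ℝ) ≤ d := by exact_mod_cast hd
  set c : ℝ := d * (2 * d * C₁) * D + d ^ 2 * D ^ 2 with hc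
  set B₁ : ℝ := 4 * (Real.exp c * 2 ^ d * C₁) + 4 * (C * D ^ 2) + 1 with hB₁
  have hB₁0 : 0 ≤ B₁ := by positivity
  set B₂ : ℝ := 2 * B₁ / ρ with hB₂
  refine ⟨d ^ 2 * (1 + 3 * (C * D) + B₂ ^ 2), by positivity, fun n f hf l y hy x x' => ?_⟩
  have hn : (1 : ℝ) ≤ n := by
    have : 0 < n := l.pos
    exact_mod_cast this
  have : Nonempty (Fin d × Fin d) := ⟨(⟨0, hd⟩, ⟨0, hd⟩)⟩
  obtain ⟨⟨a, b⟩, -, hmax⟩ := Finset.exists_max_image (Finset.univ : Finset (Fin d × Fin d))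
    (fun ab => |hess (f 0) y (Pi.single l (EuclideanSpace.single ab.2 1))
      (Pi.single l (EuclideanSpace.single ab.1 1))|) Finset.univ_nonempty
  set L := |hess (f 0) y (Pi.single l (EuclideanSpace.single b 1))
      (Pi.single l (EuclideanSpace.single a 1))| with hL
  have hmax' : ∀ a' b', |hess (f 0) y (Pi.single l (EuclideanSpace.single b' 1))
      (Pi.single l (EuclideanSpace.single a' 1))| ≤ L := fun a' b' =>
    hmax (a', b') (Finset.mem_univ _)
  have hosc : ∀ w ∈ box U n, ∀ a' b',
      |hess (f 0) w (Pi.single l (EuclideanSpace.single b' 1))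
        (Pi.single l (EuclideanSpace.single a' 1)) -
      hess (f 0) y (Pi.single l (EuclideanSpace.single b' 1))
        (Pi.single l (EuclideanSpace.single a' 1))| ≤ n * (C * D) := fun w hw a' b' => by
    have := (hf.third 0).abs_hess_sub_le hC hU.isOpen hU.convex hy hw l l
      (EuclideanSpace.single b' 1) (EuclideanSpace.single a' 1)
    calc _ ≤ _ := this
      _ ≤ n * C * D * 1 * 1 := by
          simp only [PiLp.norm_single, norm_one]
          gcongr
          exact hU.norm_sub_le hw hy
      _ = _ := by ring
  have hCD : 0 ≤ C * D := by positivity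
  suffices hLle : L ≤ (1 + 3 * (C * D) + B₂ ^ 2) * n by
    calc _ ≤ d ^ 2 * ((1 + 3 * (C * D) + B₂ ^ 2) * n) * ‖x‖ * ‖x'‖ :=
          abs_hess_le_of_basis (fun a' b' => (hmax' a' b').trans hLle) x x'
      _ = _ := by ring
  -- If the largest entry L at y does not dominate the oscillation n C D of the entries over the
  -- domain, the bound is immediate. Otherwise all entries are at most 2L everywhere.
  by_cases hsmall : L ≤ n * (1 + C * D)
  · nlinarith [sq_nonneg B₂]
  push Not at hsmall
  have hL1 : 1 ≤ L := by nlinarith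
  have hLo : n * (C * D) ≤ L := by nlinarith
  have hup : ∀ w ∈ box U n, ∀ z : E d,
      |hess (f 0) w (Pi.single l z) (Pi.single l z)| ≤ d ^ 2 * (2 * L) * ‖z‖ ^ 2 := by
    intro w hw z
    calc _ ≤ d ^ 2 * (2 * L) * ‖z‖ * ‖z‖ := abs_hess_le_of_basis (fun a' b' => by
          have h1 := hosc w hw a' b'
          have h2 := hmax' a' b'
          rw [abs_le] at *
          constructor <;> linarith [h1.1, h1.2, h2.1, h2.2]) z z
      _ = _ := by ring
  have hsq : 1 ≤ √L := by rw [Real.one_le_sqrt]; exact hL1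
  have hsq2 : √L ^ 2 = L := Real.sq_sqrt (by linarith)
  -- The step at which curvature of order L changes the log-density by a bounded amount: L r² = 1/4.
  -- On the moderate event the total drop is then at most c.
  set r : ℝ := 1 / (2 * √L) with hr
  have hr0 : 0 < r := by positivity
  have hr2 : r ≤ 1 / 2 := by
    rw [hr, div_le_div_iff₀ (by positivity) (by norm_num)]; linarith
  obtain ⟨w, hw, hwle⟩ := hf.exists_abs_hess_le hU hC (l := l) (k := l) (c := c) hr0 hr2
    (measurableSet_moderate (f 0) l (2 * d * C₁)) (hf.half_le_moderate hC₁ hd l)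
    (fun u hu z hz hzm => by
      have h1 := IsBlockPair.sub_contract_le hU (hf.third 0) (l := l) (B := d * (2 * d * C₁))
        (H := d ^ 2 * (2 * L)) (r := r) (by positivity) (by positivity)
        ⟨hr0.le, hr2.trans (by norm_num)⟩ hup hu hz
        (fun x => abs_fderiv_le_of_mem_moderate hzm x)
      have h2 : d ^ 2 * (2 * L) * D ^ 2 * r ^ 2 ≤ d ^ 2 * D ^ 2 := by
        have : L * r ^ 2 = 1 / 4 := by
          rw [hr, div_pow, mul_pow, hsq2]; field_simp; norm_num
        calc _ = d ^ 2 * D ^ 2 * 2 * (L * r ^ 2) := by ring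
          _ ≤ _ := by rw [this]; nlinarith [sq_nonneg (d * D : ℝ)]
      have h3 : d * (2 * d * C₁) * D * r ≤ d * (2 * d * C₁) * D * 1 := by
        gcongr; linarith
      rw [hc]; linarith) 0 a b
  have h1 := hosc w hw a b
  have hrinv : B₁ / (ρ * r) = B₂ * √L := by
    rw [hB₂, hr]; field_simp
  rw [← hB₁, hrinv] at hwle
  -- At some point w the entry is at most B₂√L, and it differs from its value at y by at most n C D.
  -- Since L enters on the right only through its square root, it can be absorbed on the left.
  have h2 : L ≤ B₂ * √L + n * (C * D) := by
    have := abs_sub_abs_le_abs_sub (hess (f 0) y (Pi.single l (EuclideanSpace.single b 1))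
      (Pi.single l (EuclideanSpace.single a 1)))
      (hess (f 0) w (Pi.single l (EuclideanSpace.single b 1))
      (Pi.single l (EuclideanSpace.single a 1)))
    rw [abs_sub_comm] at this
    linarith
  have h3 : B₂ * √L ≤ L / 2 + B₂ ^ 2 / 2 := by nlinarith [sq_nonneg (B₂ - √L)]
  nlinarith [sq_nonneg B₂]

/-- All blocks of the Hessians of the log-densities are bounded by a multiple of `n`. -/
theorem exists_hess_bound {U : Set (E d)} {C D C₁ ρ : ℝ} {u₀ : E d} (hd : 1 ≤ d)
    (hU : IsConvexDomain U D ρ u₀) (hC : 0 ≤ C) (hC₁ : 1 ≤ C₁) :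
    ∃ Λ : ℝ, 0 ≤ Λ ∧ ∀ (n : ℕ) (f : Fin 2 → (Fin n → E d) → ℝ), IsBlockPair U C D C₁ n f →
      ∀ (i : Fin 2) (l k : Fin n), ∀ y ∈ box U n, ∀ x x',
        |hess (f i) y (Pi.single l x) (Pi.single k x')| ≤ Λ * n * ‖x‖ * ‖x'‖ := by
  have hD := hU.one_le_D
  have hρ := hU.ρ_pos
  have hd' : (1 : ℝ) ≤ d := by exact_mod_cast hd
  obtain ⟨Λ₀, hΛ₀, hdiag⟩ := exists_diag_hess_bound hd hU hC hC₁
  set c : ℝ := d * (2 * d * C₁) * D + Λ₀ * D ^ 2 with hc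
  set B₁ : ℝ := 4 * (Real.exp c * 2 ^ d * C₁) + 4 * (C * D ^ 2) + 1 with hB₁
  have hB₁0 : 0 ≤ B₁ := by positivity
  refine ⟨d ^ 2 * (2 * B₁ / ρ + C * D), by positivity, fun n f hf i l k y hy x x' => ?_⟩
  have hn : (1 : ℝ) ≤ n := by
    have : 0 < n := l.pos
    exact_mod_cast this
  -- By the diagonal bound the curvature in one variable is O(n), so its effect n r² is bounded,
  -- while the resulting entry bound, of order 1/r, matches the oscillation n C D.
  set r : ℝ := 1 / (2 * n) with hr
  have hr0 : 0 < r := by positivity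
  have hr2 : r ≤ 1 / 2 := by
    rw [hr, div_le_div_iff₀ (by positivity) (by norm_num)]; linarith
  suffices h : ∀ a b, |hess (f i) y (Pi.single l (EuclideanSpace.single b 1))
      (Pi.single k (EuclideanSpace.single a 1))| ≤ (2 * B₁ / ρ + C * D) * n by
    calc _ ≤ d ^ 2 * ((2 * B₁ / ρ + C * D) * n) * ‖x‖ * ‖x'‖ := abs_hess_le_of_basis h x x'
      _ = _ := by ring
  intro a b
  obtain ⟨w, hw, hwle⟩ := hf.exists_abs_hess_le hU hC (l := l) (k := k) (c := c) hr0 hr2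
    (measurableSet_moderate (f 0) l (2 * d * C₁)) (hf.half_le_moderate hC₁ hd l)
    (fun u hu z hz hzm => by
      have h1 := IsBlockPair.sub_contract_le hU (hf.third 0) (l := l) (B := d * (2 * d * C₁))
        (H := Λ₀ * n) (r := r) (by positivity) (by positivity)
        ⟨hr0.le, hr2.trans (by norm_num)⟩
        (fun w hw x => (hdiag n f hf l w hw x x).trans (le_of_eq (by ring))) hu hz
        (fun x => abs_fderiv_le_of_mem_moderate hzm x)
      have h2 : Λ₀ * n * D ^ 2 * r ^ 2 ≤ Λ₀ * D ^ 2 := by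
        have : n * r ^ 2 ≤ 1 := by
          rw [hr, div_pow, mul_pow, mul_div, div_le_one (by positivity)]
          nlinarith
        calc _ = Λ₀ * D ^ 2 * (n * r ^ 2) := by ring
          _ ≤ Λ₀ * D ^ 2 * 1 := by gcongr
          _ = _ := by ring
      have h3 : d * (2 * d * C₁) * D * r ≤ d * (2 * d * C₁) * D * 1 := by
        gcongr; linarith
      rw [hc]; linarith) i a b
  have h1 := (hf.third i).abs_hess_sub_le hC hU.isOpen hU.convex hw hy l k
      (EuclideanSpace.single b 1) (EuclideanSpace.single a 1)
  have h2 : n * C * ‖y - w‖ * ‖(EuclideanSpace.single b 1 : E d)‖ *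
      ‖(EuclideanSpace.single a 1 : E d)‖ ≤ n * C * D * 1 * 1 := by
    simp only [PiLp.norm_single, norm_one]
    gcongr
    exact hU.norm_sub_le hy hw
  have hrinv : B₁ / (ρ * r) = 2 * B₁ / ρ * n := by
    rw [hr]; field_simp
  rw [← hB₁, hrinv] at hwle
  have := abs_sub_abs_le_abs_sub (hess (f i) y (Pi.single l (EuclideanSpace.single b 1))
      (Pi.single k (EuclideanSpace.single a 1)))
      (hess (f i) w (Pi.single l (EuclideanSpace.single b 1))
      (Pi.single k (EuclideanSpace.single a 1)))
  nlinarith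

/-- Uniform bounds on the derivatives of the log-densities of blocks of length `n`, and the
resulting stability of expectations under small contractions. -/
structure HasBlockBounds (U : Set (E d)) (Λ : ℝ) (n : ℕ) (f : Fin 2 → (Fin n → E d) → ℝ) :
    Prop where
  hess : ∀ (i : Fin 2) (l k : Fin n), ∀ y ∈ box U n, ∀ x x',
    |QuantNP.hess (f i) y (Pi.single l x) (Pi.single k x')| ≤ Λ * n * ‖x‖ * ‖x'‖
  grad : ∀ (i : Fin 2) (k : Fin n), ∀ y ∈ box U n, ∀ x,
    |fderiv ℝ (f i) y (Pi.single k x)| ≤ Λ * n ^ 2 * ‖x‖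
  contract : ∀ (k : Fin n) (r : ℝ), 0 ≤ r → r ≤ 1 / (2 * n ^ 2) → ∀ u ∈ U,
    ∀ G : (Fin n → E d) → ℝ, Measurable G → Integrable G (blockLaw U (f 0)) →
      Integrable (fun y => G (contract k r u y)) (blockLaw U (f 0)) ∧
      ∫ y, |G (QuantNP.contract k r u y)| ∂blockLaw U (f 0) ≤ Λ * ∫ y, |G y| ∂blockLaw U (f 0)

theorem HasBlockBounds.hess_le {U : Set (E d)} {Λ : ℝ} {n : ℕ} {f : Fin 2 → (Fin n → E d) → ℝ}
    (h : HasBlockBounds U Λ n f) (hΛ : 0 ≤ Λ) (i : Fin 2) (k : Fin n) {y : Fin n → E d}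
    (hy : y ∈ box U n) (v : Fin n → E d) (x : E d) :
    |QuantNP.hess (f i) y v (Pi.single k x)| ≤ Λ * n ^ 2 * ‖v‖ * ‖x‖ := by
  have := abs_apply_le_of_single ((ContinuousLinearMap.apply ℝ ℝ (Pi.single k x)).comp
    (QuantNP.hess (f i) y)) (B := Λ * n * ‖x‖) (by positivity)
    (fun l z => by
      have := h.hess i l k y hy z x
      simp only [ContinuousLinearMap.comp_apply, ContinuousLinearMap.apply_apply]
      calc _ ≤ _ := this
        _ = _ := by ring) v
  calc _ ≤ _ := by simpa using this
    _ = _ := by ring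

theorem exists_hasBlockBounds {U : Set (E d)} {C D C₁ ρ : ℝ} {u₀ : E d} (hd : 1 ≤ d)
    (hU : IsConvexDomain U D ρ u₀) (hC : 0 ≤ C) (hC₁ : 1 ≤ C₁) :
    ∃ Λ : ℝ, 0 ≤ Λ ∧ ∀ (n : ℕ) (f : Fin 2 → (Fin n → E d) → ℝ), IsBlockPair U C D C₁ n f →
      HasBlockBounds U Λ n f := by
  obtain ⟨Λ₀, hΛ₀, hH⟩ := exists_hess_bound hd hU hC hC₁
  have hD := hU.one_le_D
  set c : ℝ := (C₁ + Λ₀ * D) * D + Λ₀ * D ^ 2 with hc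
  have hgrad : ∀ (n : ℕ) (f : Fin 2 → (Fin n → E d) → ℝ), IsBlockPair U C D C₁ n f →
      ∀ (i : Fin 2) (k : Fin n), ∀ y ∈ box U n, ∀ x,
        |fderiv ℝ (f i) y (Pi.single k x)| ≤ (C₁ + Λ₀ * D) * n ^ 2 * ‖x‖ := by
    intro n f hf i k y hy x
    have hn : (1 : ℝ) ≤ n := by
      have : 0 < n := k.pos
      exact_mod_cast this
    have := hf.prob
    obtain ⟨hi, hle⟩ := hf.grad i k x
    -- A point of the domain where the gradient is at most its mean. The Hessian bound, O(n²) along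
    -- displacements of all variables, carries it to every other point.
    obtain ⟨w, hw, hwle⟩ := exists_notMem_null_le_integral hi.abs
      (N := (box U n)ᶜ) (by simpa [mem_ae_iff] using ae_blockLaw_mem hU.isOpen (f 0))
    simp only [Set.mem_compl_iff, not_not] at hw
    have hv : w + (y - w) = y := by abel
    have h1 := (hf.third i).abs_fderiv_sub_le hU.isOpen hU.convex (v := y - w) (k := k) (x := x)
      (B := Λ₀ * n ^ 2 * D * ‖x‖) hw (by rw [hv]; exact hy) (fun z hz => by
        have h2 := abs_apply_le_of_single ((ContinuousLinearMap.apply ℝ ℝ (Pi.single k x)).comp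
          (QuantNP.hess (f i) z)) (B := Λ₀ * n * ‖x‖) (by positivity)
          (fun l z' => by
            have := hH n f hf i l k z hz z' x
            simp only [ContinuousLinearMap.comp_apply, ContinuousLinearMap.apply_apply]
            calc _ ≤ _ := this
              _ = _ := by ring) (y - w)
        calc _ ≤ _ := by simpa using h2
          _ ≤ n * (Λ₀ * n * ‖x‖) * D := by
            gcongr
            exact hU.norm_sub_le hy hw
          _ = _ := by ring)
    rw [hv] at h1
    have h3 := abs_sub_abs_le_abs_sub (fderiv ℝ (f i) y (Pi.single k x))
      (fderiv ℝ (f i) w (Pi.single k x))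
    have h4 : C₁ * ‖x‖ ≤ C₁ * n ^ 2 * ‖x‖ := by
      have : (1 : ℝ) ≤ n ^ 2 := one_le_pow₀ hn
      have h0 : 0 ≤ C₁ * ‖x‖ := by positivity
      nlinarith
    nlinarith
  refine ⟨max (max Λ₀ (C₁ + Λ₀ * D)) (Real.exp c * 2 ^ d), by positivity, fun n f hf =>
    ⟨fun i l k y hy x x' => (hH n f hf i l k y hy x x').trans ?_,
      fun i k y hy x => (hgrad n f hf i k y hy x).trans ?_, fun k r hr0 hr u hu G hG hGi => ?_⟩⟩
  · gcongr; exact (le_max_left _ _).trans (le_max_left _ _)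
  · gcongr; exact (le_max_right _ _).trans (le_max_left _ _)
  · have hn : (1 : ℝ) ≤ n := by
      have : 0 < n := k.pos
      exact_mod_cast this
    have hr2 : r ≤ 1 / 2 := by
      refine hr.trans ?_
      rw [div_le_div_iff₀ (by positivity) (by norm_num)]
      nlinarith
    -- Now the gradient is bounded everywhere by a multiple of n², so for r ≤ 1/(2n²) the drop of
    -- the log-density is bounded on the whole domain and no moderate event is needed.
    obtain ⟨h1, h2⟩ := integral_contract_blockLaw_le hU.isOpen hU.convex (hf.measurable 0)
      (k := k) (c := c) (A := Set.univ) ⟨hr0, hr2⟩ hu MeasurableSet.univ (fun y hy _ => by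
        have h3 := IsBlockPair.sub_contract_le hU (hf.third 0) (l := k)
          (B := (C₁ + Λ₀ * D) * n ^ 2) (H := Λ₀ * n) (r := r) (by positivity) (by positivity)
          ⟨hr0, hr2.trans (by norm_num)⟩
          (fun w hw x => (hH n f hf 0 k k w hw x x).trans (le_of_eq (by ring))) hu hy
          (hgrad n f hf 0 k y hy)
        have hrn : n ^ 2 * r ≤ 1 := by
          rw [le_div_iff₀ (by positivity)] at hr; linarith
        have hrn2 : n * r ^ 2 ≤ 1 := by
          have : n * r ≤ n ^ 2 * r := by gcongr; nlinarith
          nlinarith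
        have h4 : (C₁ + Λ₀ * D) * n ^ 2 * D * r ≤ (C₁ + Λ₀ * D) * D := by
          calc _ = (C₁ + Λ₀ * D) * D * (n ^ 2 * r) := by ring
            _ ≤ (C₁ + Λ₀ * D) * D * 1 := by gcongr
            _ = _ := by ring
        have h5 : Λ₀ * n * D ^ 2 * r ^ 2 ≤ Λ₀ * D ^ 2 := by
          calc _ = Λ₀ * D ^ 2 * (n * r ^ 2) := by ring
            _ ≤ Λ₀ * D ^ 2 * 1 := by gcongr
            _ = _ := by ring
        rw [hc]; linarith) hG hGi
    simp only [IntegrableOn, Measure.restrict_univ] at h1 h2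
    refine ⟨(integrable_norm_iff (hG.comp (measurable_contract k r u)).aestronglyMeasurable).1 h1,
      h2.trans ?_⟩
    gcongr
    exact le_max_right _ _

/-! ### Trajectories -/

/-- The shift by `t` time steps. -/
def timeShift (t : ℤ) (ω : Traj d) : Traj d := fun k => ω (k + t)

theorem measurable_timeShift (t : ℤ) : Measurable (timeShift t : Traj d → Traj d) :=
  measurable_pi_lambda _ fun k => measurable_pi_apply (k + t)

theorem measurable_window (a : ℤ) (n : ℕ) : Measurable fun ω : Traj d => window ω a n :=
  measurable_pi_lambda _ fun _ => measurable_pi_apply _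

theorem measurePreserving_timeShift {P : Measure (Traj d)} (h : MeasurePreserving shift P P)
    (t : ℤ) : MeasurePreserving (timeShift t) P P := by
  have hnat : ∀ n : ℕ, MeasurePreserving (timeShift (n : ℤ)) P P := fun n => by
    have : (timeShift (n : ℤ) : Traj d → Traj d) = shift^[n] := by
      induction n with
      | zero => ext ω k; simp [timeShift]
      | succ n ih =>
        rw [Function.iterate_succ', ← ih]
        ext1 ω
        funext k
        simp only [timeShift, Function.comp_apply, shift]
        congr 1; push_cast; ring
    rw [this]
    exact h.iterate n
  rcases Int.eq_nat_or_neg t with ⟨n, rfl | rfl⟩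
  · exact hnat n
  · refine ⟨measurable_timeShift _, ?_⟩
    conv_lhs => rw [← (hnat n).map_eq]
    rw [Measure.map_map (measurable_timeShift _) (measurable_timeShift _)]
    have : (timeShift (-(n : ℤ)) ∘ timeShift (n : ℤ) : Traj d → Traj d) = id := by
      ext1 ω; funext k; simp [timeShift]
    rw [this, Measure.map_id]

theorem window_timeShift (t a : ℤ) (n : ℕ) (ω : Traj d) :
    window (timeShift t ω) a n = window ω (a + t) n := by
  funext k; simp only [window, timeShift]; congr 1; ring

theorem window_update_zero (ω : Traj d) (m n : ℕ) (h : m < n) (x : E d) :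
    window (Function.update ω 0 x) (-(m : ℤ)) n =
      Function.update (window ω (-(m : ℤ)) n) ⟨m, h⟩ x := by
  funext k
  by_cases hk : k = ⟨m, h⟩
  · subst hk; simp [window]
  · have : (-(m : ℤ) + (k : ℕ)) ≠ 0 := by
      intro h0; apply hk; ext; simp; omega
    simp [window, hk, this]

theorem window_update_of_notMem (ω : Traj d) (a : ℤ) (n : ℕ) (h : 0 < a ∨ a + n ≤ 0) (x : E d) :
    window (Function.update ω 0 x) a n = window ω a n := by
  funext k
  have : (a + (k : ℕ)) ≠ 0 := by have := k.2; omega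
  simp [window, this]

/-- Extension of a block, placed at the times `a, a + 1, …`, by a constant. -/
def extend (u₀ : E d) (a : ℤ) {n : ℕ} (y : Fin n → E d) : Traj d := fun t =>
  if h : a ≤ t ∧ t < a + n then y ⟨(t - a).toNat, by omega⟩ else u₀

theorem measurable_extend (u₀ : E d) (a : ℤ) (n : ℕ) :
    Measurable (extend u₀ a : (Fin n → E d) → Traj d) := by
  refine measurable_pi_lambda _ fun t => ?_
  by_cases h : a ≤ t ∧ t < a + n
  · simp only [extend, h, and_self, dite_true]; exact measurable_pi_apply _
  · simp only [extend, h, dite_false]; exact measurable_const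

theorem window_extend (u₀ : E d) {a b : ℤ} {n l : ℕ} (hab : a ≤ b) (hl : b + l ≤ a + n)
    (ω : Traj d) : window (extend u₀ a (window ω a n)) b l = window ω b l := by
  funext k
  have hk := k.2
  have : a ≤ b + (k : ℕ) ∧ b + (k : ℕ) < a + n := by omega
  simp only [window, extend, this, and_self, dite_true]
  congr 1
  have : ((b + (k : ℕ) - a).toNat : ℤ) = b + (k : ℕ) - a := Int.toNat_of_nonneg (by omega)
  simp only [this]; ring

/-- The log-density of the block `(Y_a, …, Y_{a+n-1})`. -/
def logDens (f : Fin 2 → (n : ℕ) → (Fin n → E d) → ℝ) (i : Fin 2) (a : ℤ) (n : ℕ) (ω : Traj d) :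
    ℝ := f i n (window ω a n)

/-- The conditional log-density of `Y_0` given `(Y_{-m}, …, Y_{-1})`. -/
def logCondDens (f : Fin 2 → (n : ℕ) → (Fin n → E d) → ℝ) (i : Fin 2) (m : ℕ) (ω : Traj d) : ℝ :=
  logDens f i (-(m : ℤ)) (m + 1) ω - logDens f i (-(m : ℤ)) m ω

/-- The derivative in the direction `x` of the variable `y_0` of the log-density of the block
`(Y_{-m}, …, Y_k)`. -/
def dirDeriv (f : Fin 2 → (n : ℕ) → (Fin n → E d) → ℝ) (i : Fin 2) (m k : ℕ) (ω : Traj d)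
    (x : E d) : ℝ :=
  fderiv ℝ (f i (m + k + 1)) (window ω (-(m : ℤ)) (m + k + 1)) (Pi.single ⟨m, by omega⟩ x)

theorem logDens_timeShift (f : Fin 2 → (n : ℕ) → (Fin n → E d) → ℝ) (i : Fin 2) (a t : ℤ) (n : ℕ)
    (ω : Traj d) : logDens f i a n (timeShift t ω) = logDens f i (a + t) n ω := by
  simp only [logDens, window_timeShift]

theorem logCondDens_timeShift (f : Fin 2 → (n : ℕ) → (Fin n → E d) → ℝ) (i : Fin 2) (m : ℕ) (t : ℤ) (ω : Traj d) :
    logCondDens f i m (timeShift t ω) =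
      logDens f i (t - m) (m + 1) ω - logDens f i (t - m) m ω := by
  simp only [logCondDens, logDens_timeShift]
  rw [neg_add_eq_sub]

/-- A stationary process with values in `U` whose blocks have density `exp (f 0 n)`, and a second
family `f 1` of log-densities, with polynomial forgetting under the first law. -/
structure IsSystem (U : Set (E d)) (P : Measure (Traj d))
    (f : Fin 2 → (n : ℕ) → (Fin n → E d) → ℝ) (C D C₁ ρ : ℝ) (u₀ : E d) (Ce ε : ℝ) : Prop where
  domain : IsConvexDomain U D ρ u₀
  dim : 1 ≤ d
  prob : IsProbabilityMeasure P
  mem : ∀ᵐ ω ∂P, ∀ k, ω k ∈ U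
  shift : MeasurePreserving shift P P
  law : ∀ n, P.map (fun ω => window ω 1 n) = blockLaw U (f 0 n)
  measurable : ∀ i n, Measurable (f i n)
  third : ∀ i n, HasBoundedThird U n C (f i n)
  grad : ∀ i n (k : Fin n) (x : E d),
    ∫⁻ ω, ‖fderiv ℝ (f i n) (window ω 1 n) (Pi.single k x)‖ₑ ∂P ≤ ENNReal.ofReal (C₁ * ‖x‖)
  integrable_zero : ∀ i, Integrable (logCondDens f i 0) P
  forget : ∀ i m m', m ≤ m' → ∫⁻ ω, ‖logCondDens f i m ω - logCondDens f i m' ω‖ₑ ∂P ≤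
    ENNReal.ofReal (Ce / (1 + (m : ℝ)) ^ (6 + ε))
  C_nonneg : 0 ≤ C
  one_le_C₁ : 1 ≤ C₁
  Ce_nonneg : 0 ≤ Ce
  ε_pos : 0 < ε
  -- Forgetting at some exponent implies forgetting at smaller ones. The cap ensures that errors of
  -- order s^{-4} are within s^{-(3+ε)}.
  ε_le_one : ε ≤ 1

namespace IsSystem

variable {U : Set (E d)} {P : Measure (Traj d)} {f : Fin 2 → (n : ℕ) → (Fin n → E d) → ℝ}
  {C D C₁ ρ : ℝ} {u₀ : E d} {Ce ε : ℝ} (S : IsSystem U P f C D C₁ ρ u₀ Ce ε)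

include S

theorem map_window (a : ℤ) (n : ℕ) : P.map (fun ω => window ω a n) = blockLaw U (f 0 n) := by
  rw [← S.law n]
  conv_lhs => rw [← (measurePreserving_timeShift S.shift (1 - a)).map_eq]
  rw [Measure.map_map (measurable_window _ _) (measurable_timeShift _)]
  congr 1
  ext1 ω
  simp [window_timeShift]

theorem measurePreserving_window (a : ℤ) (n : ℕ) :
    MeasurePreserving (fun ω => window ω a n) P (blockLaw U (f 0 n)) :=
  ⟨measurable_window a n, S.map_window a n⟩

theorem window_mem : ∀ᵐ ω ∂P, ∀ a n, window ω a n ∈ box U n := by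
  filter_upwards [S.mem] with ω hω a n k _
  exact hω _

theorem measurable_logDens (i : Fin 2) (a : ℤ) (n : ℕ) : Measurable (logDens f i a n) :=
  (S.measurable i n).comp (measurable_window a n)

theorem measurable_logCondDens (i : Fin 2) (m : ℕ) : Measurable (logCondDens f i m) :=
  (S.measurable_logDens _ _ _).sub (S.measurable_logDens _ _ _)

theorem isBlockPair (n : ℕ) : IsBlockPair U C D C₁ n (fun i => f i n) where
  measurable i := S.measurable i n
  third i := S.third i n
  prob := by
    have := S.prob
    rw [← S.law n]
    exact Measure.isProbabilityMeasure_map (measurable_window 1 n).aemeasurable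
  grad i k x := by
    have hm := measurable_fderiv_apply_single (f i n) (Pi.single k x)
    have h := S.grad i n k x
    rw [← lintegral_map (μ := P) (g := fun ω => window ω 1 n)
      (f := fun y => ‖fderiv ℝ (f i n) y (Pi.single k x)‖ₑ) hm.enorm (measurable_window 1 n),
      S.law n] at h
    have hi : Integrable (fun y => fderiv ℝ (f i n) y (Pi.single k x)) (blockLaw U (f 0 n)) :=
      ⟨hm.aestronglyMeasurable, h.trans_lt ENNReal.ofReal_lt_top⟩
    refine ⟨hi, ?_⟩
    rw [integral_eq_lintegral_of_nonneg_ae (Eventually.of_forall fun _ => abs_nonneg _)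
      hm.abs.aestronglyMeasurable]
    simp only [Real.enorm_eq_ofReal_abs] at h
    have hC : 0 ≤ C₁ := zero_le_one.trans S.one_le_C₁
    exact ENNReal.toReal_le_of_le_ofReal (by positivity) h

theorem integrable_logCondDens (i : Fin 2) (m : ℕ) : Integrable (logCondDens f i m) P := by
  have h : Integrable (fun ω => logCondDens f i 0 ω - logCondDens f i m ω) P :=
    ⟨((S.measurable_logCondDens i 0).sub (S.measurable_logCondDens i m)).aestronglyMeasurable,
      (S.forget i 0 m (Nat.zero_le m)).trans_lt ENNReal.ofReal_lt_top⟩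
  convert (S.integrable_zero i).sub h using 1
  ext ω; simp

theorem integral_abs_logCondDens_sub_le (i : Fin 2) {m m' : ℕ} (h : m ≤ m') :
    ∫ ω, |logCondDens f i m ω - logCondDens f i m' ω| ∂P ≤ Ce / (1 + (m : ℝ)) ^ (6 + ε) := by
  have hm : Measurable fun ω => |logCondDens f i m ω - logCondDens f i m' ω| :=
    ((S.measurable_logCondDens i m).sub (S.measurable_logCondDens i m')).abs
  rw [integral_eq_lintegral_of_nonneg_ae (Eventually.of_forall fun _ => abs_nonneg _)
    hm.aestronglyMeasurable]
  have := S.forget i m m' h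
  simp only [Real.enorm_eq_ofReal_abs] at this
  have hC := S.Ce_nonneg
  exact ENNReal.toReal_le_of_le_ofReal (by positivity) this

/-- By the chain rule it is a constant plus shifted conditional log-densities, which are integrable
because the one without past is and forgetting bounds their differences. -/
theorem integrable_logDens (i : Fin 2) (a : ℤ) (n : ℕ) : Integrable (logDens f i a n) P := by
  have := S.prob
  induction n with
  | zero =>
    have : logDens f i a 0 = fun _ => f i 0 (fun _ => u₀) := by
      ext ω; simp only [logDens]; congr 1; exact Subsingleton.elim _ _
    rw [this]; exact integrable_const _
  | succ n ih =>
    have h := ((measurePreserving_timeShift S.shift (a + n)).integrable_comp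
      (S.measurable_logCondDens i n).aestronglyMeasurable).2 (S.integrable_logCondDens i n)
    have e : logDens f i a (n + 1) =
        logDens f i a n + logCondDens f i n ∘ timeShift (a + n) := by
      ext1 ω
      simp only [Pi.add_apply, Function.comp_apply, logCondDens_timeShift]
      rw [add_sub_cancel_right]; ring
    rw [e]
    exact ih.add h

end IsSystem

/-! ### Forgetting of the gradients -/

theorem logDens_add_sub (f : Fin 2 → (n : ℕ) → (Fin n → E d) → ℝ) (i : Fin 2) (a : ℤ) (n j : ℕ)
    (ω : Traj d) : logDens f i a (n + j) ω - logDens f i a n ω =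
      ∑ l ∈ Finset.range j, logCondDens f i (n + l) (timeShift (a + n + l) ω) := by
  induction j with
  | zero => simp
  | succ j ih =>
    rw [Finset.sum_range_succ, ← ih, logCondDens_timeShift]
    have : a + n + j - ((n + j : ℕ) : ℤ) = a := by push_cast; ring
    rw [this, ← add_assoc]; ring

/-- The difference of the log-densities of `(Y_{-m'}, …, Y_{k+j})` and `(Y_{-m}, …, Y_k)`,
corrected by terms that do not depend on `Y_0`. -/
def bridge (f : Fin 2 → (n : ℕ) → (Fin n → E d) → ℝ) (i : Fin 2) (m m' k j : ℕ) (ω : Traj d) :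
    ℝ :=
  logDens f i (-(m' : ℤ)) (m' + (k + j) + 1) ω - logDens f i (-(m' : ℤ)) m' ω -
    (logDens f i (-(m : ℤ)) (m + k + 1) ω - logDens f i (-(m : ℤ)) m ω) -
    (logDens f i 1 (k + j) ω - logDens f i 1 k ω)

/-- The chain rule resolves each log-density into conditional ones. For the times 0, …, k the same
variable is conditioned on pasts reaching back to −m' and to −m. For the j later times the
correction supplies the past that begins at time 1, just after Y_0. So every summand is a forgetting
error. -/
theorem bridge_eq (f : Fin 2 → (n : ℕ) → (Fin n → E d) → ℝ) (i : Fin 2) (m m' k j : ℕ)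
    (ω : Traj d) : bridge f i m m' k j ω =
      (∑ l ∈ Finset.range (k + 1), (logCondDens f i (m' + l) (timeShift l ω) -
        logCondDens f i (m + l) (timeShift l ω))) +
      ∑ l ∈ Finset.range j, (logCondDens f i (m' + (k + 1 + l)) (timeShift (1 + k + l) ω) -
        logCondDens f i (k + l) (timeShift (1 + k + l) ω)) := by
  have h1 := logDens_add_sub f i (-(m' : ℤ)) m' (k + 1 + j) ω
  have h2 := logDens_add_sub f i (-(m : ℤ)) m (k + 1) ω
  have h3 := logDens_add_sub f i 1 k j ω
  rw [Finset.sum_range_add] at h1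
  rw [bridge, Finset.sum_sub_distrib, Finset.sum_sub_distrib, h3,
    show m' + (k + j) + 1 = m' + (k + 1 + j) by ring, h1,
    show m + k + 1 = m + (k + 1) by ring, h2]
  simp only [neg_add_cancel, zero_add]
  have : ∀ x : ℕ, ((k + 1 + x : ℕ) : ℤ) = 1 + k + x := fun x => by push_cast; ring
  simp only [this]
  ring

namespace IsSystem

variable {U : Set (E d)} {P : Measure (Traj d)} {f : Fin 2 → (n : ℕ) → (Fin n → E d) → ℝ}
  {C D C₁ ρ : ℝ} {u₀ : E d} {Ce ε : ℝ} (S : IsSystem U P f C D C₁ ρ u₀ Ce ε)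

include S

theorem integral_abs_shifted_sub_le (i : Fin 2) {m m' s : ℕ} (hs : 1 ≤ s) (h : m ≤ m')
    (hms : m = m' ∨ s ≤ m) (t : ℤ) :
    Integrable (fun ω => |logCondDens f i m' (timeShift t ω) -
      logCondDens f i m (timeShift t ω)|) P ∧
    ∫ ω, |logCondDens f i m' (timeShift t ω) - logCondDens f i m (timeShift t ω)| ∂P ≤
      Ce / (s : ℝ) ^ (6 + ε) := by
  have hCe := S.Ce_nonneg
  have hε := S.ε_pos
  have hmp := measurePreserving_timeShift S.shift t
  have hm : Measurable fun ω => |logCondDens f i m' ω - logCondDens f i m ω| :=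
    ((S.measurable_logCondDens i m').sub (S.measurable_logCondDens i m)).abs
  have hi : Integrable (fun ω => |logCondDens f i m' ω - logCondDens f i m ω|) P :=
    ((S.integrable_logCondDens i m').sub (S.integrable_logCondDens i m)).abs
  refine ⟨(hmp.integrable_comp hm.aestronglyMeasurable).2 hi, ?_⟩
  have hs' : (1 : ℝ) ≤ s := by exact_mod_cast hs
  have key : ∫ ω, |logCondDens f i m' ω - logCondDens f i m ω| ∂P ≤ Ce / (s : ℝ) ^ (6 + ε) := by
    rcases hms with rfl | hms
    · simp only [sub_self, abs_zero, integral_zero]; positivity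
    · have h1 := S.integral_abs_logCondDens_sub_le i h
      simp_rw [abs_sub_comm (logCondDens f i m _)] at h1
      refine h1.trans ?_
      have : (s : ℝ) ≤ 1 + m := by
        have : (s : ℝ) ≤ m := by exact_mod_cast hms
        linarith
      gcongr
  have e := hmp.integral_comp' (f := (⟨⟨timeShift t, timeShift (-t), fun ω => by
    funext k; simp [timeShift], fun ω => by funext k; simp [timeShift]⟩,
    measurable_timeShift t, measurable_timeShift (-t)⟩ : Traj d ≃ᵐ Traj d))
    (fun ω => |logCondDens f i m' ω - logCondDens f i m ω|)
  exact (le_of_eq e).trans key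

theorem integrable_bridge (i : Fin 2) (m m' k j : ℕ) : Integrable (bridge f i m m' k j) P :=
  (((S.integrable_logDens _ _ _).sub (S.integrable_logDens _ _ _)).sub
    ((S.integrable_logDens _ _ _).sub (S.integrable_logDens _ _ _))).sub
    ((S.integrable_logDens _ _ _).sub (S.integrable_logDens _ _ _))

theorem measurable_bridge (i : Fin 2) (m m' k j : ℕ) : Measurable (bridge f i m m' k j) :=
  (((S.measurable_logDens _ _ _).sub (S.measurable_logDens _ _ _)).sub
    ((S.measurable_logDens _ _ _).sub (S.measurable_logDens _ _ _))).sub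
    ((S.measurable_logDens _ _ _).sub (S.measurable_logDens _ _ _))

/-- There are k + 1 + j summands. Each is either zero or compares two pasts of length at least s. -/
theorem integral_abs_bridge_le (i : Fin 2) {m m' k j s : ℕ} (hs : 1 ≤ s) (h : m ≤ m')
    (hms : m = m' ∨ s ≤ m) (hks : j = 0 ∨ s ≤ k) :
    ∫ ω, |bridge f i m m' k j ω| ∂P ≤ (k + 1 + j) * (Ce / (s : ℝ) ^ (6 + ε)) := by
  have h1 : ∀ l, _ := fun l : ℕ => S.integral_abs_shifted_sub_le i hs
    (Nat.add_le_add_right h l) (hms.imp (by rintro rfl; rfl) (fun h => h.trans (Nat.le_add_right _ _)))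
    (l : ℤ)
  have h2 : ∀ l ∈ Finset.range j, _ := fun l hl => S.integral_abs_shifted_sub_le i hs
    (m := k + l) (m' := m' + (k + 1 + l)) (by omega) (Or.inr (by
      have := Finset.mem_range.1 hl; omega)) (1 + k + l : ℤ)
  calc ∫ ω, |bridge f i m m' k j ω| ∂P ≤
      ∫ ω, ((∑ l ∈ Finset.range (k + 1), |logCondDens f i (m' + l) (timeShift l ω) -
        logCondDens f i (m + l) (timeShift l ω)|) +
      ∑ l ∈ Finset.range j, |logCondDens f i (m' + (k + 1 + l)) (timeShift (1 + k + l) ω) -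
        logCondDens f i (k + l) (timeShift (1 + k + l) ω)|) ∂P := by
        refine integral_mono (S.integrable_bridge i m m' k j).abs
          ((integrable_finsetSum _ fun l _ => (h1 l).1).add
            (integrable_finsetSum _ fun l hl => (h2 l hl).1)) fun ω => ?_
        simp only [bridge_eq]
        exact (abs_add_le _ _).trans (add_le_add (Finset.abs_sum_le_sum_abs _ _)
          (Finset.abs_sum_le_sum_abs _ _))
    _ = (∑ l ∈ Finset.range (k + 1), ∫ ω, |logCondDens f i (m' + l) (timeShift l ω) -
        logCondDens f i (m + l) (timeShift l ω)| ∂P) +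
      ∑ l ∈ Finset.range j, ∫ ω, |logCondDens f i (m' + (k + 1 + l)) (timeShift (1 + k + l) ω) -
        logCondDens f i (k + l) (timeShift (1 + k + l) ω)| ∂P := by
        rw [integral_add (integrable_finsetSum _ fun l _ => (h1 l).1)
          (integrable_finsetSum _ fun l hl => (h2 l hl).1),
          integral_finsetSum _ fun l _ => (h1 l).1, integral_finsetSum _ fun l hl => (h2 l hl).1]
    _ ≤ (∑ _l ∈ Finset.range (k + 1), Ce / (s : ℝ) ^ (6 + ε)) +
        ∑ _l ∈ Finset.range j, Ce / (s : ℝ) ^ (6 + ε) :=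
        add_le_add (Finset.sum_le_sum fun l _ => (h1 l).2) (Finset.sum_le_sum fun l hl => (h2 l hl).2)
    _ = _ := by simp; ring

/-- Contractions of `Y_0` towards a point increase the means of functions of a block by at most a
constant factor. -/
theorem integral_contract_zero_le {Λ : ℝ} {m n : ℕ} (hmn : m < n)
    (hb : HasBlockBounds U Λ n (fun i => f i n)) {g : Traj d → ℝ} (hg : Measurable g)
    (hgi : Integrable g P) (hdep : ∀ ω, g (extend u₀ (-(m : ℤ)) (window ω (-(m : ℤ)) n)) = g ω)
    {r : ℝ} (hr0 : 0 ≤ r) (hr : r ≤ 1 / (2 * n ^ 2)) {u : E d} (hu : u ∈ U) :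
    Integrable (fun ω => g (Function.update ω 0 (ω 0 + r • (u - ω 0)))) P ∧
    ∫ ω, |g (Function.update ω 0 (ω 0 + r • (u - ω 0)))| ∂P ≤ Λ * ∫ ω, |g ω| ∂P := by
  set G : (Fin n → E d) → ℝ := fun y => g (extend u₀ (-(m : ℤ)) y) with hG
  have hGm : Measurable G := hg.comp (measurable_extend u₀ _ n)
  have hmp := S.measurePreserving_window (-(m : ℤ)) n
  have e1 : g = G ∘ fun ω => window ω (-(m : ℤ)) n := by
    ext ω; simp [hG, hdep]
  have e2 : (fun ω : Traj d => g (Function.update ω 0 (ω 0 + r • (u - ω 0)))) =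
      (fun y => G (contract ⟨m, hmn⟩ r u y)) ∘ fun ω => window ω (-(m : ℤ)) n := by
    ext ω
    rw [← hdep, window_update_zero ω m n hmn]
    simp [hG, contract, window]
  have hGi : Integrable G (blockLaw U (f 0 n)) := by
    rw [e1] at hgi
    exact (hmp.integrable_comp hGm.aestronglyMeasurable).1 hgi
  have hGc : Measurable fun y => G (contract ⟨m, hmn⟩ r u y) := hGm.comp (measurable_contract _ _ _)
  obtain ⟨h1, h2⟩ := hb.contract ⟨m, hmn⟩ r hr0 hr u hu G hGm hGi
  have key : ∀ H : (Fin n → E d) → ℝ, Measurable H →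
      ∫ ω, |H (window ω (-(m : ℤ)) n)| ∂P = ∫ y, |H y| ∂blockLaw U (f 0 n) := fun H hH => by
    rw [← hmp.map_eq, integral_map hmp.measurable.aemeasurable hH.abs.aestronglyMeasurable]
  constructor
  · rw [e2]
    exact (hmp.integrable_comp hGc.aestronglyMeasurable).2 h1
  · have e3 : ∀ ω, g (Function.update ω 0 (ω 0 + r • (u - ω 0))) =
        G (contract ⟨m, hmn⟩ r u (window ω (-(m : ℤ)) n)) := fun ω => congrFun e2 ω
    have e4 : ∀ ω, g ω = G (window ω (-(m : ℤ)) n) := fun ω => congrFun e1 ω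
    simp_rw [e3]
    conv_rhs => simp only [e4]
    rw [key _ hGc, key _ hGm]
    exact h2

omit S in
theorem dirDeriv_add_smul (i : Fin 2) (m k : ℕ) (ω : Traj d) (x x' : E d) (c : ℝ) :
    dirDeriv f i m k ω (x + c • x') = dirDeriv f i m k ω x + c * dirDeriv f i m k ω x' := by
  simp only [dirDeriv, Pi.single_add, Pi.single_smul, map_add, map_smul, smul_eq_mul]

/-- The finite difference of the log-density of `(Y_{-m}, …, Y_k)` in the variable `y_0`. -/
theorem abs_dirDeriv_sub_finite_difference (i : Fin 2) (m k : ℕ) {ω : Traj d}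
    (hω : ∀ t, ω t ∈ U) {u : E d} (hu : u ∈ U) {r : ℝ} (hr : 0 < r) (hr1 : r ≤ 1) :
    |dirDeriv f i m k ω (u - ω 0) - (-3 * logDens f i (-(m : ℤ)) (m + k + 1) ω +
      4 * logDens f i (-(m : ℤ)) (m + k + 1) (Function.update ω 0 (ω 0 + (r / 2) • (u - ω 0))) -
      logDens f i (-(m : ℤ)) (m + k + 1) (Function.update ω 0 (ω 0 + r • (u - ω 0)))) / r| ≤
    2 * (C * D ^ 3) * r ^ 2 := by
  have hy : window ω (-(m : ℤ)) (m + k + 1) ∈ box U (m + k + 1) := fun _ _ => hω _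
  have h := (S.third i (m + k + 1)).abs_fderiv_sub_finite_difference S.domain.isOpen
    S.domain.convex hy (k := ⟨m, by omega⟩) hu hr hr1
  have e : window ω (-(m : ℤ)) (m + k + 1) ⟨m, by omega⟩ = ω 0 := by simp [window]
  rw [e] at h
  simp only [logDens, dirDeriv, window_update_zero ω m (m + k + 1) (by omega)]
  refine h.trans ?_
  have : ‖u - ω 0‖ ≤ D := S.domain.diam _ hu _ (hω 0)
  have := S.C_nonneg
  gcongr

/-- The weights of the finite difference sum to zero, so the correction terms of `bridge`, which do
not involve y_0, drop out of it. Hence the finite difference of `bridge` is that of the difference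
of the two log-densities. -/
theorem abs_dirDeriv_sub_bridge_le (i : Fin 2) (m m' k j : ℕ) {ω : Traj d}
    (hω : ∀ t, ω t ∈ U) {u : E d} (hu : u ∈ U) {r : ℝ} (hr : 0 < r) (hr1 : r ≤ 1) :
    |dirDeriv f i m' (k + j) ω (u - ω 0) - dirDeriv f i m k ω (u - ω 0)| ≤
    (3 * |bridge f i m m' k j ω| +
      4 * |bridge f i m m' k j (Function.update ω 0 (ω 0 + (r / 2) • (u - ω 0)))| +
      |bridge f i m m' k j (Function.update ω 0 (ω 0 + r • (u - ω 0)))|) / r +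
    4 * (C * D ^ 3) * r ^ 2 := by
  have h1 := S.abs_dirDeriv_sub_finite_difference i m' (k + j) hω hu hr hr1
  have h2 := S.abs_dirDeriv_sub_finite_difference i m k hω hu hr hr1
  have hinv : ∀ (x : E d) (a : ℤ) (n : ℕ), (0 < a ∨ a + n ≤ 0) →
      logDens f i a n (Function.update ω 0 x) = logDens f i a n ω := fun x a n h => by
    simp only [logDens, window_update_of_notMem ω a n h]
  have hb : ∀ x : E d, bridge f i m m' k j (Function.update ω 0 x) =
      logDens f i (-(m' : ℤ)) (m' + (k + j) + 1) (Function.update ω 0 x) -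
        logDens f i (-(m' : ℤ)) m' ω -
      (logDens f i (-(m : ℤ)) (m + k + 1) (Function.update ω 0 x) - logDens f i (-(m : ℤ)) m ω) -
      (logDens f i 1 (k + j) ω - logDens f i 1 k ω) := fun x => by
    rw [bridge, hinv x _ m' (by simp), hinv x _ m (by simp), hinv x 1 _ (by simp),
      hinv x 1 _ (by simp)]
  set b0 := bridge f i m m' k j ω with hb0
  set b1 := bridge f i m m' k j (Function.update ω 0 (ω 0 + (r / 2) • (u - ω 0))) with hb1
  set b2 := bridge f i m m' k j (Function.update ω 0 (ω 0 + r • (u - ω 0))) with hb2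
  rw [hb] at hb1 hb2
  rw [bridge] at hb0
  have hdiv : |(-3 * b0 + 4 * b1 - b2) / r| ≤ (3 * |b0| + 4 * |b1| + |b2|) / r := by
    rw [abs_div, abs_of_pos hr]
    gcongr
    calc |-3 * b0 + 4 * b1 - b2| ≤ |-3 * b0 + 4 * b1| + |b2| := abs_sub _ _
      _ ≤ |-3 * b0| + |4 * b1| + |b2| := by gcongr; exact abs_add_le _ _
      _ = _ := by rw [abs_mul, abs_mul]; norm_num
  refine le_trans ?_ (add_le_add_left hdiv _)
  set A1 := logDens f i (-(m' : ℤ)) (m' + (k + j) + 1) ω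
  set A2 := logDens f i (-(m : ℤ)) (m + k + 1) ω
  have e : (-3 * b0 + 4 * b1 - b2) / r =
    (-3 * logDens f i (-(m' : ℤ)) (m' + (k + j) + 1) ω +
      4 * logDens f i (-(m' : ℤ)) (m' + (k + j) + 1)
        (Function.update ω 0 (ω 0 + (r / 2) • (u - ω 0))) -
      logDens f i (-(m' : ℤ)) (m' + (k + j) + 1)
        (Function.update ω 0 (ω 0 + r • (u - ω 0)))) / r -
    (-3 * logDens f i (-(m : ℤ)) (m + k + 1) ω +
      4 * logDens f i (-(m : ℤ)) (m + k + 1) (Function.update ω 0 (ω 0 + (r / 2) • (u - ω 0))) -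
      logDens f i (-(m : ℤ)) (m + k + 1) (Function.update ω 0 (ω 0 + r • (u - ω 0)))) / r := by
    rw [hb0, hb1, hb2]; ring
  have h3 := neg_abs_le ((-3 * b0 + 4 * b1 - b2) / r)
  have h4 := le_abs_self ((-3 * b0 + 4 * b1 - b2) / r)
  rw [abs_le] at h1 h2 ⊢
  constructor
  · linarith [h1.1, h2.2]
  · linarith [h1.2, h2.1]

omit S in
theorem bridge_extend {m m' k j : ℕ} (h : m ≤ m') (i : Fin 2) (ω : Traj d) :
    bridge f i m m' k j (extend u₀ (-(m' : ℤ)) (window ω (-(m' : ℤ)) (m' + (k + j) + 1))) =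
      bridge f i m m' k j ω := by
  have hw : ∀ (b : ℤ) (l : ℕ), -(m' : ℤ) ≤ b → b + l ≤ -(m' : ℤ) + (m' + (k + j) + 1 : ℕ) →
      logDens f i b l (extend u₀ (-(m' : ℤ)) (window ω (-(m' : ℤ)) (m' + (k + j) + 1))) =
        logDens f i b l ω := fun b l h1 h2 => by
    simp only [logDens, window_extend u₀ h1 h2]
  simp only [bridge]
  rw [hw _ _ le_rfl le_rfl, hw _ m' le_rfl (by push_cast; omega), hw _ (m + k + 1) (by omega)
    (by push_cast; omega), hw _ m (by omega) (by push_cast; omega),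
    hw 1 (k + j) (by omega) (by push_cast; omega), hw 1 k (by omega) (by push_cast; omega)]

omit S in
theorem integral_weighted_abs {Ω : Type*} [MeasurableSpace Ω] {μ : Measure Ω}
    [IsProbabilityMeasure μ] {X Y Z : Ω → ℝ} (hX : Integrable X μ) (hY : Integrable Y μ)
    (hZ : Integrable Z μ) (r c : ℝ) :
    Integrable (fun ω => (3 * |X ω| + 4 * |Y ω| + |Z ω|) / r + c) μ ∧
    ∫ ω, ((3 * |X ω| + 4 * |Y ω| + |Z ω|) / r + c) ∂μ =
      (3 * ∫ ω, |X ω| ∂μ + 4 * ∫ ω, |Y ω| ∂μ + ∫ ω, |Z ω| ∂μ) / r + c := by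
  have j0 : Integrable (fun ω => 3 * |X ω|) μ := hX.abs.const_mul 3
  have j1 : Integrable (fun ω => 4 * |Y ω|) μ := hY.abs.const_mul 4
  have j2 : Integrable (fun ω => |Z ω|) μ := hZ.abs
  have j01 : Integrable (fun ω => 3 * |X ω| + 4 * |Y ω|) μ := j0.add j1
  have j012 : Integrable (fun ω => 3 * |X ω| + 4 * |Y ω| + |Z ω|) μ := j01.add j2
  have jr : Integrable (fun ω => (3 * |X ω| + 4 * |Y ω| + |Z ω|) / r) μ := j012.div_const r
  refine ⟨jr.add (integrable_const c), ?_⟩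
  rw [integral_add jr (integrable_const c), integral_div, integral_add j01 j2,
    integral_add j0 j1, integral_const_mul, integral_const_mul]
  simp

/-- Quantitative forgetting of the gradients: the mean change of the gradient when a block of
length of order `s` is extended at distance at least `s` from the variable `y_0`. -/
theorem exists_integral_abs_dirDeriv_sub_le {Λ : ℝ} (hΛ : 0 ≤ Λ)
    (hb : ∀ n, HasBlockBounds U Λ n (fun i => f i n)) :
    ∃ K : ℝ, 0 ≤ K ∧ ∀ (i : Fin 2) (m m' k j s : ℕ), 1 ≤ s → m ≤ m' → (m = m' ∨ s ≤ m) →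
      (j = 0 ∨ s ≤ k) → m' + (k + j) + 1 ≤ 8 * s → ∀ a : Fin d,
      ∫ ω, |dirDeriv f i m' (k + j) ω (EuclideanSpace.single a 1) -
        dirDeriv f i m k ω (EuclideanSpace.single a 1)| ∂P ≤ K / (s : ℝ) ^ (3 + ε) := by
  have hD := S.domain.one_le_D
  have hC := S.C_nonneg
  have hCe := S.Ce_nonneg
  have hρ := S.domain.ρ_pos
  have hε := S.ε_pos
  have := S.prob
  set A : ℝ := (3 + 5 * Λ) * (128 * (8 * Ce)) + 4 * (C * D ^ 3) with hA
  refine ⟨2 * A / ρ, by positivity, fun i m m' k j s hs hm hms hks hn a => ?_⟩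
  set n := m' + (k + j) + 1 with hndef
  have hs' : (1 : ℝ) ≤ s := by exact_mod_cast hs
  have hn' : (n : ℝ) ≤ 8 * s := by exact_mod_cast hn
  have hn1 : (1 : ℝ) ≤ n := by 
    rw [hndef]; push_cast
    linarith [m'.cast_nonneg (α := ℝ), k.cast_nonneg (α := ℝ), j.cast_nonneg (α := ℝ)]
  -- Since n ≤ 8s this is at most 1/(2n²), the longest step under which means are stable. The mean
  -- of `bridge` is of order s · s^{-(6+ε)}, so dividing by r gives s^{-(3+ε)}. The discretization
  -- error is of order r², that is s^{-4}.
  set r : ℝ := 1 / (128 * s ^ 2) with hr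
  have hr0 : 0 < r := by positivity
  have hrn : r ≤ 1 / (2 * n ^ 2) := by
    rw [hr]
    apply one_div_le_one_div_of_le (by positivity)
    nlinarith
  have hr1 : r ≤ 1 := by
    rw [hr, div_le_one (by positivity)]; nlinarith
  have hbr := S.integral_abs_bridge_le i hs hm hms hks
  have hbi := S.integrable_bridge i m m' k j
  have hbm := S.measurable_bridge i m m' k j
  have hdep := bridge_extend (f := f) (u₀ := u₀) (m := m) (m' := m') (k := k) (j := j) hm i
  have key : ∀ u ∈ U,
      Integrable (fun ω => (3 * |bridge f i m m' k j ω| +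
        4 * |bridge f i m m' k j (Function.update ω 0 (ω 0 + (r / 2) • (u - ω 0)))| +
        |bridge f i m m' k j (Function.update ω 0 (ω 0 + r • (u - ω 0)))|) / r +
        4 * (C * D ^ 3) * r ^ 2) P ∧
      ∫ ω, ((3 * |bridge f i m m' k j ω| +
        4 * |bridge f i m m' k j (Function.update ω 0 (ω 0 + (r / 2) • (u - ω 0)))| +
        |bridge f i m m' k j (Function.update ω 0 (ω 0 + r • (u - ω 0)))|) / r +
        4 * (C * D ^ 3) * r ^ 2) ∂P ≤ A / (s : ℝ) ^ (3 + ε) := by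
    intro u hu
    obtain ⟨i1, l1⟩ := S.integral_contract_zero_le (show m' < n by omega) (hb n) hbm hbi hdep
      (half_pos hr0).le ((half_le_self hr0.le).trans hrn) hu
    obtain ⟨i2, l2⟩ := S.integral_contract_zero_le (show m' < n by omega) (hb n) hbm hbi hdep
      hr0.le hrn hu
    obtain ⟨j1, j2⟩ := integral_weighted_abs hbi i1 i2 r (4 * (C * D ^ 3) * r ^ 2)
    refine ⟨j1, ?_⟩
    rw [j2]
    have hsp : (s : ℝ) ^ (6 + ε) = s ^ (3 + ε) * s ^ 3 := by
      rw [← Real.rpow_natCast, ← Real.rpow_add (by linarith)]; norm_num; ring_nf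
    have hsp1 : (s : ℝ) ^ (3 + ε) ≤ s ^ 4 := by
      rw [← Real.rpow_natCast]
      exact Real.rpow_le_rpow_of_exponent_le hs' (by have := S.ε_le_one; norm_num; linarith)
    have hb' : (∫ ω, |bridge f i m m' k j ω| ∂P) / r ≤ 128 * (8 * Ce) / (s : ℝ) ^ (3 + ε) := by
      have hk : ((k : ℝ) + 1 + j) ≤ 8 * s := by
        refine le_trans ?_ hn'
        rw [hndef]; push_cast; linarith [m'.cast_nonneg (α := ℝ)]
      calc _ ≤ ((k + 1 + j) * (Ce / (s : ℝ) ^ (6 + ε))) / r := by gcongr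
        _ ≤ (8 * s * (Ce / (s : ℝ) ^ (6 + ε))) / r := by gcongr
        _ = _ := by rw [hr, hsp]; field_simp
    have hr2 : 4 * (C * D ^ 3) * r ^ 2 ≤ 4 * (C * D ^ 3) / (s : ℝ) ^ (3 + ε) := by
      rw [div_eq_mul_inv]
      gcongr
      rw [hr, div_pow, one_pow, ← one_div]
      apply one_div_le_one_div_of_le (by positivity)
      nlinarith [pow_pos (lt_of_lt_of_le one_pos hs') 4]
    set I0 := ∫ ω, |bridge f i m m' k j ω| ∂P
    have : (3 * I0 +
        4 * ∫ ω, |bridge f i m m' k j (Function.update ω 0 (ω 0 + (r / 2) • (u - ω 0)))| ∂P +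
        ∫ ω, |bridge f i m m' k j (Function.update ω 0 (ω 0 + r • (u - ω 0)))| ∂P) / r ≤
        (3 + 5 * Λ) * (I0 / r) := by
      rw [← mul_div_assoc]
      gcongr
      linarith
    calc _ ≤ (3 + 5 * Λ) * (I0 / r) + 4 * (C * D ^ 3) * r ^ 2 := by linarith
      _ ≤ (3 + 5 * Λ) * (128 * (8 * Ce) / (s : ℝ) ^ (3 + ε)) +
          4 * (C * D ^ 3) / (s : ℝ) ^ (3 + ε) := by gcongr
      _ = _ := by rw [hA]; ring
  -- The finite difference controls the derivative in the direction u − Y_0 only. Subtracting the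
  -- estimates for u₀ and u₀ + ρ e_a isolates the fixed direction e_a.
  have hu0 := S.domain.center_mem
  have hu1 : u₀ + ρ • (EuclideanSpace.single a 1 : E d) ∈ U :=
    S.domain.ball _ (by rw [norm_smul]; simp [abs_of_pos hρ])
  obtain ⟨i0, l0⟩ := key _ hu0
  obtain ⟨i1, l1⟩ := key _ hu1
  have hmain : ∫ ω, |dirDeriv f i m' (k + j) ω (EuclideanSpace.single a 1) -
        dirDeriv f i m k ω (EuclideanSpace.single a 1)| ∂P ≤
      (A / (s : ℝ) ^ (3 + ε) + A / (s : ℝ) ^ (3 + ε)) / ρ := by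
    refine le_trans ?_ (div_le_div_of_nonneg_right (add_le_add l1 l0) hρ.le)
    rw [← integral_add i1 i0, ← integral_div]
    refine integral_mono_of_nonneg (Eventually.of_forall fun _ => abs_nonneg _)
      ((i1.add i0).div_const ρ) ?_
    filter_upwards [S.mem] with ω hω
    have e1 := S.abs_dirDeriv_sub_bridge_le i m m' k j hω hu1 hr0 hr1
    have e0 := S.abs_dirDeriv_sub_bridge_le i m m' k j hω hu0 hr0 hr1
    have hlin : ∀ m k, dirDeriv f i m k ω (u₀ + ρ • (EuclideanSpace.single a 1 : E d) - ω 0) =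
        dirDeriv f i m k ω (u₀ - ω 0) + ρ * dirDeriv f i m k ω (EuclideanSpace.single a 1) :=
      fun m k => by
        rw [← dirDeriv_add_smul]; congr 1; abel
    rw [hlin, hlin] at e1
    rw [le_div_iff₀ hρ]
    refine le_trans ?_ (add_le_add e1 e0)
    set p := dirDeriv f i m' (k + j) ω (u₀ - ω 0)
    set q := dirDeriv f i m k ω (u₀ - ω 0)
    set p' := dirDeriv f i m' (k + j) ω (EuclideanSpace.single a 1)
    set q' := dirDeriv f i m k ω (EuclideanSpace.single a 1)
    have : |p' - q'| * ρ = |(p + ρ * p' - (q + ρ * q')) - (p - q)| := by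
      rw [← abs_of_pos hρ, ← abs_mul, abs_of_pos hρ]; congr 1; ring
    rw [this]
    exact abs_sub _ _
  calc _ ≤ _ := hmain
    _ = _ := by ring

end IsSystem

/-! ### Mean-square convergence of the gradients -/

theorem norm_toLp_sq {Ω : Type*} [MeasurableSpace Ω] {μ : Measure Ω} {X : Ω → ℝ}
    (hX : MemLp X 2 μ) : ‖hX.toLp X‖ ^ 2 = ∫ ω, X ω ^ 2 ∂μ := by
  rw [← real_inner_self_eq_norm_sq, L2.inner_def]
  refine integral_congr_ae ?_
  filter_upwards [hX.coeFn_toLp] with ω hω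
  rw [hω]; simp [sq]

/-- The component `c` of the gradient at `y_0` of the log-density of `(Y_{-m}, …, Y_k)`. -/
def gradCoord (f : Fin 2 → (n : ℕ) → (Fin n → E d) → ℝ) (i : Fin 2) (m k : ℕ) (c : Fin d)
    (ω : Traj d) : ℝ := dirDeriv f i m k ω (EuclideanSpace.single c 1)

theorem measurable_gradCoord (f : Fin 2 → (n : ℕ) → (Fin n → E d) → ℝ) (i : Fin 2) (m k : ℕ)
    (c : Fin d) : Measurable (gradCoord f i m k c) :=
  (measurable_fderiv_apply_single _ _).comp (measurable_window _ _)

namespace IsSystem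

variable {U : Set (E d)} {P : Measure (Traj d)} {f : Fin 2 → (n : ℕ) → (Fin n → E d) → ℝ}
  {C D C₁ ρ : ℝ} {u₀ : E d} {Ce ε : ℝ} (S : IsSystem U P f C D C₁ ρ u₀ Ce ε)
  {Λ : ℝ}

include S

theorem abs_gradCoord_le (hb : ∀ n, HasBlockBounds U Λ n (fun i => f i n)) (i : Fin 2) (m k : ℕ)
    (c : Fin d) : ∀ᵐ ω ∂P, |gradCoord f i m k c ω| ≤ Λ * ((m + k + 1 : ℕ) : ℝ) ^ 2 := by
  filter_upwards [S.window_mem] with ω hω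
  simpa [gradCoord, dirDeriv] using (hb (m + k + 1)).grad i ⟨m, by omega⟩ _ (hω (-(m : ℤ)) (m + k + 1))
    (EuclideanSpace.single c 1)

theorem memLp_gradCoord (hb : ∀ n, HasBlockBounds U Λ n (fun i => f i n)) (i : Fin 2) (m k : ℕ)
    (c : Fin d) : MemLp (gradCoord f i m k c) 2 P := by
  have := S.prob
  exact MemLp.of_bound (measurable_gradCoord f i m k c).aestronglyMeasurable _
    ((S.abs_gradCoord_le hb i m k c).mono fun ω h => h)

/-- The L² increments over one doubling of the scale are O(1/√s), a geometric series. Truncating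
both lengths by `min` allows a block with very different numbers of variables before and after y_0
to be exhausted by doublings, which gives bounds uniform in the two lengths. -/
theorem exists_norm_gradCoord_sub_le (hΛ : 0 ≤ Λ)
    (hb : ∀ n, HasBlockBounds U Λ n (fun i => f i n)) :
    ∃ B : ℝ, 0 ≤ B ∧ ∀ (i : Fin 2) (a b : ℕ) (c : Fin d) (s k : ℕ), 1 ≤ s → s ≤ k →
      ‖(S.memLp_gradCoord hb i (min a k) (min b k) c).toLp -
        (S.memLp_gradCoord hb i (min a s) (min b s) c).toLp‖ ≤ B / √s := by
  have := S.prob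
  have hε := S.ε_pos
  obtain ⟨K, hK, hstep⟩ := S.exists_integral_abs_dirDeriv_sub_le hΛ hb
  set K' : ℝ := 128 * Λ * K with hK'
  have hshort : ∀ (i : Fin 2) (a b : ℕ) (c : Fin d) (s k : ℕ), 1 ≤ s → s ≤ k → k ≤ 2 * s →
      ‖(S.memLp_gradCoord hb i (min a k) (min b k) c).toLp -
        (S.memLp_gradCoord hb i (min a s) (min b s) c).toLp‖ ≤ √K' / √s := by
    intro i a b c s k hs hsk hk
    have hs' : (1 : ℝ) ≤ s := by exact_mod_cast hs
    rw [← MemLp.toLp_sub, ← Real.sqrt_div' _ (by positivity)]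
    apply Real.le_sqrt_of_sq_le
    rw [norm_toLp_sq]
    obtain ⟨j, hj⟩ := Nat.exists_eq_add_of_le (show min b s ≤ min b k by omega)
    have h1 := hstep i (min a s) (min a k) (min b s) j s hs (by omega) (by omega) (by omega)
      (by omega) c
    rw [← hj] at h1
    -- Interpolation: a square is at most the sup bound, of order s², times the absolute value,
    -- whose mean is of order s^{-3}.
    have hsup : ∀ᵐ ω ∂P, ((gradCoord f i (min a k) (min b k) c - gradCoord f i (min a s) (min b s) c)
        ω) ^ 2 ≤ 128 * Λ * s ^ 2 * |gradCoord f i (min a k) (min b k) c ω -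
          gradCoord f i (min a s) (min b s) c ω| := by
      filter_upwards [S.abs_gradCoord_le hb i (min a k) (min b k) c,
        S.abs_gradCoord_le hb i (min a s) (min b s) c] with ω h2 h3
      have h4 : ((min a k + min b k + 1 : ℕ) : ℝ) ≤ 8 * s := by
        have : min a k + min b k + 1 ≤ 8 * s := by omega
        exact_mod_cast this
      have h5 : ((min a s + min b s + 1 : ℕ) : ℝ) ≤ 8 * s := by
        have : min a s + min b s + 1 ≤ 8 * s := by omega
        exact_mod_cast this
      have h6 : |gradCoord f i (min a k) (min b k) c ω - gradCoord f i (min a s) (min b s) c ω| ≤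
          128 * Λ * s ^ 2 := by
        calc _ ≤ |gradCoord f i (min a k) (min b k) c ω| +
              |gradCoord f i (min a s) (min b s) c ω| := abs_sub _ _
          _ ≤ Λ * (8 * s) ^ 2 + Λ * (8 * s) ^ 2 := by
              gcongr
              · exact h2.trans (by gcongr)
              · exact h3.trans (by gcongr)
          _ = _ := by ring
      rw [Pi.sub_apply, ← sq_abs, sq]
      gcongr
    have hint : Integrable (fun ω => |gradCoord f i (min a k) (min b k) c ω -
        gradCoord f i (min a s) (min b s) c ω|) P :=
      (((S.memLp_gradCoord hb i (min a k) (min b k) c).sub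
        (S.memLp_gradCoord hb i (min a s) (min b s) c)).integrable (by norm_num)).abs
    calc _ ≤ ∫ ω, 128 * Λ * s ^ 2 * |gradCoord f i (min a k) (min b k) c ω -
          gradCoord f i (min a s) (min b s) c ω| ∂P :=
          integral_mono_of_nonneg (Eventually.of_forall fun _ => sq_nonneg _)
            (hint.const_mul _) hsup
      _ ≤ 128 * Λ * s ^ 2 * (K / (s : ℝ) ^ (3 + ε)) := by
          rw [integral_const_mul]
          gcongr
          exact h1
      _ ≤ 128 * Λ * s ^ 2 * (K / (s : ℝ) ^ (3 : ℝ)) := by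
          have : (s : ℝ) ^ (3 : ℝ) ≤ (s : ℝ) ^ (3 + ε) :=
            Real.rpow_le_rpow_of_exponent_le hs' (by linarith)
          gcongr
      _ = K' / s := by
          rw [show (3 : ℝ) = ((3 : ℕ) : ℝ) by norm_num, Real.rpow_natCast, hK']
          field_simp
  refine ⟨4 * √K', by positivity, fun i a b c s k hs hsk => ?_⟩
  induction hN : k - s using Nat.strong_induction_on generalizing s with
  | _ N ih =>
    have hs' : (1 : ℝ) ≤ s := by exact_mod_cast hs
    by_cases hk : k ≤ 2 * s
    · refine (hshort i a b c s k hs hsk hk).trans ?_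
      gcongr
      linarith [Real.sqrt_nonneg K']
    -- Induction over doublings with constant 4√K': it closes because 4/√2 + 1 ≤ 4.
    · have h1 := ih (k - 2 * s) (by omega) (2 * s) (by omega) (by omega) rfl
      have h2 := hshort i a b c s (2 * s) hs (by omega) le_rfl
      refine (norm_sub_le_norm_sub_add_norm_sub _
        (S.memLp_gradCoord hb i (min a (2 * s)) (min b (2 * s)) c).toLp _).trans
        ((add_le_add h1 h2).trans ?_)
      push_cast
      rw [Real.sqrt_mul (show (0 : ℝ) ≤ 2 by norm_num), ← div_div, ← add_div]
      gcongr
      have h7 : (1.4 : ℝ) ≤ √2 := Real.le_sqrt_of_sq_le (by norm_num)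
      have : 4 * √K' / √2 ≤ 3 * √K' := by
        rw [div_le_iff₀ (by positivity)]
        nlinarith [Real.sqrt_nonneg K']
      linarith

/-- Compare with the truncation at scale 1, a block of at most three variables on which the sup
bound is a constant. This uniform second moment is what keeps the error of the block expansion at
n³δ³, where sup bounds alone would give a higher power of n. -/
theorem exists_integral_sq_gradCoord_le (hΛ : 0 ≤ Λ)
    (hb : ∀ n, HasBlockBounds U Λ n (fun i => f i n)) :
    ∃ B : ℝ, 0 ≤ B ∧ ∀ (i : Fin 2) (m k : ℕ) (c : Fin d),
      ∫ ω, gradCoord f i m k c ω ^ 2 ∂P ≤ B := by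
  have := S.prob
  obtain ⟨B, hB, h⟩ := S.exists_norm_gradCoord_sub_le hΛ hb
  refine ⟨(B + 9 * Λ) ^ 2, by positivity, fun i m k c => ?_⟩
  rw [← norm_toLp_sq (S.memLp_gradCoord hb i m k c)]
  have h1 := h i m k c 1 (max 1 (max m k)) le_rfl (le_max_left _ _)
  have e1 : min m (max 1 (max m k)) = m := by omega
  have e2 : min k (max 1 (max m k)) = k := by omega
  simp only [e1, e2, Nat.cast_one, Real.sqrt_one, div_one] at h1
  have h2 : ‖(S.memLp_gradCoord hb i (min m 1) (min k 1) c).toLp‖ ≤ 9 * Λ := by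
    rw [← abs_of_nonneg (by positivity : 0 ≤ 9 * Λ), ← abs_of_nonneg (norm_nonneg _), ← sq_le_sq,
      norm_toLp_sq]
    have : ∀ᵐ ω ∂P, gradCoord f i (min m 1) (min k 1) c ω ^ 2 ≤ (9 * Λ) ^ 2 := by
      filter_upwards [S.abs_gradCoord_le hb i (min m 1) (min k 1) c] with ω hω
      rw [sq_le_sq, abs_of_nonneg (by positivity : 0 ≤ 9 * Λ)]
      refine hω.trans ?_
      have : ((min m 1 + min k 1 + 1 : ℕ) : ℝ) ≤ 3 := by
        have : min m 1 + min k 1 + 1 ≤ 3 := by omega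
        exact_mod_cast this
      calc _ ≤ Λ * 3 ^ 2 := by gcongr
        _ = _ := by ring
    calc _ ≤ ∫ _ω, (9 * Λ) ^ 2 ∂P := integral_mono_of_nonneg
          (Eventually.of_forall fun _ => sq_nonneg _) (integrable_const _) this
      _ = _ := by simp
  have h3 := norm_le_norm_add_norm_sub' (S.memLp_gradCoord hb i m k c).toLp
    (S.memLp_gradCoord hb i (min m 1) (min k 1) c).toLp
  gcongr
  linarith

/-- The components of the gradients of the log-likelihood ratios converge in mean square. -/
theorem exists_limit_gradCoord (hΛ : 0 ≤ Λ)
    (hb : ∀ n, HasBlockBounds U Λ n (fun i => f i n)) (i : Fin 2) (c : Fin d) :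
    ∃ X : Traj d → ℝ, Measurable X ∧ ∃ hX : MemLp X 2 P, ∀ B : ℝ,
      (∀ (a b s k : ℕ), 1 ≤ s → s ≤ k →
      ‖(S.memLp_gradCoord hb i (min a k) (min b k) c).toLp -
        (S.memLp_gradCoord hb i (min a s) (min b s) c).toLp‖ ≤ B / √s) →
      ∀ a b s, 1 ≤ s → s ≤ a → s ≤ b →
        ‖(S.memLp_gradCoord hb i a b c).toLp - hX.toLp‖ ≤ 2 * B / √s := by
  obtain ⟨B₀, hB₀, h₀⟩ := S.exists_norm_gradCoord_sub_le hΛ hb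
  have htend : ∀ B : ℝ, Tendsto (fun s : ℕ => B / √(s : ℝ)) atTop (𝓝 0) := fun B =>
    (Real.tendsto_sqrt_atTop.comp tendsto_natCast_atTop_atTop).const_div_atTop B
  set u : ℕ → Lp ℝ 2 P := fun k => (S.memLp_gradCoord hb i k k c).toLp with hu
  have hu' : ∀ B : ℝ, (∀ (a b s k : ℕ), 1 ≤ s → s ≤ k →
      ‖(S.memLp_gradCoord hb i (min a k) (min b k) c).toLp -
        (S.memLp_gradCoord hb i (min a s) (min b s) c).toLp‖ ≤ B / √s) →
      ∀ s k, 1 ≤ s → s ≤ k → ‖u k - u s‖ ≤ B / √s := fun B hB s k hs hk => by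
    have := hB k k s k hs hk
    simpa only [min_self, min_eq_right hk] using this
  have hcauchy : CauchySeq u := by
    rw [Metric.cauchySeq_iff']
    intro ε hε
    obtain ⟨s, hs⟩ := (((htend B₀).eventually_lt_const hε).and (eventually_ge_atTop 1)).exists
    refine ⟨s, fun k hk => ?_⟩
    rw [dist_eq_norm]
    exact (hu' B₀ (h₀ i · · c) s k hs.2 hk).trans_lt hs.1
  obtain ⟨x, hx⟩ := cauchySeq_tendsto_of_complete hcauchy
  obtain ⟨X, hXm, hX⟩ := (Lp.aestronglyMeasurable x)
  have hXL : MemLp X 2 P := (memLp_congr_ae hX).1 (Lp.memLp x)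
  have hxX : hXL.toLp = x := by
    apply Lp.ext
    exact hXL.coeFn_toLp.trans hX.symm
  refine ⟨X, hXm.measurable, hXL, fun B hB a b s hs hsa hsb => ?_⟩
  rw [hxX]
  have h1 : ‖x - u s‖ ≤ B / √s := by
    refine le_of_tendsto ((hx.sub_const (u s)).norm) ?_
    filter_upwards [eventually_ge_atTop s] with k hk
    exact hu' B hB s k hs hk
  have h2 := hB a b s (max a b) hs (hsa.trans (le_max_left _ _))
  simp only [min_eq_left (le_max_left a b), min_eq_left (le_max_right a b), min_eq_right hsa,
    min_eq_right hsb] at h2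
  rw [norm_sub_rev] at h1
  calc _ ≤ _ := norm_sub_le_norm_sub_add_norm_sub _ (u s) _
    _ ≤ B / √s + B / √s := add_le_add h2 h1
    _ = _ := by ring

end IsSystem

/-! ### Loss of divergence on a small cell -/

theorem abs_log_one_add_le {t : ℝ} (ht : |t| ≤ 3 / 10) :
    |Real.log (1 + t) - t + t ^ 2 / 2| ≤ 2 * |t| ^ 3 := by
  have h := Real.abs_log_sub_add_sum_range_le (x := -t) (by rw [abs_neg]; linarith) 2
  simp only [Finset.sum_range_succ, Finset.sum_range_zero, abs_neg, sub_neg_eq_add] at h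
  have e : Real.log (1 + t) - t + t ^ 2 / 2 =
      0 + (-t) ^ (0 + 1) / ((0 : ℕ) + 1 : ℝ) + (-t) ^ (1 + 1) / ((1 : ℕ) + 1 : ℝ) +
        Real.log (1 + t) := by
    push_cast; ring
  rw [e]
  refine h.trans ?_
  rw [div_le_iff₀ (by linarith)]
  have : 0 ≤ |t| ^ 3 := by positivity
  norm_num
  nlinarith

theorem abs_exp_sub_quadratic_le {x : ℝ} (hx : |x| ≤ 1) :
    |Real.exp x - (1 + x + x ^ 2 / 2)| ≤ |x| ^ 3 := by
  have h := Real.exp_bound hx (n := 3) (by norm_num)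
  simp only [Finset.sum_range_succ, Finset.sum_range_zero, Nat.factorial] at h
  have h3 : 0 ≤ |x| ^ 3 := by positivity
  calc _ = _ := by congr 1; push_cast; ring
    _ ≤ _ := h
    _ ≤ |x| ^ 3 * 1 := by gcongr; norm_num
    _ = _ := mul_one _

/-- Here m and s stand for the first two moments of a small function and 1 + t for the mean of its
exponential. The lemma is the expansion of the cumulant generating function to second order. -/
theorem abs_log_cumulant_le {m s t τ : ℝ} (hτ0 : 0 ≤ τ) (hτ : τ ≤ 1 / 4) (hm : |m| ≤ τ)
    (hs : |s| ≤ τ ^ 2) (ht : |t - (m + s / 2)| ≤ τ ^ 3) :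
    |t| ≤ 3 / 2 * τ ∧ |t - m| ≤ τ ^ 2 ∧
    |Real.log (1 + t) - (m + s / 2 - m ^ 2 / 2)| ≤ 9 * τ ^ 3 := by
  have hτ3 : τ ^ 3 ≤ τ ^ 2 / 4 := by nlinarith [sq_nonneg τ]
  have hτ2 : τ ^ 2 ≤ τ / 4 := by nlinarith
  have h1 : |t - m| ≤ 3 / 4 * τ ^ 2 := by
    rw [abs_le] at *
    constructor <;> linarith [ht.1, ht.2, hs.1, hs.2]
  have h2 : |t| ≤ 19 / 16 * τ := by
    rw [abs_le] at *
    constructor <;> linarith [h1.1, h1.2, hm.1, hm.2]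
  refine ⟨by linarith, h1.trans (by nlinarith [sq_nonneg τ]), ?_⟩
  have h3 := abs_log_one_add_le (t := t) (by linarith)
  have h4 : |t| ^ 3 ≤ (19 / 16 * τ) ^ 3 := by gcongr
  have h5 : |t ^ 2 - m ^ 2| ≤ 3 / 4 * τ ^ 2 * (9 / 4 * τ) := by
    rw [show t ^ 2 - m ^ 2 = (t - m) * (t + m) by ring, abs_mul]
    have : |t + m| ≤ 9 / 4 * τ := (abs_add_le _ _).trans (by linarith)
    gcongr
  have e : Real.log (1 + t) - (m + s / 2 - m ^ 2 / 2) =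
      (Real.log (1 + t) - t + t ^ 2 / 2) + (t - (m + s / 2)) - (t ^ 2 - m ^ 2) / 2 := by ring
  rw [e]
  have hp : 0 ≤ τ ^ 3 := by positivity
  rw [abs_le] at *
  constructor <;> nlinarith [h3.1, h3.2, h5.1, h5.2, ht.1, ht.2]

/-- Here m is the mean of a, 1 + t the mean of exp a, X the mean of exp a · (a − b), β the mean of a
− b, and γ that of a (a − b). The quotient is the mean of a − b under the law tilted by exp a. -/
theorem abs_tilt_le {m t β γ X τ : ℝ} (hτ0 : 0 ≤ τ) (hτ : τ ≤ 1 / 4) (hm : |m| ≤ τ)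
    (ht : |t| ≤ 3 / 2 * τ) (htm : |t - m| ≤ τ ^ 2) (hβ : |β| ≤ 2 * τ) (hγ : |γ| ≤ 2 * τ ^ 2)
    (hX : |X - (β + γ)| ≤ 2 * τ ^ 3) :
    |X / (1 + t) - (β + γ - m * β)| ≤ 20 * τ ^ 3 := by
  have ht' : 5 / 8 ≤ 1 + t := by
    rw [abs_le] at ht; linarith [ht.1]
  have hpos : 0 < 1 + t := by linarith
  have e : X / (1 + t) - (β + γ - m * β) =
      ((X - (β + γ)) - (t - m) * β - t * γ + t * m * β) / (1 + t) := by
    field_simp; ring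
  rw [e, abs_div, abs_of_pos hpos, div_le_iff₀ hpos]
  have h1 : |(t - m) * β| ≤ τ ^ 2 * (2 * τ) := by rw [abs_mul]; gcongr
  have h2 : |t * γ| ≤ 3 / 2 * τ * (2 * τ ^ 2) := by rw [abs_mul]; gcongr
  have h3 : |t * m * β| ≤ 3 / 2 * τ * τ * (2 * τ) := by rw [abs_mul, abs_mul]; gcongr
  have hp : 0 ≤ τ ^ 3 := by positivity
  have h4 : 20 * τ ^ 3 * (5 / 8) ≤ 20 * τ ^ 3 * (1 + t) := by gcongr
  refine le_trans ?_ h4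
  rw [abs_le] at *
  constructor <;> nlinarith [h1.1, h1.2, h2.1, h2.2, h3.1, h3.2, hX.1, hX.2]

section Gap

variable {X : Type*} [MeasurableSpace X]

/-- The loss of relative entropy when two densities are replaced by their means. -/
def divergenceGap (μ : Measure X) (u v : X → ℝ) : ℝ :=
  ∫ x, u x * Real.log (u x / v x) ∂μ -
    (∫ x, u x ∂μ) * Real.log ((∫ x, u x ∂μ) / ∫ x, v x ∂μ)

/-- The variance of a function. -/
def spread (μ : Measure X) (φ : X → ℝ) : ℝ := ∫ x, φ x ^ 2 ∂μ - (∫ x, φ x ∂μ) ^ 2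

theorem integrable_of_abs_le {μ : Measure X} [IsFiniteMeasure μ] {g : X → ℝ} (hg : Measurable g)
    {K : ℝ} (h : ∀ᵐ x ∂μ, |g x| ≤ K) : Integrable g μ :=
  Integrable.of_bound hg.aestronglyMeasurable K h

theorem abs_integral_le_of_ae {μ : Measure X} [IsProbabilityMeasure μ] {g : X → ℝ} {K : ℝ}
    (h : ∀ᵐ x ∂μ, |g x| ≤ K) : |∫ x, g x ∂μ| ≤ K := by
  have := norm_integral_le_of_norm_le_const (μ := μ) (f := g) (C := K) h
  simpa using this

/-- The tilted mean of a − b is E[a−b] + Cov(a, a−b), and the logarithms contribute −E[a] − Var(a)/2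
and E[b] + Var(b)/2. First-order terms cancel and the rest is half the variance of a − b. The error
38 is 20 from the tilt and 9 from each logarithm. -/
theorem abs_entropy_expansion {μ : Measure X} [IsProbabilityMeasure μ] {a b : X → ℝ}
    (ha : Measurable a) (hb : Measurable b) {τ : ℝ} (hτ : τ ≤ 1 / 4)
    (ha' : ∀ᵐ x ∂μ, |a x| ≤ τ) (hb' : ∀ᵐ x ∂μ, |b x| ≤ τ) :
    |(∫ x, Real.exp (a x) * (a x - b x) ∂μ) / (∫ x, Real.exp (a x) ∂μ) -
        Real.log (∫ x, Real.exp (a x) ∂μ) + Real.log (∫ x, Real.exp (b x) ∂μ) -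
        1 / 2 * spread μ (fun x => a x - b x)| ≤ 38 * τ ^ 3 := by
  have hτ0 : 0 ≤ τ := by
    obtain ⟨x, hx⟩ := ha'.exists
    exact (abs_nonneg _).trans hx
  have hexp : ∀ c : X → ℝ, Measurable c → (∀ᵐ x ∂μ, |c x| ≤ τ) →
      |(∫ x, c x ∂μ)| ≤ τ ∧ |∫ x, c x ^ 2 ∂μ| ≤ τ ^ 2 ∧
      |(∫ x, Real.exp (c x) ∂μ - 1) - (∫ x, c x ∂μ + (∫ x, c x ^ 2 ∂μ) / 2)| ≤ τ ^ 3 := by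
    intro c hc hc'
    have i1 : Integrable c μ := integrable_of_abs_le hc hc'
    have b2 : ∀ᵐ x ∂μ, |c x ^ 2| ≤ τ ^ 2 := by
      filter_upwards [hc'] with x hx
      rw [abs_pow]; gcongr
    have i2 : Integrable (fun x => c x ^ 2) μ := integrable_of_abs_le (hc.pow_const 2) b2
    have i3 : Integrable (fun x => Real.exp (c x)) μ :=
      integrable_of_abs_le hc.exp (K := Real.exp τ) (by
        filter_upwards [hc'] with x hx
        rw [abs_of_pos (Real.exp_pos _)]
        exact Real.exp_le_exp.2 ((le_abs_self _).trans hx))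
    refine ⟨abs_integral_le_of_ae hc', abs_integral_le_of_ae b2, ?_⟩
    have j1 : Integrable (fun x => 1 + c x) μ := (integrable_const 1).add i1
    have j2 : Integrable (fun x => 1 + c x + c x ^ 2 / 2) μ := j1.add (i2.div_const 2)
    have e : (∫ x, Real.exp (c x) ∂μ - 1) - (∫ x, c x ∂μ + (∫ x, c x ^ 2 ∂μ) / 2) =
        ∫ x, (Real.exp (c x) - (1 + c x + c x ^ 2 / 2)) ∂μ := by
      rw [integral_sub i3 j2, integral_add j1 (i2.div_const 2),
        integral_add (integrable_const 1) i1, integral_div]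
      simp; ring
    rw [e]
    refine abs_integral_le_of_ae ?_
    filter_upwards [hc'] with x hx
    refine (abs_exp_sub_quadratic_le (by linarith)).trans ?_
    gcongr
  obtain ⟨hma, hsa, hta⟩ := hexp a ha ha'
  obtain ⟨hmb, hsb, htb⟩ := hexp b hb hb'
  set ma := ∫ x, a x ∂μ with hma_def
  set mb := ∫ x, b x ∂μ with hmb_def
  set sa := ∫ x, a x ^ 2 ∂μ with hsa_def
  set sb := ∫ x, b x ^ 2 ∂μ with hsb_def
  set ta := ∫ x, Real.exp (a x) ∂μ - 1 with hta_def
  set tb := ∫ x, Real.exp (b x) ∂μ - 1 with htb_def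
  have iA : ∫ x, Real.exp (a x) ∂μ = 1 + ta := by rw [hta_def]; ring
  have iB : ∫ x, Real.exp (b x) ∂μ = 1 + tb := by rw [htb_def]; ring
  obtain ⟨ha1, ha2, ha3⟩ := abs_log_cumulant_le hτ0 hτ hma hsa hta
  obtain ⟨-, -, hb3⟩ := abs_log_cumulant_le hτ0 hτ hmb hsb htb
  have i1 : Integrable a μ := integrable_of_abs_le ha ha'
  have i2 : Integrable b μ := integrable_of_abs_le hb hb'
  have babs : ∀ᵐ x ∂μ, |a x - b x| ≤ 2 * τ := by
    filter_upwards [ha', hb'] with x h1 h2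
    exact (abs_sub _ _).trans (by linarith)
  have bab : ∀ᵐ x ∂μ, |a x * (a x - b x)| ≤ 2 * τ ^ 2 := by
    filter_upwards [ha', babs] with x h1 h2
    rw [abs_mul]
    calc _ ≤ τ * (2 * τ) := by gcongr
      _ = _ := by ring
  have i3 : Integrable (fun x => a x - b x) μ := i1.sub i2
  have i4 : Integrable (fun x => a x * (a x - b x)) μ :=
    integrable_of_abs_le (ha.mul (ha.sub hb)) bab
  have hβ : |∫ x, (a x - b x) ∂μ| ≤ 2 * τ := abs_integral_le_of_ae babs
  have hγ : |∫ x, a x * (a x - b x) ∂μ| ≤ 2 * τ ^ 2 := abs_integral_le_of_ae bab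
  have hdiff : ∀ᵐ x ∂μ, |Real.exp (a x) * (a x - b x) - (a x - b x) - a x * (a x - b x)| ≤
      2 * τ ^ 3 := by
    filter_upwards [ha', babs] with x h1 h2
    rw [show Real.exp (a x) * (a x - b x) - (a x - b x) - a x * (a x - b x) =
      (Real.exp (a x) - 1 - a x) * (a x - b x) by ring, abs_mul]
    have h3 := Real.abs_exp_sub_one_sub_id_le (x := a x) (by linarith)
    have h4 : a x ^ 2 ≤ τ ^ 2 := by rw [← sq_abs]; gcongr
    calc _ ≤ τ ^ 2 * (2 * τ) := by gcongr; exact h3.trans h4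
      _ = _ := by ring
  have i5 : Integrable (fun x => Real.exp (a x) * (a x - b x)) μ := by
    have h1 : Integrable (fun x => Real.exp (a x) * (a x - b x) - (a x - b x) -
        a x * (a x - b x)) μ := integrable_of_abs_le
      (((ha.exp.mul (ha.sub hb)).sub (ha.sub hb)).sub (ha.mul (ha.sub hb))) hdiff
    have h2 := (h1.add i4).add i3
    refine h2.congr (Eventually.of_forall fun x => ?_)
    simp only [Pi.add_apply]; ring
  have hX : |∫ x, Real.exp (a x) * (a x - b x) ∂μ -
      (∫ x, (a x - b x) ∂μ + ∫ x, a x * (a x - b x) ∂μ)| ≤ 2 * τ ^ 3 := by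
    have h56 : Integrable (fun x => Real.exp (a x) * (a x - b x) - (a x - b x)) μ := i5.sub i3
    rw [← sub_sub, ← integral_sub i5 i3, ← integral_sub h56 i4]
    exact abs_integral_le_of_ae hdiff
  have hT := abs_tilt_le hτ0 hτ hma ha1 ha2 hβ hγ hX
  have iab : Integrable (fun x => a x * b x) μ := integrable_of_abs_le (ha.mul hb)
    (K := τ * τ) (by
      filter_upwards [ha', hb'] with x h1 h2
      rw [abs_mul]; gcongr)
  have ia2 : Integrable (fun x => a x ^ 2) μ := integrable_of_abs_le (ha.pow_const 2)
    (K := τ ^ 2) (by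
      filter_upwards [ha'] with x h1
      rw [abs_pow]; gcongr)
  have ib2 : Integrable (fun x => b x ^ 2) μ := integrable_of_abs_le (hb.pow_const 2)
    (K := τ ^ 2) (by
      filter_upwards [hb'] with x h1
      rw [abs_pow]; gcongr)
  have eβ : ∫ x, (a x - b x) ∂μ = ma - mb := integral_sub i1 i2
  have eγ : ∫ x, a x * (a x - b x) ∂μ = sa - ∫ x, a x * b x ∂μ := by
    rw [hsa_def, ← integral_sub ia2 iab]
    congr 1; ext x; ring
  have eS : ∫ x, (a x - b x) ^ 2 ∂μ = sa - 2 * ∫ x, a x * b x ∂μ + sb := by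
    have h1 : Integrable (fun x => a x ^ 2 - 2 * (a x * b x)) μ := ia2.sub (iab.const_mul 2)
    rw [hsa_def, hsb_def, ← integral_const_mul, ← integral_sub ia2 (iab.const_mul 2),
      ← integral_add h1 ib2]
    congr 1; ext x; ring
  rw [spread, eβ, eS, iA, iB]
  rw [eβ, eγ, iA.symm.trans iA] at hT
  rw [abs_le] at hT ha3 hb3 ⊢
  obtain ⟨hT1, hT2⟩ := hT
  obtain ⟨ha31, ha32⟩ := ha3
  obtain ⟨hb31, hb32⟩ := hb3
  clear_value ma mb sa sb ta tb
  clear hexp ha' hb' babs bab hdiff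
  constructor
  · linarith
  · linarith

/-- Variance ignores the constant c, and it is quadratic: the change is the size τ times the
perturbation e. -/
theorem abs_spread_sub_le {μ : Measure X} [IsProbabilityMeasure μ] {b φ : X → ℝ}
    (hb : Measurable b) (hφ : Measurable φ) {τ e c : ℝ}
    (hb' : ∀ᵐ x ∂μ, |b x| ≤ τ) (hφ' : ∀ᵐ x ∂μ, |φ x - c| ≤ τ)
    (he : ∀ᵐ x ∂μ, |b x - (φ x - c)| ≤ e) : |spread μ b - spread μ φ| ≤ 4 * τ * e := by
  have hτ0 : 0 ≤ τ := by
    obtain ⟨x, hx⟩ := hb'.exists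
    exact (abs_nonneg _).trans hx
  have i1 : Integrable b μ := integrable_of_abs_le hb hb'
  have i2 : Integrable (fun x => φ x - c) μ := integrable_of_abs_le (hφ.sub_const c) hφ'
  have iφ : Integrable φ μ := by
    have := i2.add (integrable_const c)
    refine this.congr (Eventually.of_forall fun x => by simp)
  have i3 : Integrable (fun x => b x ^ 2) μ := integrable_of_abs_le (hb.pow_const 2)
    (K := τ ^ 2) (by
      filter_upwards [hb'] with x h1
      rw [abs_pow]; gcongr)
  have i4 : Integrable (fun x => (φ x - c) ^ 2) μ :=
    integrable_of_abs_le ((hφ.sub_const c).pow_const 2) (K := τ ^ 2) (by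
      filter_upwards [hφ'] with x h1
      rw [abs_pow]; gcongr)
  have e1 : spread μ φ = ∫ x, (φ x - c) ^ 2 ∂μ - (∫ x, (φ x - c) ∂μ) ^ 2 := by
    have h1 : ∫ x, (φ x - c) ∂μ = ∫ x, φ x ∂μ - c := by
      rw [integral_sub iφ (integrable_const c)]; simp
    have h2 : ∫ x, φ x ^ 2 ∂μ = ∫ x, (φ x - c) ^ 2 ∂μ + 2 * c * ∫ x, (φ x - c) ∂μ + c ^ 2 := by
      have j : Integrable (fun x => (φ x - c) ^ 2 + 2 * c * (φ x - c)) μ :=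
        i4.add (i2.const_mul _)
      have h3 : ∫ x, φ x ^ 2 ∂μ = ∫ x, ((φ x - c) ^ 2 + 2 * c * (φ x - c) + c ^ 2) ∂μ := by
        congr 1; ext x; ring
      rw [h3, integral_add j (integrable_const _), integral_add i4 (i2.const_mul _),
        integral_const_mul]
      simp
    rw [spread, h2, h1]; ring
  rw [e1, spread]
  have h1 : |∫ x, b x ^ 2 ∂μ - ∫ x, (φ x - c) ^ 2 ∂μ| ≤ 2 * τ * e := by
    rw [← integral_sub i3 i4]
    refine abs_integral_le_of_ae ?_
    filter_upwards [hb', hφ', he] with x h1 h2 h3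
    rw [show b x ^ 2 - (φ x - c) ^ 2 = (b x + (φ x - c)) * (b x - (φ x - c)) by ring, abs_mul]
    have : |b x + (φ x - c)| ≤ 2 * τ := (abs_add_le _ _).trans (by linarith)
    gcongr
  have h2 : |(∫ x, b x ∂μ) ^ 2 - (∫ x, (φ x - c) ∂μ) ^ 2| ≤ 2 * τ * e := by
    have k1 := abs_integral_le_of_ae hb'
    have k2 := abs_integral_le_of_ae hφ'
    have k3 : |∫ x, b x ∂μ - ∫ x, (φ x - c) ∂μ| ≤ e := by
      rw [← integral_sub i1 i2]; exact abs_integral_le_of_ae he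
    rw [show (∫ x, b x ∂μ) ^ 2 - (∫ x, (φ x - c) ∂μ) ^ 2 =
      (∫ x, b x ∂μ + ∫ x, (φ x - c) ∂μ) * (∫ x, b x ∂μ - ∫ x, (φ x - c) ∂μ) by ring, abs_mul]
    have : |∫ x, b x ∂μ + ∫ x, (φ x - c) ∂μ| ≤ 2 * τ := (abs_add_le _ _).trans (by linarith)
    gcongr
  rw [abs_le] at *
  constructor <;> linarith [h1.1, h1.2, h2.1, h2.2]

/-- The loss of relative entropy on one cell on which the log-densities are close to the functions
`φ` and `ψ`. -/
theorem abs_divergenceGap_sub_le {μ : Measure X} [IsProbabilityMeasure μ] {u v φ ψ : X → ℝ}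
    (hu : Measurable u) (hv : Measurable v) (hφ : Measurable φ) (hψ : Measurable ψ) {A : Set X}
    (hA : ∀ᵐ x ∂μ, x ∈ A) (hu0 : ∀ x ∈ A, 0 < u x) (hv0 : ∀ x ∈ A, 0 < v x) {x₀ : X}
    (hx₀ : x₀ ∈ A) {e τ : ℝ} (hτ : τ ≤ 1 / 4)
    (hue : ∀ x ∈ A, |Real.log (u x) - Real.log (u x₀) - (φ x - φ x₀)| ≤ e)
    (hve : ∀ x ∈ A, |Real.log (v x) - Real.log (v x₀) - (ψ x - ψ x₀)| ≤ e)
    (hφτ : ∀ x ∈ A, |φ x - φ x₀| + e ≤ τ) (hψτ : ∀ x ∈ A, |ψ x - ψ x₀| + e ≤ τ) :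
    |divergenceGap μ u v - 1 / 2 * (∫ x, u x ∂μ) * spread μ (fun x => φ x - ψ x)| ≤
      (∫ x, u x ∂μ) * (38 * τ ^ 3 + 8 * τ * e) := by
  have he0 : 0 ≤ e := (abs_nonneg _).trans (hue x₀ hx₀)
  have hτ0 : 0 ≤ τ := (add_nonneg (abs_nonneg _) he0).trans (hφτ x₀ hx₀)
  set a : X → ℝ := fun x => Real.log (u x) - Real.log (u x₀) with ha
  set b : X → ℝ := fun x => Real.log (v x) - Real.log (v x₀) with hb
  have ham : Measurable a := hu.log.sub_const _
  have hbm : Measurable b := hv.log.sub_const _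
  have habs : ∀ x ∈ A, |a x| ≤ τ := fun x hx => by
    have h1 := hue x hx
    have h2 := hφτ x hx
    calc |a x| = |(a x - (φ x - φ x₀)) + (φ x - φ x₀)| := by congr 1; ring
      _ ≤ _ := abs_add_le _ _
      _ ≤ τ := by simp only [ha]; linarith
  have hbbs : ∀ x ∈ A, |b x| ≤ τ := fun x hx => by
    have h1 := hve x hx
    have h2 := hψτ x hx
    calc |b x| = |(b x - (ψ x - ψ x₀)) + (ψ x - ψ x₀)| := by congr 1; ring
      _ ≤ _ := abs_add_le _ _
      _ ≤ τ := by simp only [hb]; linarith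
  have hu' : ∀ x ∈ A, u x = u x₀ * Real.exp (a x) := fun x hx => by
    simp only [ha]
    rw [Real.exp_sub, Real.exp_log (hu0 x hx), Real.exp_log (hu0 x₀ hx₀), mul_div_cancel₀ _
      (hu0 x₀ hx₀).ne']
  have hv' : ∀ x ∈ A, v x = v x₀ * Real.exp (b x) := fun x hx => by
    simp only [hb]
    rw [Real.exp_sub, Real.exp_log (hv0 x hx), Real.exp_log (hv0 x₀ hx₀), mul_div_cancel₀ _
      (hv0 x₀ hx₀).ne']
  have ha' : ∀ᵐ x ∂μ, |a x| ≤ τ := hA.mono habs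
  have hb' : ∀ᵐ x ∂μ, |b x| ≤ τ := hA.mono hbbs
  have key := abs_entropy_expansion ham hbm hτ ha' hb'
  have hsp := abs_spread_sub_le (μ := μ) (b := fun x => a x - b x) (φ := fun x => φ x - ψ x)
    (ham.sub hbm) (hφ.sub hψ) (τ := 2 * τ) (e := 2 * e) (c := φ x₀ - ψ x₀)
    (by
      filter_upwards [ha', hb'] with x h1 h2
      exact (abs_sub _ _).trans (by linarith))
    (by
      filter_upwards [hA] with x hx
      rw [show φ x - ψ x - (φ x₀ - ψ x₀) = (φ x - φ x₀) - (ψ x - ψ x₀) by ring]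
      exact (abs_sub _ _).trans (by linarith [hφτ x hx, hψτ x hx]))
    (by
      filter_upwards [hA] with x hx
      rw [show a x - b x - (φ x - ψ x - (φ x₀ - ψ x₀)) =
        (a x - (φ x - φ x₀)) - (b x - (ψ x - ψ x₀)) by ring]
      exact (abs_sub _ _).trans (by simp only [ha, hb]; linarith [hue x hx, hve x hx]))
  set Ea := ∫ x, Real.exp (a x) ∂μ with hEa
  set Eb := ∫ x, Real.exp (b x) ∂μ with hEb
  have hexpi : ∀ c : X → ℝ, Measurable c → (∀ᵐ x ∂μ, |c x| ≤ τ) →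
      Integrable (fun x => Real.exp (c x)) μ := fun c hc hc' =>
    integrable_of_abs_le hc.exp (K := Real.exp τ) (by
      filter_upwards [hc'] with x hx
      rw [abs_of_pos (Real.exp_pos _)]
      exact Real.exp_le_exp.2 ((le_abs_self _).trans hx))
  have hEapos : 0 < Ea := integral_exp_pos (hexpi a ham ha')
  have hEbpos : 0 < Eb := integral_exp_pos (hexpi b hbm hb')
  have iu : ∫ x, u x ∂μ = u x₀ * Ea := by
    rw [hEa, ← integral_const_mul]
    exact integral_congr_ae (hA.mono fun x hx => hu' x hx)
  have iv : ∫ x, v x ∂μ = v x₀ * Eb := by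
    rw [hEb, ← integral_const_mul]
    exact integral_congr_ae (hA.mono fun x hx => hv' x hx)
  have pu := hu0 x₀ hx₀
  have pv := hv0 x₀ hx₀
  have iuv : ∫ x, u x * Real.log (u x / v x) ∂μ =
      u x₀ * (Real.log (u x₀ / v x₀) * Ea + ∫ x, Real.exp (a x) * (a x - b x) ∂μ) := by
    have j1 : Integrable (fun x => Real.log (u x₀ / v x₀) * Real.exp (a x)) μ :=
      (hexpi a ham ha').const_mul _
    have j2 : Integrable (fun x => Real.exp (a x) * (a x - b x)) μ :=
      integrable_of_abs_le (ham.exp.mul (ham.sub hbm)) (K := Real.exp τ * (2 * τ)) (by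
        filter_upwards [ha', hb'] with x h1 h2
        rw [abs_mul, abs_of_pos (Real.exp_pos _)]
        have h3 : |a x - b x| ≤ 2 * τ := (abs_sub _ _).trans (by linarith)
        have h4 : Real.exp (a x) ≤ Real.exp τ := Real.exp_le_exp.2 ((le_abs_self _).trans h1)
        gcongr)
    rw [hEa, ← integral_const_mul, ← integral_add j1 j2, ← integral_const_mul]
    refine integral_congr_ae (hA.mono fun x hx => ?_)
    beta_reduce
    have : Real.log (u x / v x) = Real.log (u x₀ / v x₀) + (a x - b x) := by
      rw [Real.log_div (hu0 x hx).ne' (hv0 x hx).ne', Real.log_div pu.ne' pv.ne']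
      simp only [ha, hb]; ring
    rw [this, hu' x hx]; ring
  -- With u and v normalized at x₀, the contribution of the constant ratio u x₀ / v x₀ cancels and
  -- only the overall mass u x₀ · Ea remains as a factor.
  have hgap : divergenceGap μ u v = (u x₀ * Ea) *
      ((∫ x, Real.exp (a x) * (a x - b x) ∂μ) / Ea - Real.log Ea + Real.log Eb) := by
    rw [divergenceGap, iuv, iu, iv, mul_div_mul_comm, Real.log_mul (by positivity) (by positivity),
      Real.log_div hEapos.ne' hEbpos.ne']
    field_simp; ring
  rw [hgap, iu]
  have hpos : 0 ≤ u x₀ * Ea := by positivity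
  rw [show u x₀ * Ea *
      ((∫ x, Real.exp (a x) * (a x - b x) ∂μ) / Ea - Real.log Ea + Real.log Eb) -
      1 / 2 * (u x₀ * Ea) * spread μ (fun x => φ x - ψ x) = (u x₀ * Ea) *
      ((∫ x, Real.exp (a x) * (a x - b x) ∂μ) / Ea - Real.log Ea + Real.log Eb -
      1 / 2 * spread μ (fun x => φ x - ψ x)) by ring, abs_mul, abs_of_nonneg hpos]
  gcongr
  rw [abs_le] at key hsp ⊢
  constructor <;> linarith [key.1, key.2, hsp.1, hsp.2]

end Gap

/-! ### Loss of divergence on a product of small cells -/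

section Product

variable {X : Type*} [MeasurableSpace X]

/-- A positive function on a product of cells whose logarithm is close, in each variable, to a
given function of that variable. -/
structure IsCellDensity {n : ℕ} (A : Fin n → Set X) (φ : Fin n → X → ℝ) (e : ℝ)
    (u : (Fin n → X) → ℝ) : Prop where
  measurable : Measurable u
  pos : ∀ y ∈ Set.univ.pi A, 0 < u y
  bdd : ∃ K, ∀ y ∈ Set.univ.pi A, |Real.log (u y)| ≤ K
  slope : ∀ y ∈ Set.univ.pi A, ∀ j, ∀ x ∈ A j,
    |Real.log (u (Function.update y j x)) - Real.log (u y) - (φ j x - φ j (y j))| ≤ e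

/-- Averaging over the first variable. -/
def firstMean {n : ℕ} (μ : Measure X) (u : (Fin (n + 1) → X) → ℝ) (y : Fin n → X) : ℝ :=
  ∫ x, u (Fin.cons x y) ∂μ

omit [MeasurableSpace X] in
theorem cons_mem_pi {n : ℕ} {A : Fin (n + 1) → Set X} {x : X} {y : Fin n → X} (hx : x ∈ A 0)
    (hy : y ∈ Set.univ.pi fun j => A j.succ) : (Fin.cons x y : Fin (n + 1) → X) ∈ Set.univ.pi A := by
  intro j _
  refine Fin.cases ?_ (fun j => ?_) j
  · simpa using hx
  · simpa using hy j trivial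

theorem measurable_fin_cons {n : ℕ} :
    Measurable fun z : X × (Fin n → X) => (Fin.cons z.1 z.2 : Fin (n + 1) → X) := by
  refine measurable_pi_iff.2 fun j => ?_
  refine Fin.cases ?_ (fun j => ?_) j
  · simpa using measurable_fst
  · simp only [Fin.cons_succ]
    exact (measurable_pi_apply j).comp measurable_snd

theorem integral_pi_succ {n : ℕ} (κ : Fin (n + 1) → Measure X) [∀ j, IsProbabilityMeasure (κ j)]
    {g : (Fin (n + 1) → X) → ℝ} (hg : Integrable g (Measure.pi κ)) :
    Integrable (fun y => firstMean (κ 0) g y) (Measure.pi fun j => κ j.succ) ∧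
    ∫ y, g y ∂Measure.pi κ = ∫ y, firstMean (κ 0) g y ∂Measure.pi fun j => κ j.succ := by
  have mp := (measurePreserving_piFinSuccAbove κ 0).symm
  have hsymm : ∀ z : X × (Fin n → X),
      (MeasurableEquiv.piFinSuccAbove (fun _ => X) 0).symm z = Fin.cons z.1 z.2 := fun z => by
    funext j
    refine Fin.cases ?_ (fun j => ?_) j <;>
    simp [MeasurableEquiv.piFinSuccAbove, Fin.insertNthEquiv]
  have h1 := (mp.integrable_comp_emb (MeasurableEquiv.measurableEmbedding _)).2 hg
  have h2 := mp.integral_comp' g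
  simp only [Function.comp_def, hsymm, Fin.succAbove_zero] at h1 h2
  rw [← h2]
  exact ⟨h1.integral_prod_right, integral_prod_symm _ h1⟩

theorem ae_mem_pi {n : ℕ} {κ : Fin n → Measure X} [∀ j, IsProbabilityMeasure (κ j)]
    {A : Fin n → Set X} (h : ∀ j, ∀ᵐ x ∂κ j, x ∈ A j) :
    ∀ᵐ y ∂Measure.pi κ, y ∈ Set.univ.pi A := by
  have : ∀ᵐ y ∂Measure.pi κ, ∀ j, y j ∈ A j :=
    ae_all_iff.2 fun j => (Measure.quasiMeasurePreserving_eval κ j).ae (h j)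
  filter_upwards [this] with y hy j _ using hy j

namespace IsCellDensity

variable {n : ℕ} {e : ℝ}

theorem integrable {A : Fin n → Set X} {φ : Fin n → X → ℝ} {u : (Fin n → X) → ℝ}
    (hu : IsCellDensity A φ e u) {μ : Measure (Fin n → X)} [IsFiniteMeasure μ]
    (hμ : ∀ᵐ y ∂μ, y ∈ Set.univ.pi A) : Integrable u μ := by
  obtain ⟨K, hK⟩ := hu.bdd
  refine integrable_of_abs_le hu.measurable (K := Real.exp K) (hμ.mono fun y hy => ?_)
  rw [abs_of_pos (hu.pos y hy), ← Real.exp_log (hu.pos y hy)]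
  exact Real.exp_le_exp.2 ((le_abs_self _).trans (hK y hy))

theorem integrable_mul_log {A : Fin n → Set X} {φ ψ : Fin n → X → ℝ} {u v : (Fin n → X) → ℝ}
    (hu : IsCellDensity A φ e u) (hv : IsCellDensity A ψ e v) {μ : Measure (Fin n → X)}
    [IsFiniteMeasure μ] (hμ : ∀ᵐ y ∂μ, y ∈ Set.univ.pi A) :
    Integrable (fun y => u y * Real.log (u y / v y)) μ := by
  obtain ⟨K, hK⟩ := hu.bdd
  obtain ⟨L, hL⟩ := hv.bdd
  refine integrable_of_abs_le (hu.measurable.mul (hu.measurable.div hv.measurable).log)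
    (K := Real.exp K * (K + L)) (hμ.mono fun y hy => ?_)
  rw [Real.log_div (hu.pos y hy).ne' (hv.pos y hy).ne', abs_mul, abs_of_pos (hu.pos y hy)]
  have h1 : u y ≤ Real.exp K := by
    rw [← Real.exp_log (hu.pos y hy)]
    exact Real.exp_le_exp.2 ((le_abs_self _).trans (hK y hy))
  have h2 : |Real.log (u y) - Real.log (v y)| ≤ K + L :=
    (abs_sub _ _).trans (add_le_add (hK y hy) (hL y hy))
  gcongr

variable {A : Fin (n + 1) → Set X} {φ : Fin (n + 1) → X → ℝ} {u : (Fin (n + 1) → X) → ℝ}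

theorem measurable_section (hu : IsCellDensity A φ e u) (y : Fin n → X) :
    Measurable fun x => u (Fin.cons x y) :=
  hu.measurable.comp (measurable_fin_cons.comp (measurable_id.prodMk measurable_const))

theorem integrable_section (hu : IsCellDensity A φ e u) {μ : Measure X} [IsFiniteMeasure μ]
    (hμ : ∀ᵐ x ∂μ, x ∈ A 0) {y : Fin n → X} (hy : y ∈ Set.univ.pi fun j => A j.succ) :
    Integrable (fun x => u (Fin.cons x y)) μ := by
  obtain ⟨K, hK⟩ := hu.bdd
  refine integrable_of_abs_le (hu.measurable_section y) (K := Real.exp K) (hμ.mono fun x hx => ?_)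
  have h := cons_mem_pi hx hy
  rw [abs_of_pos (hu.pos _ h), ← Real.exp_log (hu.pos _ h)]
  exact Real.exp_le_exp.2 ((le_abs_self _).trans (hK _ h))

/-- The condition on slopes survives averaging with the same e: moving y_j multiplies u by at most
exp(φ_j x − φ_j (y_j) + e) for every value of the averaged variable, hence also multiplies the mean.
The reverse inequality follows by moving back. This is what allows induction over the variables. -/
theorem firstMean (hu : IsCellDensity A φ e u) {μ : Measure X} [IsProbabilityMeasure μ]
    (hμ : ∀ᵐ x ∂μ, x ∈ A 0) :
    IsCellDensity (fun j => A j.succ) (fun j => φ j.succ) e (firstMean μ u) := by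
  obtain ⟨K, hK⟩ := hu.bdd
  have hlow : ∀ y ∈ Set.univ.pi fun j => A j.succ, Real.exp (-K) ≤ QuantNP.firstMean μ u y := by
    intro y hy
    calc Real.exp (-K) = ∫ _x, Real.exp (-K) ∂μ := by simp
      _ ≤ _ := integral_mono_ae (integrable_const _) (hu.integrable_section hμ hy)
        (hμ.mono fun x hx => by
          have h := cons_mem_pi hx hy
          beta_reduce
          rw [← Real.exp_log (hu.pos _ h)]
          exact Real.exp_le_exp.2 (neg_le_of_abs_le (hK _ h)))
  have hup : ∀ y ∈ Set.univ.pi fun j => A j.succ, QuantNP.firstMean μ u y ≤ Real.exp K := by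
    intro y hy
    calc QuantNP.firstMean μ u y ≤ ∫ _x, Real.exp K ∂μ :=
        integral_mono_ae (hu.integrable_section hμ hy) (integrable_const _) (hμ.mono fun x hx => by
          have h := cons_mem_pi hx hy
          beta_reduce
          rw [← Real.exp_log (hu.pos _ h)]
          exact Real.exp_le_exp.2 (le_of_abs_le (hK _ h)))
      _ = _ := by simp
  have hpos : ∀ y ∈ Set.univ.pi fun j => A j.succ, 0 < QuantNP.firstMean μ u y :=
    fun y hy => (Real.exp_pos _).trans_le (hlow y hy)
  have hone : ∀ y ∈ Set.univ.pi fun j => A j.succ, ∀ j, ∀ x ∈ A (Fin.succ j),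
      Real.log (QuantNP.firstMean μ u (Function.update y j x)) ≤
        Real.log (QuantNP.firstMean μ u y) + ((φ j.succ x - φ j.succ (y j)) + e) := by
    intro y hy j x hx
    have hy' : Function.update y j x ∈ Set.univ.pi fun j => A j.succ := by
      intro l _
      rcases eq_or_ne l j with rfl | h
      · simpa using hx
      · simpa [h] using hy l trivial
    rw [← Real.log_exp ((φ j.succ x - φ j.succ (y j)) + e),
      ← Real.log_mul (hpos y hy).ne' (Real.exp_pos _).ne']
    refine Real.log_le_log (hpos _ hy') ?_
    rw [QuantNP.firstMean, QuantNP.firstMean, ← integral_mul_const]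
    refine integral_mono_ae (hu.integrable_section hμ hy')
      ((hu.integrable_section hμ hy).mul_const _) (hμ.mono fun z hz => ?_)
    have h := cons_mem_pi hz hy
    have h' := cons_mem_pi hz hy'
    have hs := hu.slope _ h j.succ x hx
    rw [← Fin.cons_update] at hs
    beta_reduce
    rw [← Real.exp_log (hu.pos _ h), ← Real.exp_log (hu.pos _ h'), ← Real.exp_add]
    apply Real.exp_le_exp.2
    have := (abs_le.1 hs).2
    simp only [Fin.cons_succ] at this
    linarith
  refine ⟨?_, hpos, ⟨K, fun y hy => ?_⟩, fun y hy j x hx => ?_⟩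
  · exact ((hu.measurable.comp measurable_fin_cons).stronglyMeasurable.integral_prod_left'
      (μ := μ)).measurable
  · rw [abs_le]
    exact ⟨(Real.le_log_iff_exp_le (hpos y hy)).2 (hlow y hy),
      (Real.log_le_iff_le_exp (hpos y hy)).2 (hup y hy)⟩
  · have h1 := hone y hy j x hx
    have hy' : Function.update y j x ∈ Set.univ.pi fun j => A j.succ := by
      intro l _
      rcases eq_or_ne l j with rfl | h
      · simpa using hx
      · simpa [h] using hy l trivial
    have h2 := hone _ hy' j (y j) (hy j trivial)
    simp only [Function.update_idem, Function.update_eq_self, Function.update_self] at h2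
    rw [abs_le]
    constructor <;> linarith

end IsCellDensity

/-- The loss of relative entropy on a product of small cells is the sum of the losses in the
single variables, up to errors of third order. -/
theorem abs_divergenceGap_pi_sub_le {n : ℕ} {κ : Fin n → Measure X}
    [∀ j, IsProbabilityMeasure (κ j)] {A : Fin n → Set X} (hA : ∀ j, ∀ᵐ x ∂κ j, x ∈ A j)
    {φ ψ : Fin n → X → ℝ} (hφ : ∀ j, Measurable (φ j)) (hψ : ∀ j, Measurable (ψ j)) {e : ℝ}
    {u v : (Fin n → X) → ℝ} (hu : IsCellDensity A φ e u) (hv : IsCellDensity A ψ e v)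
    {τ : Fin n → ℝ} (hτ : ∀ j, τ j ≤ 1 / 4)
    (hφτ : ∀ j, ∀ x ∈ A j, ∀ x' ∈ A j, |φ j x - φ j x'| + e ≤ τ j)
    (hψτ : ∀ j, ∀ x ∈ A j, ∀ x' ∈ A j, |ψ j x - ψ j x'| + e ≤ τ j) :
    |divergenceGap (Measure.pi κ) u v - 1 / 2 * (∫ y, u y ∂Measure.pi κ) *
        ∑ j, spread (κ j) (fun x => φ j x - ψ j x)| ≤
      (∫ y, u y ∂Measure.pi κ) * ∑ j, (38 * τ j ^ 3 + 8 * τ j * e) := by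
  induction n with
  | zero =>
    have hc : ∀ g : (Fin 0 → X) → ℝ, g = fun _ => g default := fun g => by
      ext y; congr 1; exact Subsingleton.elim _ _
    rw [divergenceGap, hc u, hc v]
    simp
  | succ n ih =>
    have hA' : ∀ᵐ y ∂Measure.pi (fun j => κ (Fin.succ j)), y ∈ Set.univ.pi fun j => A j.succ :=
      ae_mem_pi fun j => hA j.succ
    have hAll := ae_mem_pi hA
    have hu' := hu.firstMean (hA 0)
    have hv' := hv.firstMean (hA 0)
    have IH := ih (κ := fun j => κ j.succ) (fun j => hA j.succ) (fun j => hφ j.succ)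
      (fun j => hψ j.succ) hu' hv' (fun j => hτ j.succ) (fun j => hφτ j.succ) (fun j => hψτ j.succ)
    obtain ⟨iu, eu⟩ := integral_pi_succ κ (hu.integrable hAll)
    obtain ⟨iv, ev⟩ := integral_pi_succ κ (hv.integrable hAll)
    obtain ⟨il, el⟩ := integral_pi_succ κ (hu.integrable_mul_log hv hAll)
    have ilog := hu'.integrable_mul_log hv' hA'
    set π := Measure.pi fun j => κ (Fin.succ j) with hπ
    set u' := firstMean (κ 0) u with hu'def
    set v' := firstMean (κ 0) v with hv'def
    have hgapint : Integrable (fun y => divergenceGap (κ 0) (fun x => u (Fin.cons x y))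
        (fun x => v (Fin.cons x y))) π := il.sub ilog
    -- Chain rule for relative entropy: the loss on the product is the mean loss from averaging the
    -- first variable, plus the loss of the averaged densities in the other variables.
    have hdecomp : divergenceGap (Measure.pi κ) u v =
        ∫ y, divergenceGap (κ 0) (fun x => u (Fin.cons x y)) (fun x => v (Fin.cons x y)) ∂π +
          divergenceGap π u' v' := by
      have : ∫ y, divergenceGap (κ 0) (fun x => u (Fin.cons x y)) (fun x => v (Fin.cons x y)) ∂π =
          ∫ y, firstMean (κ 0) (fun y => u y * Real.log (u y / v y)) y ∂π -
            ∫ y, u' y * Real.log (u' y / v' y) ∂π := integral_sub il ilog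
      rw [this, divergenceGap, divergenceGap, el, eu, ev]
      ring
    have hcell : ∀ᵐ y ∂π, |divergenceGap (κ 0) (fun x => u (Fin.cons x y))
        (fun x => v (Fin.cons x y)) -
          1 / 2 * u' y * spread (κ 0) (fun x => φ 0 x - ψ 0 x)| ≤
        u' y * (38 * τ 0 ^ 3 + 8 * τ 0 * e) := by
      filter_upwards [hA'] with y hy
      obtain ⟨x₀, hx₀⟩ := (hA 0).exists
      have hslope : ∀ {φ : Fin (n + 1) → X → ℝ} {u : (Fin (n + 1) → X) → ℝ},
          IsCellDensity A φ e u → ∀ x ∈ A 0, |Real.log (u (Fin.cons x y)) -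
            Real.log (u (Fin.cons x₀ y)) - (φ 0 x - φ 0 x₀)| ≤ e := fun hu x hx => by
        have := hu.slope _ (cons_mem_pi hx₀ hy) 0 x hx
        simpa using this
      exact abs_divergenceGap_sub_le (hu.measurable_section y) (hv.measurable_section y) (hφ 0)
        (hψ 0) (hA 0) (fun x hx => hu.pos _ (cons_mem_pi hx hy))
        (fun x hx => hv.pos _ (cons_mem_pi hx hy)) hx₀ (hτ 0) (hslope hu) (hslope hv)
        (fun x hx => hφτ 0 x hx x₀ hx₀) (fun x hx => hψτ 0 x hx x₀ hx₀)
    have hfirst : |∫ y, divergenceGap (κ 0) (fun x => u (Fin.cons x y))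
        (fun x => v (Fin.cons x y)) ∂π -
          1 / 2 * (∫ y, u' y ∂π) * spread (κ 0) (fun x => φ 0 x - ψ 0 x)| ≤
        (∫ y, u' y ∂π) * (38 * τ 0 ^ 3 + 8 * τ 0 * e) := by
      have i1 : Integrable (fun y => 1 / 2 * u' y * spread (κ 0) (fun x => φ 0 x - ψ 0 x)) π :=
        (iu.const_mul _).mul_const _
      rw [← integral_mul_const, ← integral_const_mul, ← integral_mul_const,
        ← integral_sub hgapint i1]
      refine abs_integral_le_integral_abs.trans ?_
      exact integral_mono_ae (hgapint.sub i1).abs (iu.mul_const _) hcell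
    rw [hdecomp, eu, Fin.sum_univ_succ, Fin.sum_univ_succ]
    rw [abs_le] at *
    constructor <;> linarith [hfirst.1, hfirst.2, IH.1, IH.2]

end Product

/-! ### Loss of divergence by quantization of a block -/

/-- The covariance matrix of the uniform distribution on a set. -/
def cellCov (A : Set (E d)) (c c' : Fin d) : ℝ :=
  ∫ x : E d, x c * x c' ∂ProbabilityTheory.cond volume A -
    (∫ x : E d, x c ∂ProbabilityTheory.cond volume A) *
      ∫ x : E d, x c' ∂ProbabilityTheory.cond volume A

theorem vec_eq_sum (x : E d) : x = ∑ c, x c • (EuclideanSpace.single c (1 : ℝ) : E d) := by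
  have := (EuclideanSpace.basisFun (Fin d) ℝ).sum_repr x
  simpa using this.symm

theorem clm_apply_eq_sum (L : E d →L[ℝ] ℝ) (x : E d) :
    L x = ∑ c, x c * L (EuclideanSpace.single c 1) := by
  conv_lhs => rw [vec_eq_sum x, map_sum]
  simp

theorem abs_coord_le (x : E d) (c : Fin d) : |x c| ≤ ‖x‖ := by
  simpa using PiLp.norm_apply_le x c

theorem spread_clm {μ : Measure (E d)} [IsProbabilityMeasure μ] {R : ℝ}
    (hμ : ∀ᵐ x ∂μ, ‖x‖ ≤ R) (L : E d →L[ℝ] ℝ) :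
    spread μ L = ∑ c, ∑ c', L (EuclideanSpace.single c 1) *
      (∫ x : E d, x c * x c' ∂μ - (∫ x : E d, x c ∂μ) * ∫ x : E d, x c' ∂μ) *
        L (EuclideanSpace.single c' 1) := by
  have i1 : ∀ c, Integrable (fun x : E d => x c) μ := fun c =>
    integrable_of_abs_le (by fun_prop) (hμ.mono fun x hx => (abs_coord_le x c).trans hx)
  have i2 : ∀ c c', Integrable (fun x : E d => x c * x c') μ := fun c c' =>
    integrable_of_abs_le (K := R * R) (by fun_prop) (hμ.mono fun x hx => by
      rw [abs_mul]
      have h1 := (abs_coord_le x c).trans hx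
      have h2 := (abs_coord_le x c').trans hx
      gcongr
      exact (norm_nonneg _).trans hx)
  have e1 : ∫ x, L x ∂μ = ∑ c, (∫ x : E d, x c ∂μ) * L (EuclideanSpace.single c 1) := by
    rw [integral_congr_ae (Eventually.of_forall (clm_apply_eq_sum L)),
      integral_finsetSum _ fun c _ => (i1 c).mul_const _]
    simp_rw [integral_mul_const]
  have e2 : ∫ x, L x ^ 2 ∂μ = ∑ c, ∑ c', (∫ x : E d, x c * x c' ∂μ) *
      (L (EuclideanSpace.single c 1) * L (EuclideanSpace.single c' 1)) := by
    have : ∀ x, L x ^ 2 = ∑ c, ∑ c', (x c * x c') *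
        (L (EuclideanSpace.single c 1) * L (EuclideanSpace.single c' 1)) := fun x => by
      rw [clm_apply_eq_sum L x, sq, Finset.sum_mul_sum]
      refine Finset.sum_congr rfl fun c _ => Finset.sum_congr rfl fun c' _ => by ring
    simp_rw [this]
    rw [integral_finsetSum _ fun c _ => integrable_finsetSum _ fun c' _ => (i2 c c').mul_const _]
    refine Finset.sum_congr rfl fun c _ => ?_
    rw [integral_finsetSum _ fun c' _ => (i2 c c').mul_const _]
    simp_rw [integral_mul_const]
  rw [spread, e1, e2, sq, Finset.sum_mul_sum, ← Finset.sum_sub_distrib]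
  refine Finset.sum_congr rfl fun c _ => ?_
  rw [← Finset.sum_sub_distrib]
  refine Finset.sum_congr rfl fun c' _ => by ring

/-- The gradients of the log-likelihood ratio of a block. -/
def ratioGrad {n : ℕ} (f : Fin 2 → (Fin n → E d) → ℝ) (j : Fin n) (c : Fin d)
    (y : Fin n → E d) : ℝ :=
  fderiv ℝ (f 0) y (Pi.single j (EuclideanSpace.single c 1)) -
    fderiv ℝ (f 1) y (Pi.single j (EuclideanSpace.single c 1))

/-- A bound for the gradients of both log-densities of a block. -/
def gradSize {n : ℕ} (f : Fin 2 → (Fin n → E d) → ℝ) (j : Fin n) (y : Fin n → E d) : ℝ :=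
  ∑ c : Fin d, (|fderiv ℝ (f 0) y (Pi.single j (EuclideanSpace.single c 1))| +
    |fderiv ℝ (f 1) y (Pi.single j (EuclideanSpace.single c 1))|)

theorem abs_fderiv_single_le_gradSize {n : ℕ} (f : Fin 2 → (Fin n → E d) → ℝ) (i : Fin 2)
    (j : Fin n) (y : Fin n → E d) (x : E d) :
    |fderiv ℝ (f i) y (Pi.single j x)| ≤ gradSize f j y * ‖x‖ := by
  have := clm_apply_eq_sum ((fderiv ℝ (f i) y).comp
    (ContinuousLinearMap.single ℝ (fun _ : Fin n => E d) j)) x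
  simp only [ContinuousLinearMap.comp_apply, ContinuousLinearMap.single_apply] at this
  rw [this, gradSize, Finset.sum_mul]
  refine (Finset.abs_sum_le_sum_abs _ _).trans (Finset.sum_le_sum fun c _ => ?_)
  rw [abs_mul, mul_comm]
  have hle : |fderiv ℝ (f i) y (Pi.single j (EuclideanSpace.single c 1))| ≤
      |fderiv ℝ (f 0) y (Pi.single j (EuclideanSpace.single c 1))| +
        |fderiv ℝ (f 1) y (Pi.single j (EuclideanSpace.single c 1))| := by
    fin_cases i
    · exact le_add_of_nonneg_right (abs_nonneg _)
    · exact le_add_of_nonneg_left (abs_nonneg _)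
  gcongr
  exact abs_coord_le x c

theorem gradSize_le {U : Set (E d)} {Λ : ℝ} {n : ℕ} {f : Fin 2 → (Fin n → E d) → ℝ}
    (h : HasBlockBounds U Λ n f) (j : Fin n) {y : Fin n → E d} (hy : y ∈ box U n) :
    gradSize f j y ≤ 2 * d * Λ * n ^ 2 := by
  calc gradSize f j y ≤ ∑ _c : Fin d, (Λ * n ^ 2 + Λ * n ^ 2) := by
        refine Finset.sum_le_sum fun c _ => add_le_add ?_ ?_
        · simpa using h.grad 0 j y hy (EuclideanSpace.single c 1)
        · simpa using h.grad 1 j y hy (EuclideanSpace.single c 1)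
    _ = _ := by simp; ring

theorem gradSize_nonneg {n : ℕ} (f : Fin 2 → (Fin n → E d) → ℝ) (j : Fin n) (y : Fin n → E d) :
    0 ≤ gradSize f j y := Finset.sum_nonneg fun _ _ => by positivity

theorem measurable_gradSize {n : ℕ} (f : Fin 2 → (Fin n → E d) → ℝ) (j : Fin n) :
    Measurable (gradSize f j) :=
  Finset.measurable_sum _ fun _ _ => (measurable_fderiv_apply_single _ _).abs.add
    (measurable_fderiv_apply_single _ _).abs

theorem measurable_ratioGrad {n : ℕ} (f : Fin 2 → (Fin n → E d) → ℝ) (j : Fin n) (c : Fin d) :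
    Measurable (ratioGrad f j c) :=
  (measurable_fderiv_apply_single _ _).sub (measurable_fderiv_apply_single _ _)

theorem abs_ratioGrad_le {n : ℕ} (f : Fin 2 → (Fin n → E d) → ℝ) (j : Fin n) (c : Fin d)
    (y : Fin n → E d) : |ratioGrad f j c y| ≤ gradSize f j y := by
  refine (abs_sub _ _).trans ?_
  exact Finset.single_le_sum (f := fun c : Fin d =>
    |fderiv ℝ (f 0) y (Pi.single j (EuclideanSpace.single c 1))| +
    |fderiv ℝ (f 1) y (Pi.single j (EuclideanSpace.single c 1))|) (fun _ _ => by positivity)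
    (Finset.mem_univ c)

/-- On a product of cells, log-densities are almost linear in each variable. -/
theorem isCellDensity_exp {U : Set (E d)} {C D ρ Λ δ : ℝ} {u₀ : E d} {n : ℕ}
    {f : Fin 2 → (Fin n → E d) → ℝ} (hU : IsConvexDomain U D ρ u₀) (hΛ : 0 ≤ Λ)
    (hb : HasBlockBounds U Λ n f) (i : Fin 2) (hm : Measurable (f i))
    (hf : HasBoundedThird U n C (f i)) {A : Fin n → Set (E d)}
    (hAU : ∀ j, A j ⊆ U) (hδ : 0 ≤ δ) (hA : ∀ j, ∀ x ∈ A j, ∀ x' ∈ A j, ‖x - x'‖ ≤ δ)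
    {y₀ : Fin n → E d} (hy₀ : y₀ ∈ Set.univ.pi A) :
    IsCellDensity A (fun j x => fderiv ℝ (f i) y₀ (Pi.single j x)) (2 * Λ * n ^ 2 * δ ^ 2)
      (fun y => Real.exp (f i y)) := by
  have hsub : Set.univ.pi A ⊆ box U n := fun y hy j _ => hAU j (hy j trivial)
  have hdist : ∀ y ∈ Set.univ.pi A, ‖y - y₀‖ ≤ δ := fun y hy =>
    (pi_norm_le_iff_of_nonneg hδ).2 fun j => hA j _ (hy j trivial) _ (hy₀ j trivial)
  refine ⟨hm.exp, fun y _ => Real.exp_pos _, ?_, ?_⟩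
  · refine ⟨|f i y₀| + n * (Λ * n ^ 2) * δ, fun y hy => ?_⟩
    rw [Real.log_exp]
    have h1 := abs_sub_le_of_hasDerivAt (r := 1) zero_le_one
      (φ := fun s => f i (y₀ + s • (y - y₀)))
      (φ' := fun s => fderiv ℝ (f i) (y₀ + s • (y - y₀)) (y - y₀)) (K := n * (Λ * n ^ 2) * δ)
      (fun s hs => HasBoundedThird.hasDerivAt_line (hf.hasFDerivAt hU.isOpen
        (HasBoundedThird.line_mem hU.convex (hsub hy₀) (hsub hy) hs)))
      (fun s hs => by
        refine (abs_apply_le_of_single _ (B := Λ * n ^ 2) (by positivity) (fun k x =>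
          hb.grad i k _ (HasBoundedThird.line_mem hU.convex (hsub hy₀) (hsub hy) hs) x) _).trans ?_
        gcongr
        exact hdist y hy)
    simp only [one_smul, zero_smul, add_zero, mul_one, add_sub_cancel] at h1
    have h2 := abs_sub_abs_le_abs_sub (f i y) (f i y₀)
    linarith
  · intro y hy j x hx
    rw [Real.log_exp, Real.log_exp]
    have hn : (1 : ℝ) ≤ n := by
      have : 0 < n := j.pos
      exact_mod_cast this
    have hxy : ‖x - y j‖ ≤ δ := hA j _ hx _ (hy j trivial)
    -- Two errors make up the slope defect: curvature in the variable j, at most Λ n δ², and the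
    -- drift of the partial gradient from y₀ to y, at most Λ n² δ².
    have h1 := hf.abs_taylor_update hU.isOpen hU.convex (hsub hy) (k := j) (hAU j hx)
      (B := Λ * n) (fun w hw x => (hb.hess i j j w hw x x).trans (le_of_eq (by ring)))
      (r := 1) ⟨zero_le_one, le_rfl⟩
    simp only [one_smul, add_sub_cancel, one_mul, one_pow, mul_one] at h1
    have hv : y₀ + (y - y₀) = y := by abel
    have h2 := hf.abs_fderiv_sub_le hU.isOpen hU.convex (y := y₀) (v := y - y₀) (k := j)
      (x := x - y j) (B := Λ * n ^ 2 * δ * δ) (hsub hy₀) (by rw [hv]; exact hsub hy)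
      (fun w hw => (hb.hess_le hΛ i j hw _ _).trans (by
        have := hdist y hy
        gcongr))
    rw [hv] at h2
    have h3 : Λ * n * ‖x - y j‖ ^ 2 ≤ Λ * n ^ 2 * δ ^ 2 := by
      have : (n : ℝ) ≤ n ^ 2 := by nlinarith
      gcongr
    have e : fderiv ℝ (f i) y₀ (Pi.single j x) - fderiv ℝ (f i) y₀ (Pi.single j (y j)) =
        fderiv ℝ (f i) y₀ (Pi.single j (x - y j)) := by
      rw [Pi.single_sub, map_sub]
    rw [e]
    have h4 := h1.trans h3
    rw [abs_le] at h2 h4 ⊢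
    constructor <;> nlinarith [h2.1, h2.2, h4.1, h4.2]

/-- The leading term of the loss of divergence by quantization of a block. -/
def quadLoss {n : ℕ} (f : Fin 2 → (Fin n → E d) → ℝ) (A : Fin n → Set (E d)) (y : Fin n → E d) :
    ℝ :=
  ∑ j, ∑ c, ∑ c', ratioGrad f j c y * cellCov (A j) c c' * ratioGrad f j c' y

theorem pi_cond_eq {n : ℕ} {A : Fin n → Set (E d)} (hA : ∀ j, MeasurableSet (A j))
    (h0 : ∀ j, volume (A j) ≠ 0) (htop : ∀ j, volume (A j) ≠ ∞) :
    volume.restrict (Set.univ.pi A) = (∏ j, volume (A j)) •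
      Measure.pi fun j => ProbabilityTheory.cond volume (A j) := by
  have := fun j => ProbabilityTheory.cond_isProbabilityMeasure_of_finite (h0 j) (htop j)
  rw [volume_pi, Measure.restrict_pi_pi]
  refine (Measure.pi_eq fun s _ => ?_)
  rw [Measure.smul_apply, Measure.pi_pi, smul_eq_mul, ← Finset.prod_mul_distrib]
  refine Finset.prod_congr rfl fun j _ => ?_
  rw [ProbabilityTheory.cond_apply (hA j), ← mul_assoc, ENNReal.mul_inv_cancel (h0 j) (htop j),
    one_mul, Measure.restrict_apply' (hA j), Set.inter_comm]

/-! ### Quantizers on the open domain and the expansion of the loss over product cells -/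

/-- A measurable map with `N` values whose level sets in `U` have positive volume and diameter at
most `δ`. -/
structure IsFineQuantizer (U : Set (E d)) (δ : ℝ) (N : ℕ) (q : E d → ℕ) : Prop where
  measurable : Measurable q
  lt : ∀ y, q y < N
  volume_ne_zero : ∀ j < N, volume (cell U q j) ≠ 0
  norm_sub_le : ∀ y ∈ U, ∀ y' ∈ U, q y = q y' → ‖y - y'‖ ≤ δ

/-- The sequence of cells visited by a block. -/
def label {n : ℕ} (q : E d → ℕ) (y : Fin n → E d) : Fin n → ℕ := fun j => q (y j)

/-- The product of the cells with given labels. -/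
def blockCell (U : Set (E d)) {n : ℕ} (q : E d → ℕ) (z : Fin n → ℕ) : Set (Fin n → E d) :=
  Set.univ.pi fun j => cell U q (z j)

/-- The log-likelihood ratio of the quantized block. -/
def quantLogRatio (U : Set (E d)) {n : ℕ} (q : E d → ℕ) (f : Fin 2 → (Fin n → E d) → ℝ)
    (z : Fin n → ℕ) : ℝ :=
  Real.log ((blockLaw U (f 0)).real (blockCell U q z) / (blockLaw U (f 1)).real (blockCell U q z))

theorem mem_blockCell {U : Set (E d)} {n : ℕ} {q : E d → ℕ} {z : Fin n → ℕ} {y : Fin n → E d} :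
    y ∈ blockCell U q z ↔ y ∈ box U n ∧ label q y = z := by
  simp only [blockCell, box, Set.mem_univ_pi, cell, Set.mem_ofPred_eq, label, funext_iff]
  exact forall_and

theorem measurable_label {n : ℕ} {q : E d → ℕ} (hq : Measurable q) :
    Measurable (label q : (Fin n → E d) → _) :=
  measurable_pi_lambda _ fun j => hq.comp (measurable_pi_apply j)

theorem exists_abs_label_le {n N : ℕ} {q : E d → ℕ} (hq : ∀ y, q y < N) (g : (Fin n → ℕ) → ℝ) :
    ∃ K, ∀ y : Fin n → E d, |g (label q y)| ≤ K := by
  refine ⟨∑ z ∈ Fintype.piFinset fun _ : Fin n => Finset.range N, |g z|, fun y => ?_⟩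
  exact Finset.single_le_sum (f := fun z => |g z|) (fun _ _ => abs_nonneg _)
    (Fintype.mem_piFinset.2 fun j => Finset.mem_range.2 (hq (y j)))

section

variable {U : Set (E d)} {C D ρ Λ δ : ℝ} {u₀ : E d} {n N : ℕ}
  {f : Fin 2 → (Fin n → E d) → ℝ} {q : E d → ℕ}

theorem measurableSet_cell (hU : IsOpen U) (hq : Measurable q) (j : ℕ) :
    MeasurableSet (cell U q j) :=
  hU.measurableSet.inter (hq (measurableSet_singleton j))

theorem volume_cell_ne_top (hU : IsConvexDomain U D ρ u₀) (j : ℕ) :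
    volume (cell U q j) ≠ ∞ := by
  have hb : Bornology.IsBounded U := by
    rw [Metric.isBounded_iff]
    exact ⟨D, fun x hx y hy => by rw [dist_eq_norm]; exact hU.diam x hx y hy⟩
  exact ((measure_mono fun y hy => hy.1).trans_lt hb.measure_lt_top).ne

/-- The constant in the error term of `abs_integral_sub_quantLogRatio_le`. -/
def gapError (Λ δ : ℝ) {n : ℕ} (f : Fin 2 → (Fin n → E d) → ℝ) (y : Fin n → E d) : ℝ :=
  200 * (d + 1) * Λ * n ^ 2 * δ ^ 3 * ∑ j, (1 + gradSize f j y ^ 2)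

/-- Here G is the gradient size, s is n², a is d + 1, and τ = Gδ + 2Λsδ² bounds the oscillation on a
cell plus the slope defect. In τ³ one factor is replaced by its sup bound 2aΛsδ, and only τ² is
estimated through G. So G enters at most squared, which suits the uniform second moments of the
gradients. -/
theorem gap_error_le {G Λ δ s a : ℝ} (hG : 0 ≤ G) (hΛ : 0 ≤ Λ) (hδ : 0 ≤ δ) (ha : 1 ≤ a)
    (hs : 0 ≤ s) (hGs : G ≤ 2 * (a - 1) * Λ * s) (hsmall : 16 * a * (Λ + 1) * s * δ ≤ 1)
    (hδ1 : δ ≤ 1) :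
    G * δ + 2 * Λ * s * δ ^ 2 ≤ 1 / 4 ∧
    38 * (G * δ + 2 * Λ * s * δ ^ 2) ^ 3 + 8 * (G * δ + 2 * Λ * s * δ ^ 2) * (2 * Λ * s * δ ^ 2) ≤
      200 * a * Λ * s * δ ^ 3 * (1 + G ^ 2) := by
  set τ := G * δ + 2 * Λ * s * δ ^ 2 with hτ
  have hp : 0 ≤ Λ * s * δ := by positivity
  have hsmall' : 16 * (a * Λ * s * δ) ≤ 1 := by
    have : 0 ≤ 16 * a * s * δ := by positivity
    nlinarith
  have h1 : Λ * s * δ ≤ 1 / 16 := by nlinarith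
  have hG' : G * δ ≤ 2 * (a - 1) * (Λ * s * δ) := by
    calc G * δ ≤ (2 * (a - 1) * Λ * s) * δ := by gcongr
      _ = _ := by ring
  have h2 : 2 * Λ * s * δ ^ 2 ≤ 2 * (Λ * s * δ) := by
    have : Λ * s * δ * δ ≤ Λ * s * δ * 1 := by gcongr
    nlinarith
  have h3 : 2 * Λ * s * δ ^ 2 ≤ δ := by
    have : Λ * s * δ * δ ≤ 1 / 16 * δ := by gcongr
    nlinarith
  have hτ0 : 0 ≤ τ := by positivity
  have hτ1 : τ ≤ 2 * a * (Λ * s * δ) := by rw [hτ]; linarith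
  have hτ2 : τ ≤ δ * (G + 1) := by rw [hτ]; linarith
  have hτ3 : τ ^ 2 ≤ 2 * δ ^ 2 * (1 + G ^ 2) := by
    calc τ ^ 2 ≤ (δ * (G + 1)) ^ 2 := by gcongr
      _ = δ ^ 2 * (G + 1) ^ 2 := by ring
      _ ≤ δ ^ 2 * (2 * (1 + G ^ 2)) := by gcongr; nlinarith [sq_nonneg (G - 1)]
      _ = _ := by ring
  refine ⟨by linarith, ?_⟩
  have h4 : τ ^ 3 ≤ (2 * a * (Λ * s * δ)) * (2 * δ ^ 2 * (1 + G ^ 2)) := by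
    calc τ ^ 3 = τ * τ ^ 2 := by ring
      _ ≤ _ := by gcongr
  have h5 : τ * (2 * Λ * s * δ ^ 2) ≤ a * (δ * (2 * (1 + G ^ 2))) * (2 * Λ * s * δ ^ 2) := by
    gcongr
    have : δ * (G + 1) ≤ δ * (2 * (1 + G ^ 2)) := by gcongr; nlinarith [sq_nonneg (G - 1)]
    have h0 : 0 ≤ δ * (2 * (1 + G ^ 2)) := by positivity
    nlinarith
  have h6 : 0 ≤ a * Λ * s * δ ^ 3 * (1 + G ^ 2) := by positivity
  nlinarith

/-- Loss of divergence by quantization on one product of cells. -/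
theorem abs_blockCell_gap_le (hU : IsConvexDomain U D ρ u₀) (hΛ : 0 ≤ Λ)
    (hb : HasBlockBounds U Λ n f) (hm : ∀ i, Measurable (f i))
    (hf : ∀ i, HasBoundedThird U n C (f i)) (hq : IsFineQuantizer U δ N q) (hδ : 0 ≤ δ)
    (hδ1 : δ ≤ 1) (hsmall : 16 * (d + 1) * (Λ + 1) * n ^ 2 * δ ≤ 1) {z : Fin n → ℕ}
    (hz : ∀ j, z j < N) {y₀ : Fin n → E d} (hy₀ : y₀ ∈ blockCell U q z) :
    |(∫ y in blockCell U q z, (f 0 y - f 1 y) ∂blockLaw U (f 0)) -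
        (blockLaw U (f 0)).real (blockCell U q z) * quantLogRatio U q f z -
        1 / 2 * (blockLaw U (f 0)).real (blockCell U q z) *
          quadLoss f (fun j => cell U q (z j)) y₀| ≤
      (blockLaw U (f 0)).real (blockCell U q z) * gapError Λ δ f y₀ := by
  set A : Fin n → Set (E d) := fun j => cell U q (z j) with hAdef
  have hAm : ∀ j, MeasurableSet (A j) := fun j => measurableSet_cell hU.isOpen hq.measurable _
  have h0 : ∀ j, volume (A j) ≠ 0 := fun j => hq.volume_ne_zero _ (hz j)
  have htop : ∀ j, volume (A j) ≠ ∞ := fun j => volume_cell_ne_top hU _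
  have hAU : ∀ j, A j ⊆ U := fun j y hy => hy.1
  have hdiam : ∀ j, ∀ x ∈ A j, ∀ x' ∈ A j, ‖x - x'‖ ≤ δ := fun j x hx x' hx' =>
    hq.norm_sub_le _ hx.1 _ hx'.1 (hx.2.trans hx'.2.symm)
  set κ : Fin n → Measure (E d) := fun j => ProbabilityTheory.cond volume (A j) with hκ
  have hprob : ∀ j, IsProbabilityMeasure (κ j) := fun j =>
    ProbabilityTheory.cond_isProbabilityMeasure_of_finite (h0 j) (htop j)
  have hκA : ∀ j, ∀ᵐ x ∂κ j, x ∈ A j := fun j => ProbabilityTheory.ae_cond_mem (hAm j)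
  set V : ℝ := (∏ j, volume (A j)).toReal with hV
  have hVpos : 0 < V := ENNReal.toReal_pos (Finset.prod_ne_zero_iff.2 fun j _ => h0 j)
    (ENNReal.prod_ne_top fun j _ => htop j)
  have hBU : blockCell U q z ⊆ box U n := fun y hy => (mem_blockCell.1 hy).1
  have hBm : MeasurableSet (blockCell U q z) := MeasurableSet.univ_pi hAm
  have hden : ∀ i, Measurable fun y => ENNReal.ofReal (Real.exp (f i y)) := fun i =>
    (hm i).exp.ennreal_ofReal
  have hrestr : ∀ i, (blockLaw U (f i)).restrict (blockCell U q z) =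
      (volume.restrict (Set.univ.pi A)).withDensity
        fun y => ENNReal.ofReal (Real.exp (f i y)) := fun i => by
    rw [blockLaw, restrict_withDensity hBm, Measure.restrict_restrict hBm,
      Set.inter_eq_left.2 hBU]
    rfl
  have hint : ∀ i (g : (Fin n → E d) → ℝ), ∫ y in blockCell U q z, g y ∂blockLaw U (f i) =
      V * ∫ y, Real.exp (f i y) * g y ∂Measure.pi κ := fun i g => by
    rw [hrestr i, integral_withDensity_eq_integral_toReal_smul (hden i)
      (Eventually.of_forall fun _ => ENNReal.ofReal_lt_top), pi_cond_eq hAm h0 htop,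
      integral_smul_measure]
    simp [ENNReal.toReal_ofReal (Real.exp_nonneg _), hV, hκ]
  have hreal : ∀ i, (blockLaw U (f i)).real (blockCell U q z) =
      V * ∫ y, Real.exp (f i y) ∂Measure.pi κ := fun i => by
    have := hint i fun _ => 1
    simpa using this
  have hcd : ∀ i, IsCellDensity A (fun j x => fderiv ℝ (f i) y₀ (Pi.single j x))
      (2 * Λ * n ^ 2 * δ ^ 2) (fun y => Real.exp (f i y)) := fun i =>
    isCellDensity_exp hU hΛ hb i (hm i) (hf i) hAU hδ hdiam hy₀
  have hmφ : ∀ i j, Measurable fun x : E d => fderiv ℝ (f i) y₀ (Pi.single j x) := fun i j =>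
    ((fderiv ℝ (f i) y₀).comp (ContinuousLinearMap.single ℝ (fun _ : Fin n => E d) j)).measurable
  have hGle : ∀ j, gradSize f j y₀ ≤ 2 * ((d + 1 : ℝ) - 1) * Λ * n ^ 2 := fun j => by
    have := gradSize_le hb j (hBU hy₀)
    simpa using this
  have herr := fun j => gap_error_le (gradSize_nonneg f j y₀) hΛ hδ
    (by have : (0 : ℝ) ≤ d := by positivity
        linarith) (by positivity) (hGle j) hsmall hδ1
  have hφτ : ∀ i j, ∀ x ∈ A j, ∀ x' ∈ A j,
      |fderiv ℝ (f i) y₀ (Pi.single j x) - fderiv ℝ (f i) y₀ (Pi.single j x')| +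
        2 * Λ * n ^ 2 * δ ^ 2 ≤ gradSize f j y₀ * δ + 2 * Λ * n ^ 2 * δ ^ 2 := by
    intro i j x hx x' hx'
    rw [← map_sub, ← Pi.single_sub]
    gcongr
    refine (abs_fderiv_single_le_gradSize f i j y₀ _).trans ?_
    have := gradSize_nonneg f j y₀
    gcongr
    exact hdiam j x hx x' hx'
  -- Under the uniform laws of the cells, the slope functions are the linear parts at the arbitrary
  -- point y₀ of the product cell. Their variances are the quadratic forms in the cell covariances.
  have key := abs_divergenceGap_pi_sub_le hκA (hmφ 0) (hmφ 1) (hcd 0) (hcd 1)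
    (τ := fun j => gradSize f j y₀ * δ + 2 * Λ * n ^ 2 * δ ^ 2) (fun j => (herr j).1)
    (hφτ 0) (hφτ 1)
  have hspread : ∑ j, spread (κ j) (fun x => fderiv ℝ (f 0) y₀ (Pi.single j x) -
      fderiv ℝ (f 1) y₀ (Pi.single j x)) = quadLoss f A y₀ := by
    rw [quadLoss]
    refine Finset.sum_congr rfl fun j _ => ?_
    have := spread_clm (μ := κ j) (R := ‖y₀ j‖ + δ) ((hκA j).mono fun x hx => by
      have h1 := hdiam j x hx _ (hy₀ j trivial)
      have h2 := norm_add_le (x - y₀ j) (y₀ j)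
      rw [sub_add_cancel] at h2
      linarith) ((fderiv ℝ (f 0) y₀ - fderiv ℝ (f 1) y₀).comp
        (ContinuousLinearMap.single ℝ (fun _ : Fin n => E d) j))
    exact this
  have hlog : ∀ y : Fin n → E d, Real.log (Real.exp (f 0 y) / Real.exp (f 1 y)) = f 0 y - f 1 y :=
    fun y => by rw [← Real.exp_sub, Real.log_exp]
  have hgap : (∫ y in blockCell U q z, (f 0 y - f 1 y) ∂blockLaw U (f 0)) -
        (blockLaw U (f 0)).real (blockCell U q z) * quantLogRatio U q f z =
      V * divergenceGap (Measure.pi κ) (fun y => Real.exp (f 0 y)) (fun y => Real.exp (f 1 y)) := by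
    rw [hint, quantLogRatio, hreal, hreal, divergenceGap, mul_div_mul_left _ _ hVpos.ne']
    simp only [hlog]
    ring
  rw [hspread] at key
  rw [hgap, hreal]
  have hI : 0 ≤ ∫ y, Real.exp (f 0 y) ∂Measure.pi κ := integral_nonneg fun y => Real.exp_nonneg _
  have e : V * divergenceGap (Measure.pi κ) (fun y => Real.exp (f 0 y))
      (fun y => Real.exp (f 1 y)) - 1 / 2 * (V * ∫ y, Real.exp (f 0 y) ∂Measure.pi κ) *
        quadLoss f A y₀ = V * (divergenceGap (Measure.pi κ) (fun y => Real.exp (f 0 y))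
      (fun y => Real.exp (f 1 y)) - 1 / 2 * (∫ y, Real.exp (f 0 y) ∂Measure.pi κ) *
        quadLoss f A y₀) := by ring
  rw [e, abs_mul, abs_of_pos hVpos, mul_assoc V]
  refine mul_le_mul_of_nonneg_left (key.trans (mul_le_mul_of_nonneg_left ?_ hI)) hVpos.le
  rw [gapError, Finset.mul_sum]
  exact Finset.sum_le_sum fun j _ => (herr j).2

theorem measurable_quadLoss (hq : Measurable q) :
    Measurable fun y => quadLoss f (fun j => cell U q (label q y j)) y := by
  refine Finset.measurable_sum _ fun j _ => Finset.measurable_sum _ fun c _ =>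
    Finset.measurable_sum _ fun c' _ => ((measurable_ratioGrad f j c).mul ?_).mul
      (measurable_ratioGrad f j c')
  exact (measurable_of_countable fun z : Fin n → ℕ => cellCov (cell U q (z j)) c c').comp
    (measurable_label hq)

theorem exists_abs_quadLoss_le (hΛ : 0 ≤ Λ) (hb : HasBlockBounds U Λ n f) (hq : ∀ y, q y < N) :
    ∃ K, ∀ y ∈ box U n, |quadLoss f (fun j => cell U q (label q y j)) y| ≤ K := by
  choose K hK using fun j c c' => exists_abs_label_le (n := n) hq fun z =>
    cellCov (cell U q (z j)) c c'
  refine ⟨∑ j, ∑ c, ∑ c', (2 * d * Λ * n ^ 2) * K j c c' * (2 * d * Λ * n ^ 2), fun y hy => ?_⟩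
  refine (Finset.abs_sum_le_sum_abs _ _).trans (Finset.sum_le_sum fun j _ => ?_)
  refine (Finset.abs_sum_le_sum_abs _ _).trans (Finset.sum_le_sum fun c _ => ?_)
  refine (Finset.abs_sum_le_sum_abs _ _).trans (Finset.sum_le_sum fun c' _ => ?_)
  have h1 : ∀ c, |ratioGrad f j c y| ≤ 2 * d * Λ * n ^ 2 := fun c =>
    (abs_ratioGrad_le f j c y).trans (gradSize_le hb j hy)
  have hK0 : 0 ≤ K j c c' := (abs_nonneg _).trans (hK j c c' y)
  rw [abs_mul, abs_mul]
  gcongr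
  · exact h1 c
  · exact hK j c c' y
  · exact h1 c'

/-- The whole domain is treated as a single cell, of diameter at most D. -/
theorem exists_abs_le_of_hasBlockBounds (hU : IsConvexDomain U D ρ u₀) (hΛ : 0 ≤ Λ)
    (hb : HasBlockBounds U Λ n f) (hm : ∀ i, Measurable (f i))
    (hf : ∀ i, HasBoundedThird U n C (f i)) (i : Fin 2) :
    ∃ K, ∀ y ∈ box U n, |f i y| ≤ K := by
  obtain ⟨K, hK⟩ := (isCellDensity_exp hU hΛ hb i (hm i) (hf i) (A := fun _ => U)
    (fun _ => subset_rfl) (zero_le_one.trans hU.one_le_D) (fun _ x hx x' hx' => hU.diam x hx x' hx')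
    (y₀ := fun _ => u₀) (fun _ _ => hU.center_mem)).bdd
  refine ⟨K, fun y hy => ?_⟩
  simpa using hK y hy

theorem gapError_le (hΛ : 0 ≤ Λ) (hδ : 0 ≤ δ) (hb : HasBlockBounds U Λ n f) {y : Fin n → E d}
    (hy : y ∈ box U n) : |gapError Λ δ f y| ≤
      200 * (d + 1) * Λ * n ^ 2 * δ ^ 3 * ∑ _j : Fin n, (1 + (2 * d * Λ * n ^ 2) ^ 2) := by
  rw [gapError, abs_of_nonneg (by positivity)]
  have := fun j => gradSize_le hb j hy
  have := fun j => gradSize_nonneg f j y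
  gcongr with j
  · exact gradSize_nonneg f j y
  · exact gradSize_le hb j hy

theorem integral_sub_sub_half {X : Type*} [MeasurableSpace X] {ν : Measure X} {a b c : X → ℝ}
    (ha : Integrable a ν) (hb : Integrable b ν) (hc : Integrable c ν) :
    ∫ x, (a x - b x - 1 / 2 * c x) ∂ν = ∫ x, a x ∂ν - ∫ x, b x ∂ν - 1 / 2 * ∫ x, c x ∂ν := by
  rw [← integral_const_mul, ← integral_sub ha hb]
  exact integral_sub (ha.sub hb) (hc.const_mul _)

/-- Loss of divergence by quantization of a block. -/
theorem abs_integral_sub_quantLogRatio_le (hU : IsConvexDomain U D ρ u₀) (hΛ : 0 ≤ Λ)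
    (hb : HasBlockBounds U Λ n f) (hm : ∀ i, Measurable (f i))
    (hf : ∀ i, HasBoundedThird U n C (f i)) (hprob : IsProbabilityMeasure (blockLaw U (f 0)))
    (hq : IsFineQuantizer U δ N q) (hδ : 0 ≤ δ)
    (hδ1 : δ ≤ 1) (hsmall : 16 * (d + 1) * (Λ + 1) * n ^ 2 * δ ≤ 1) :
    |∫ y, (f 0 y - f 1 y) ∂blockLaw U (f 0) -
        ∫ y, quantLogRatio U q f (label q y) ∂blockLaw U (f 0) -
        1 / 2 * ∫ y, quadLoss f (fun j => cell U q (label q y j)) y ∂blockLaw U (f 0)| ≤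
      ∫ y, gapError Λ δ f y ∂blockLaw U (f 0) := by
  set μ := blockLaw U (f 0) with hμ
  have hbox : ∀ᵐ y ∂μ, y ∈ box U n := ae_blockLaw_mem hU.isOpen _
  obtain ⟨K₀, hK₀⟩ := exists_abs_le_of_hasBlockBounds hU hΛ hb hm hf 0
  obtain ⟨K₁, hK₁⟩ := exists_abs_le_of_hasBlockBounds hU hΛ hb hm hf 1
  obtain ⟨Kq, hKq⟩ := exists_abs_quadLoss_le (U := U) hΛ hb hq.lt
  obtain ⟨Kl, hKl⟩ := exists_abs_label_le (n := n) hq.lt (quantLogRatio U q f)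
  have i0 : Integrable (fun y => f 0 y - f 1 y) μ :=
    (integrable_of_abs_le (hm 0) (hbox.mono hK₀)).sub (integrable_of_abs_le (hm 1) (hbox.mono hK₁))
  have il : Integrable (fun y => quantLogRatio U q f (label q y)) μ :=
    integrable_of_abs_le ((measurable_of_countable (quantLogRatio U q f)).comp (measurable_label hq.measurable))
      (Eventually.of_forall hKl)
  have iq : Integrable (fun y => quadLoss f (fun j => cell U q (label q y j)) y) μ :=
    integrable_of_abs_le (measurable_quadLoss hq.measurable) (hbox.mono hKq)
  have ig : Integrable (gapError Λ δ f) μ := by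
    refine integrable_of_abs_le ?_ (hbox.mono fun y hy => gapError_le hΛ hδ hb hy)
    exact (Finset.measurable_sum _ fun j _ =>
      measurable_const.add ((measurable_gradSize f j).pow_const 2)).const_mul _
  set g : (Fin n → E d) → ℝ := fun y => f 0 y - f 1 y - quantLogRatio U q f (label q y) -
    1 / 2 * quadLoss f (fun j => cell U q (label q y j)) y with hg
  have igg : Integrable g μ := (i0.sub il).sub (iq.const_mul _)
  have eg : ∫ y, g y ∂μ = ∫ y, (f 0 y - f 1 y) ∂μ - ∫ y, quantLogRatio U q f (label q y) ∂μ -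
      1 / 2 * ∫ y, quadLoss f (fun j => cell U q (label q y j)) y ∂μ := by
    exact integral_sub_sub_half i0 il iq
  rw [← eg]
  set Z := Fintype.piFinset fun _ : Fin n => Finset.range N with hZ
  have hBm : ∀ z, MeasurableSet (blockCell U q z : Set (Fin n → E d)) := fun z =>
    MeasurableSet.univ_pi fun j => measurableSet_cell hU.isOpen hq.measurable _
  have hdisj : Set.PairwiseDisjoint (↑Z) fun z => (blockCell U q z : Set (Fin n → E d)) := by
    intro z _ z' _ hne
    refine Set.disjoint_left.2 fun y hy hy' => hne ?_
    rw [← (mem_blockCell.1 hy).2, (mem_blockCell.1 hy').2]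
  have hunion : (⋃ z ∈ Z, blockCell U q z) = box U n := by
    ext y
    simp only [Set.mem_iUnion, mem_blockCell, exists_prop]
    refine ⟨fun ⟨z, _, h, _⟩ => h, fun h => ⟨label q y, ?_, h, rfl⟩⟩
    exact Fintype.mem_piFinset.2 fun j => Finset.mem_range.2 (hq.lt _)
  have hsum : ∀ h : (Fin n → E d) → ℝ, Integrable h μ →
      ∫ y, h y ∂μ = ∑ z ∈ Z, ∫ y in blockCell U q z, h y ∂μ := fun h hh => by
    rw [← integral_biUnion_finset _ (fun z _ => hBm z) hdisj fun z _ => hh.integrableOn, hunion,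
      Measure.restrict_eq_self_of_ae_mem hbox]
  rw [hsum g igg, hsum _ ig]
  refine (Finset.abs_sum_le_sum_abs _ _).trans (Finset.sum_le_sum fun z hz => ?_)
  have hz' : ∀ j, z j < N := fun j => Finset.mem_range.1 (Fintype.mem_piFinset.1 hz j)
  rcases eq_or_ne (μ (blockCell U q z)) 0 with h0 | h0
  · simp [Measure.restrict_eq_zero.2 h0]
  set lam := μ.real (blockCell U q z) with hlam
  have hpos : 0 < lam := (measureReal_nonneg).lt_of_ne' (by
    exact (ENNReal.toReal_pos h0 (measure_ne_top _ _)).ne')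
  set J := ∫ y in blockCell U q z, (f 0 y - f 1 y) ∂μ with hJ
  -- The base point of the expansion on a product cell is arbitrary, so the inequality holds at
  -- every y of the cell and may be averaged over it. The quadratic loss thereby becomes an integral
  -- against the law of the block.
  have hptw : ∀ᵐ y ∂μ.restrict (blockCell U q z), |J - lam * quantLogRatio U q f z -
      1 / 2 * lam * quadLoss f (fun j => cell U q (label q y j)) y| ≤ lam * gapError Λ δ f y := by
    filter_upwards [ae_restrict_mem (hBm z)] with y hy
    have := abs_blockCell_gap_le hU hΛ hb hm hf hq hδ hδ1 hsmall hz' hy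
    have hl := (mem_blockCell.1 hy).2
    simp only [hl]
    exact this
  have hgz : ∫ y in blockCell U q z, g y ∂μ = J - lam * quantLogRatio U q f z -
      1 / 2 * ∫ y in blockCell U q z, quadLoss f (fun j => cell U q (label q y j)) y ∂μ := by
    rw [hg, integral_sub_sub_half i0.integrableOn il.integrableOn iq.integrableOn,
      setIntegral_congr_fun (f := fun y => quantLogRatio U q f (label q y))
        (g := fun _ => quantLogRatio U q f z) (hBm z) fun y hy => by
        simp only [(mem_blockCell.1 hy).2]]
    simp only [integral_const, measureReal_restrict_apply_univ, smul_eq_mul, ← hlam, hJ]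
  have ic : Integrable (fun y => J - lam * quantLogRatio U q f z -
      1 / 2 * lam * quadLoss f (fun j => cell U q (label q y j)) y)
      (μ.restrict (blockCell U q z)) :=
    (integrable_const _).sub (iq.integrableOn.const_mul _)
  have h1 : |∫ y in blockCell U q z, (J - lam * quantLogRatio U q f z -
      1 / 2 * lam * quadLoss f (fun j => cell U q (label q y j)) y) ∂μ| ≤
      ∫ y in blockCell U q z, lam * gapError Λ δ f y ∂μ :=
    abs_integral_le_integral_abs.trans
      (integral_mono_ae ic.abs (ig.integrableOn.const_mul _) hptw)
  -- The terms without y are constant on the cell, so integrating them gives a second factor `lam`.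
  -- This common factor is cancelled at the end.
  have h2 : ∫ y in blockCell U q z, (J - lam * quantLogRatio U q f z -
      1 / 2 * lam * quadLoss f (fun j => cell U q (label q y j)) y) ∂μ =
      lam * ∫ y in blockCell U q z, g y ∂μ := by
    rw [integral_sub (integrable_const _) (iq.integrableOn.const_mul _), integral_const_mul, hgz]
    simp only [integral_const, measureReal_restrict_apply_univ, smul_eq_mul]
    ring
  rw [h2, abs_mul, abs_of_pos hpos, integral_const_mul] at h1
  exact le_of_mul_le_mul_left h1 hpos

end

/-! ### Reduction of the block loss to the variable at time 0 -/

/-- The component `c` of the gradient at `y_0` of the log-likelihood ratio of `(Y_{-a}, …, Y_b)`. -/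
def ratioCoord (f : Fin 2 → (n : ℕ) → (Fin n → E d) → ℝ) (a b : ℕ) (c : Fin d) (ω : Traj d) : ℝ :=
  gradCoord f 0 a b c ω - gradCoord f 1 a b c ω

/-- The expectation of a quadratic form, with coefficients depending on `Y_0`, in the gradient at
`y_0` of the log-likelihood ratio of `(Y_{-a}, …, Y_b)`. -/
def centerLoss (P : Measure (Traj d)) (f : Fin 2 → (n : ℕ) → (Fin n → E d) → ℝ)
    (g : Fin d → Fin d → E d → ℝ) (a b : ℕ) : ℝ :=
  ∑ c, ∑ c', ∫ ω, ratioCoord f a b c ω * g c c' (ω 0) * ratioCoord f a b c' ω ∂P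

theorem measurable_ratioCoord (f : Fin 2 → (n : ℕ) → (Fin n → E d) → ℝ) (a b : ℕ) (c : Fin d) :
    Measurable (ratioCoord f a b c) :=
  (measurable_gradCoord f 0 a b c).sub (measurable_gradCoord f 1 a b c)

theorem fderiv_window_single (f : Fin 2 → (n : ℕ) → (Fin n → E d) → ℝ) (i : Fin 2) {n : ℕ}
    (j : Fin n) {k : ℕ} (h : n = j + k + 1) (c : Fin d) (ω : Traj d) :
    fderiv ℝ (f i n) (window ω (-((j : ℕ) : ℤ)) n) (Pi.single j (EuclideanSpace.single c 1)) =
      gradCoord f i j k c ω := by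
  obtain ⟨j, hj⟩ := j
  simp only at h
  subst h
  rfl

theorem ratioGrad_window (f : Fin 2 → (n : ℕ) → (Fin n → E d) → ℝ) {n : ℕ}
    (j : Fin n) {k : ℕ} (h : n = j + k + 1) (c : Fin d) (ω : Traj d) :
    ratioGrad (fun i => f i n) j c (window ω (-((j : ℕ) : ℤ)) n) = ratioCoord f j k c ω := by
  rw [ratioGrad, ratioCoord, fderiv_window_single f 0 j h, fderiv_window_single f 1 j h]

theorem abs_mul_mul_sub_le {x x' y y' g κ H : ℝ} (hg : |g| ≤ κ) (hx : |x| ≤ H) (hy' : |y'| ≤ H) :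
    |x * g * y - x' * g * y'| ≤ κ * H * (|x - x'| + |y - y'|) := by
  have e : x * g * y - x' * g * y' = x * g * (y - y') + (x - x') * g * y' := by ring
  have hH : 0 ≤ H := (abs_nonneg _).trans hx
  have hκ : 0 ≤ κ := (abs_nonneg _).trans hg
  rw [e]
  refine (abs_add_le _ _).trans ?_
  rw [abs_mul, abs_mul, abs_mul, abs_mul]
  calc _ ≤ H * κ * |y - y'| + |x - x'| * κ * H := by gcongr
    _ = _ := by ring

namespace IsSystem

variable {U : Set (E d)} {P : Measure (Traj d)} {f : Fin 2 → (n : ℕ) → (Fin n → E d) → ℝ}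
  {C D C₁ ρ : ℝ} {u₀ : E d} {Ce ε : ℝ} (S : IsSystem U P f C D C₁ ρ u₀ Ce ε)
  {Λ : ℝ}

include S

theorem abs_ratioCoord_le (hb : ∀ n, HasBlockBounds U Λ n (fun i => f i n)) (m k : ℕ)
    (c : Fin d) : ∀ᵐ ω ∂P, |ratioCoord f m k c ω| ≤ 2 * Λ * ((m + k + 1 : ℕ) : ℝ) ^ 2 := by
  filter_upwards [S.abs_gradCoord_le hb 0 m k c, S.abs_gradCoord_le hb 1 m k c] with ω h0 h1
  refine (abs_sub _ _).trans ((add_le_add h0 h1).trans (le_of_eq (by ring)))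

theorem ae_zero_mem : ∀ᵐ ω ∂P, ω 0 ∈ U := S.mem.mono fun _ h => h 0

theorem integrable_centerLoss (hb : ∀ n, HasBlockBounds U Λ n (fun i => f i n))
    {g : Fin d → Fin d → E d → ℝ} (hg : ∀ c c', Measurable (g c c')) {κ : ℝ}
    (hκ : ∀ c c', ∀ x ∈ U, |g c c' x| ≤ κ) (a b : ℕ) (c c' : Fin d) :
    Integrable (fun ω => ratioCoord f a b c ω * g c c' (ω 0) * ratioCoord f a b c' ω) P := by
  have := S.prob
  refine integrable_of_abs_le (((measurable_ratioCoord f a b c).mul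
    ((hg c c').comp (measurable_pi_apply 0))).mul (measurable_ratioCoord f a b c'))
    (K := (2 * Λ * ((a + b + 1 : ℕ) : ℝ) ^ 2) * κ * (2 * Λ * ((a + b + 1 : ℕ) : ℝ) ^ 2)) ?_
  filter_upwards [S.abs_ratioCoord_le hb a b c, S.abs_ratioCoord_le hb a b c',
    S.ae_zero_mem] with ω h1 h2 h3
  have h4 := hκ c c' _ h3
  have := (abs_nonneg _).trans h4
  have := (abs_nonneg _).trans h1
  rw [abs_mul, abs_mul]
  gcongr

/-- In the difference of two products one gradient factor is bounded in sup norm by H, while the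
increment of the other is bounded in mean by e. -/
theorem abs_centerLoss_sub_le (hb : ∀ n, HasBlockBounds U Λ n (fun i => f i n))
    {g : Fin d → Fin d → E d → ℝ} (hg : ∀ c c', Measurable (g c c')) {κ : ℝ} (hκ0 : 0 ≤ κ)
    (hκ : ∀ c c', ∀ x ∈ U, |g c c' x| ≤ κ) {a b a' b' : ℕ} {H e : ℝ} (hΛ : 0 ≤ Λ)
    (hH : 2 * Λ * ((a + b + 1 : ℕ) : ℝ) ^ 2 ≤ H) (hH' : 2 * Λ * ((a' + b' + 1 : ℕ) : ℝ) ^ 2 ≤ H)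
    (he : ∀ i c, ∫ ω, |gradCoord f i a b c ω - gradCoord f i a' b' c ω| ∂P ≤ e) :
    |centerLoss P f g a b - centerLoss P f g a' b'| ≤ d ^ 2 * (κ * H * (4 * e)) := by
  have := S.prob
  have hH0 : 0 ≤ H := le_trans (by positivity) hH
  have ig : ∀ i a b c, Integrable (gradCoord f i a b c) P := fun i a b c =>
    (S.memLp_gradCoord hb i a b c).integrable (by norm_num)
  have ir : ∀ c, Integrable (fun ω => |ratioCoord f a b c ω - ratioCoord f a' b' c ω|) P :=
    fun c => (((ig 0 a b c).sub (ig 1 a b c)).sub ((ig 0 a' b' c).sub (ig 1 a' b' c))).abs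
  have hr : ∀ c, ∫ ω, |ratioCoord f a b c ω - ratioCoord f a' b' c ω| ∂P ≤ 2 * e := fun c => by
    have i0 := ((ig 0 a b c).sub (ig 0 a' b' c)).abs
    have i1 := ((ig 1 a b c).sub (ig 1 a' b' c)).abs
    calc _ ≤ ∫ ω, (|gradCoord f 0 a b c ω - gradCoord f 0 a' b' c ω| +
          |gradCoord f 1 a b c ω - gradCoord f 1 a' b' c ω|) ∂P := by
          refine integral_mono (ir c) (i0.add i1) fun ω => ?_
          simp only [ratioCoord]
          rw [sub_sub_sub_comm]
          exact abs_sub _ _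
      _ = _ := integral_add i0 i1
      _ ≤ e + e := add_le_add (he 0 c) (he 1 c)
      _ = 2 * e := by ring
  have hterm : ∀ c c', |∫ ω, ratioCoord f a b c ω * g c c' (ω 0) * ratioCoord f a b c' ω ∂P -
      ∫ ω, ratioCoord f a' b' c ω * g c c' (ω 0) * ratioCoord f a' b' c' ω ∂P| ≤
        κ * H * (4 * e) := by
    intro c c'
    have j1 := S.integrable_centerLoss hb hg hκ a b c c'
    have j2 := S.integrable_centerLoss hb hg hκ a' b' c c'
    rw [← integral_sub j1 j2]
    refine abs_integral_le_integral_abs.trans ?_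
    calc _ ≤ ∫ ω, κ * H * (|ratioCoord f a b c ω - ratioCoord f a' b' c ω| +
          |ratioCoord f a b c' ω - ratioCoord f a' b' c' ω|) ∂P := by
          refine integral_mono_ae (j1.sub j2).abs (((ir c).add (ir c')).const_mul _) ?_
          filter_upwards [S.abs_ratioCoord_le hb a b c, S.abs_ratioCoord_le hb a' b' c',
            S.ae_zero_mem] with ω h1 h2 h3
          exact abs_mul_mul_sub_le (hκ c c' _ h3) (h1.trans hH) (h2.trans hH')
      _ = κ * H * (∫ ω, |ratioCoord f a b c ω - ratioCoord f a' b' c ω| ∂P +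
          ∫ ω, |ratioCoord f a b c' ω - ratioCoord f a' b' c' ω| ∂P) := by
          rw [integral_const_mul]
          congr 1
          exact integral_add (ir c) (ir c')
      _ ≤ κ * H * (2 * e + 2 * e) := by gcongr <;> exact hr _
      _ = _ := by ring
  rw [centerLoss, centerLoss, ← Finset.sum_sub_distrib]
  simp_rw [← Finset.sum_sub_distrib]
  refine (Finset.abs_sum_le_sum_abs _ _).trans ?_
  calc _ ≤ ∑ c : Fin d, ∑ c' : Fin d, κ * H * (4 * e) := by
        refine Finset.sum_le_sum fun c _ => (Finset.abs_sum_le_sum_abs _ _).trans ?_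
        exact Finset.sum_le_sum fun c' _ => hterm c c'
    _ = _ := by simp; ring

/-- The leading term of the loss of divergence of a block, by stationarity. -/
theorem integral_quadLoss (hb : ∀ n, HasBlockBounds U Λ n (fun i => f i n)) {q : E d → ℕ}
    (hq : Measurable q) {κ : ℝ} (hκ : ∀ c c', ∀ x ∈ U, |cellCov (cell U q (q x)) c c'| ≤ κ)
    (n : ℕ) :
    ∫ y, quadLoss (fun i => f i n) (fun j => cell U q (label q y j)) y ∂blockLaw U (f 0 n) =
      ∑ j ∈ Finset.range n,
        centerLoss P f (fun c c' x => cellCov (cell U q (q x)) c c') j (n - 1 - j) := by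
  have := S.prob
  set g : Fin d → Fin d → E d → ℝ := fun c c' x => cellCov (cell U q (q x)) c c' with hg
  have hgm : ∀ c c', Measurable (g c c') := fun c c' =>
    (measurable_of_countable fun k : ℕ => cellCov (cell U q k) c c').comp hq
  have hterm : ∀ (j : Fin n) (c c' : Fin d),
      Integrable (fun y => ratioGrad (fun i => f i n) j c y * g c c' (y j) *
        ratioGrad (fun i => f i n) j c' y) (blockLaw U (f 0 n)) ∧
      ∫ y, ratioGrad (fun i => f i n) j c y * g c c' (y j) *
        ratioGrad (fun i => f i n) j c' y ∂blockLaw U (f 0 n) =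
        ∫ ω, ratioCoord f j (n - 1 - j) c ω * g c c' (ω 0) *
          ratioCoord f j (n - 1 - j) c' ω ∂P := by
    intro j c c'
    have hm : Measurable fun y : Fin n → E d => ratioGrad (fun i => f i n) j c y * g c c' (y j) *
        ratioGrad (fun i => f i n) j c' y :=
      ((measurable_ratioGrad _ j c).mul ((hgm c c').comp (measurable_pi_apply j))).mul
        (measurable_ratioGrad _ j c')
    -- A window that starts at time −j has its variable j at time 0.
    have e : ∀ ω, ratioGrad (fun i => f i n) j c (window ω (-((j : ℕ) : ℤ)) n) *
        g c c' (window ω (-((j : ℕ) : ℤ)) n j) *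
        ratioGrad (fun i => f i n) j c' (window ω (-((j : ℕ) : ℤ)) n) =
        ratioCoord f j (n - 1 - j) c ω * g c c' (ω 0) * ratioCoord f j (n - 1 - j) c' ω := by
      intro ω
      have hj := j.2
      rw [ratioGrad_window f j (k := n - 1 - j) (by omega),
        ratioGrad_window f j (k := n - 1 - j) (by omega)]
      simp [window]
    have mp := S.measurePreserving_window (-((j : ℕ) : ℤ)) n
    constructor
    · rw [← mp.integrable_comp hm.aestronglyMeasurable]
      simp only [Function.comp_def, e]
      exact S.integrable_centerLoss hb hgm hκ _ _ c c'
    · rw [← mp.map_eq, integral_map mp.measurable.aemeasurable hm.aestronglyMeasurable]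
      simp only [e]
  have e1 : ∀ y : Fin n → E d, quadLoss (fun i => f i n) (fun j => cell U q (label q y j)) y =
      ∑ j, ∑ c, ∑ c', ratioGrad (fun i => f i n) j c y * g c c' (y j) *
        ratioGrad (fun i => f i n) j c' y := fun y => rfl
  simp_rw [e1]
  rw [integral_finsetSum _ fun j _ => integrable_finsetSum _ fun c _ => integrable_finsetSum _
    fun c' _ => (hterm j c c').1, ← Fin.sum_univ_eq_sum_range
    (fun j => centerLoss P f g j (n - 1 - j))]
  refine Finset.sum_congr rfl fun j _ => ?_
  rw [integral_finsetSum _ fun c _ => integrable_finsetSum _ fun c' _ => (hterm j c c').1,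
    centerLoss]
  refine Finset.sum_congr rfl fun c _ => ?_
  rw [integral_finsetSum _ fun c' _ => (hterm j c c').1]
  exact Finset.sum_congr rfl fun c' _ => (hterm j c c').2

end IsSystem

/-- Before the middle, terms are paired at equal first length, with second lengths one apart; after
it, at equal second length. The first sum has one more term than the second, and the one left
unpaired is w t t. -/
theorem sum_antidiagonal_sub_eq (w : ℕ → ℕ → ℝ) (t : ℕ) :
    ∑ j ∈ Finset.range (2 * t + 1), w j (2 * t + 1 - 1 - j) -
        ∑ j ∈ Finset.range (2 * t), w j (2 * t - 1 - j) - w t t =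
      ∑ j ∈ Finset.range t, (w j (2 * t - j) - w j (2 * t - 1 - j)) +
        ∑ j ∈ Finset.range t, (w (t + 1 + j) (t - 1 - j) - w (t + j) (t - 1 - j)) := by
  have e1 : ∑ j ∈ Finset.range (2 * t + 1), w j (2 * t + 1 - 1 - j) =
      ∑ j ∈ Finset.range t, w j (2 * t - j) + w t t +
        ∑ j ∈ Finset.range t, w (t + 1 + j) (t - 1 - j) := by
    rw [show 2 * t + 1 = (t + 1) + t by ring, Finset.sum_range_add, Finset.sum_range_succ]
    congr 1
    · congr 1
      · exact Finset.sum_congr rfl fun j _ => by congr 1; omega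
      · congr 1; omega
    · exact Finset.sum_congr rfl fun j _ => by congr 1; omega
  have e2 : ∑ j ∈ Finset.range (2 * t), w j (2 * t - 1 - j) =
      ∑ j ∈ Finset.range t, w j (2 * t - 1 - j) +
        ∑ j ∈ Finset.range t, w (t + j) (t - 1 - j) := by
    rw [show 2 * t = t + t by ring, Finset.sum_range_add]
    congr 1
    exact Finset.sum_congr rfl fun j _ => by congr 1; omega
  rw [e1, e2, Finset.sum_sub_distrib, Finset.sum_sub_distrib]
  ring

theorem abs_sum_antidiagonal_sub_le {w : ℕ → ℕ → ℝ} {t : ℕ} {e : ℝ}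
    (h1 : ∀ j < t, |w j (2 * t - 1 - j + 1) - w j (2 * t - 1 - j)| ≤ e)
    (h2 : ∀ j < t, |w (t + j + 1) (t - 1 - j) - w (t + j) (t - 1 - j)| ≤ e) :
    |∑ j ∈ Finset.range (2 * t + 1), w j (2 * t + 1 - 1 - j) -
        ∑ j ∈ Finset.range (2 * t), w j (2 * t - 1 - j) - w t t| ≤ 2 * t * e := by
  rw [sum_antidiagonal_sub_eq]
  calc _ ≤ ∑ _j ∈ Finset.range t, e + ∑ _j ∈ Finset.range t, e := by
        refine (abs_add_le _ _).trans (add_le_add ?_ ?_)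
        · refine (Finset.abs_sum_le_sum_abs _ _).trans (Finset.sum_le_sum fun j hj => ?_)
          have hj := Finset.mem_range.1 hj
          rw [show 2 * t - j = 2 * t - 1 - j + 1 by omega]
          exact h1 j hj
        · refine (Finset.abs_sum_le_sum_abs _ _).trans (Finset.sum_le_sum fun j hj => ?_)
          rw [show t + 1 + j = t + j + 1 by omega]
          exact h2 j (Finset.mem_range.1 hj)
    _ = _ := by simp; ring

/-- Loss of relative entropy of a block of length `n` by quantization. -/
def blockGap (U : Set (E d)) (f : Fin 2 → (n : ℕ) → (Fin n → E d) → ℝ) (q : E d → ℕ) (n : ℕ) : ℝ :=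
  ∫ y, (f 0 n y - f 1 n y) ∂blockLaw U (f 0 n) -
    ∫ y, quantLogRatio U q (fun i => f i n) (label q y) ∂blockLaw U (f 0 n)

namespace IsSystem

variable {U : Set (E d)} {P : Measure (Traj d)} {f : Fin 2 → (n : ℕ) → (Fin n → E d) → ℝ}
  {C D C₁ ρ : ℝ} {u₀ : E d} {Ce ε : ℝ} (S : IsSystem U P f C D C₁ ρ u₀ Ce ε)
  {Λ : ℝ}

include S

/-- Stationarity moves the variable j to time 0, where second moments are bounded uniformly in the
block. The factor 4d² comes from the Cauchy–Schwarz inequality over d coordinates and two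
log-densities. -/
theorem integral_gradSize_sq_le (hb : ∀ n, HasBlockBounds U Λ n (fun i => f i n)) {B : ℝ}
    (hB : ∀ (i : Fin 2) (m k : ℕ) (c : Fin d), ∫ ω, gradCoord f i m k c ω ^ 2 ∂P ≤ B) (n : ℕ)
    (j : Fin n) :
    Integrable (fun y => gradSize (fun i => f i n) j y ^ 2) (blockLaw U (f 0 n)) ∧
      ∫ y, gradSize (fun i => f i n) j y ^ 2 ∂blockLaw U (f 0 n) ≤ 4 * d ^ 2 * B := by
  have := S.prob
  have hprob := (S.isBlockPair n).prob
  have hm := (measurable_gradSize (fun i => f i n) j).pow_const 2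
  have hint : Integrable (fun y => gradSize (fun i => f i n) j y ^ 2) (blockLaw U (f 0 n)) := by
    refine integrable_of_abs_le hm (K := (2 * d * Λ * n ^ 2) ^ 2) ?_
    filter_upwards [ae_blockLaw_mem S.domain.isOpen (f 0 n)] with y hy
    rw [abs_of_nonneg (sq_nonneg _)]
    have := gradSize_le (hb n) j hy
    have := gradSize_nonneg (fun i => f i n) j y
    gcongr
  refine ⟨hint, ?_⟩
  have mp := S.measurePreserving_window (-((j : ℕ) : ℤ)) n
  have hint' := (mp.integrable_comp hm.aestronglyMeasurable).2 hint
  rw [← mp.map_eq, integral_map mp.measurable.aemeasurable hm.aestronglyMeasurable]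
  have hj := j.2
  have isq : ∀ i c, Integrable (fun ω => gradCoord f i j (n - 1 - j) c ω ^ 2) P := fun i c =>
    (S.memLp_gradCoord hb i j (n - 1 - j) c).integrable_sq
  have hle : ∀ ω, gradSize (fun i => f i n) j (window ω (-((j : ℕ) : ℤ)) n) ^ 2 ≤
      ∑ c : Fin d, (2 * d) * (gradCoord f 0 j (n - 1 - j) c ω ^ 2 +
        gradCoord f 1 j (n - 1 - j) c ω ^ 2) := fun ω => by
    rw [gradSize]
    refine sq_sum_le_card_mul_sum_sq.trans ?_
    rw [Finset.card_univ, Fintype.card_fin, Finset.mul_sum]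
    refine Finset.sum_le_sum fun c _ => ?_
    rw [fderiv_window_single f 0 j (k := n - 1 - j) (by omega),
      fderiv_window_single f 1 j (k := n - 1 - j) (by omega), mul_comm 2 (d : ℝ), mul_assoc]
    gcongr
    have := sq_abs (gradCoord f 0 j (n - 1 - j) c ω)
    have := sq_abs (gradCoord f 1 j (n - 1 - j) c ω)
    nlinarith [sq_nonneg (|gradCoord f 0 j (n - 1 - j) c ω| - |gradCoord f 1 j (n - 1 - j) c ω|)]
  have i2 : ∀ c : Fin d, Integrable (fun ω => (2 * d) * (gradCoord f 0 j (n - 1 - j) c ω ^ 2 +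
        gradCoord f 1 j (n - 1 - j) c ω ^ 2)) P := fun c => ((isq 0 c).add (isq 1 c)).const_mul _
  calc _ ≤ ∫ ω, ∑ c : Fin d, (2 * d) * (gradCoord f 0 j (n - 1 - j) c ω ^ 2 +
        gradCoord f 1 j (n - 1 - j) c ω ^ 2) ∂P :=
        integral_mono hint' (integrable_finsetSum _ fun c _ => i2 c) hle
    _ = ∑ c : Fin d, (2 * d) * (∫ ω, gradCoord f 0 j (n - 1 - j) c ω ^ 2 ∂P +
        ∫ ω, gradCoord f 1 j (n - 1 - j) c ω ^ 2 ∂P) := by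
        rw [integral_finsetSum _ fun c _ => i2 c]
        refine Finset.sum_congr rfl fun c _ => ?_
        rw [integral_const_mul, integral_add (isq 0 c) (isq 1 c)]
    _ ≤ ∑ c : Fin d, (2 * d) * (B + B) := by
        gcongr <;> exact hB _ _ _ _
    _ = _ := by simp; ring

/-- The factor n² of `gapError` meets a sum of n uniformly bounded means. -/
theorem integral_gapError_le (hΛ : 0 ≤ Λ) (hb : ∀ n, HasBlockBounds U Λ n (fun i => f i n)) {B : ℝ}
    (hB : ∀ (i : Fin 2) (m k : ℕ) (c : Fin d), ∫ ω, gradCoord f i m k c ω ^ 2 ∂P ≤ B) (n : ℕ)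
    {δ : ℝ} (hδ : 0 ≤ δ) :
    ∫ y, gapError Λ δ (fun i => f i n) y ∂blockLaw U (f 0 n) ≤
      200 * (d + 1) * Λ * (1 + 4 * d ^ 2 * B) * n ^ 3 * δ ^ 3 := by
  have hprob := (S.isBlockPair n).prob
  have h := S.integral_gradSize_sq_le hb hB n
  simp only [gapError]
  have i1 : ∀ j, Integrable (fun y => 1 + gradSize (fun i => f i n) j y ^ 2)
      (blockLaw U (f 0 n)) := fun j => (integrable_const _).add (h j).1
  rw [integral_const_mul, integral_finsetSum _ fun j _ => i1 j]
  calc _ ≤ 200 * (d + 1) * Λ * n ^ 2 * δ ^ 3 * ∑ _j : Fin n, (1 + 4 * d ^ 2 * B) := by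
        gcongr with j
        rw [integral_add (integrable_const _) (h j).1]
        simpa using (h j).2
    _ = _ := by simp; ring

/-- The increment of the loss of relative entropy of blocks is half the centered quadratic loss,
up to an error. -/
theorem exists_abs_blockGap_sub_le (hΛ : 0 ≤ Λ)
    (hb : ∀ n, HasBlockBounds U Λ n (fun i => f i n)) :
    ∃ A : ℝ, 0 ≤ A ∧ ∀ (q : E d → ℕ) (δ : ℝ) (N : ℕ) (κ : ℝ) (t : ℕ), IsFineQuantizer U δ N q →
      0 ≤ δ → δ ≤ 1 → 1 ≤ t → 16 * (d + 1) * (Λ + 1) * ((2 * t + 1 : ℕ) : ℝ) ^ 2 * δ ≤ 1 →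
      0 ≤ κ → (∀ c c', ∀ x ∈ U, |cellCov (cell U q (q x)) c c'| ≤ κ) →
      |blockGap U f q (2 * t + 1) - blockGap U f q (2 * t) -
          1 / 2 * centerLoss P f (fun c c' x => cellCov (cell U q (q x)) c c') t t| ≤
        A * (t ^ 3 * δ ^ 3 + κ / (t : ℝ) ^ ε) := by
  obtain ⟨B, hB0, hB⟩ := S.exists_integral_sq_gradCoord_le hΛ hb
  obtain ⟨K, hK0, hK⟩ := S.exists_integral_abs_dirDeriv_sub_le hΛ hb
  set A₁ : ℝ := 200 * (d + 1) * Λ * (1 + 4 * d ^ 2 * B) with hA₁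
  have hA₁0 : 0 ≤ A₁ := by positivity
  refine ⟨54 * A₁ + 72 * d ^ 2 * Λ * K, by positivity,
    fun q δ N κ t hq hδ hδ1 ht hsmall hκ0 hκ => ?_⟩
  have ht' : (1 : ℝ) ≤ t := by exact_mod_cast ht
  have hblock : ∀ n : ℕ, n ≤ 2 * t + 1 → |blockGap U f q n - 1 / 2 * ∑ j ∈ Finset.range n,
      centerLoss P f (fun c c' x => cellCov (cell U q (q x)) c c') j (n - 1 - j)| ≤
        27 * A₁ * (t ^ 3 * δ ^ 3) := by
    intro n hn
    have hn' : (n : ℝ) ≤ (2 * t + 1 : ℕ) := by exact_mod_cast hn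
    rw [← S.integral_quadLoss hb hq.measurable hκ n, blockGap]
    refine (abs_integral_sub_quantLogRatio_le S.domain hΛ (hb n) (fun i => S.measurable i n)
      (fun i => S.third i n) (S.isBlockPair n).prob hq hδ hδ1 (le_trans (by gcongr) hsmall)).trans ?_
    refine (S.integral_gapError_le hΛ hb hB n hδ).trans ?_
    rw [← hA₁]
    have h3 : (n : ℝ) ≤ 3 * t := by
      push_cast at hn'
      linarith
    calc A₁ * n ^ 3 * δ ^ 3 ≤ A₁ * (3 * t) ^ 3 * δ ^ 3 := by gcongr
      _ = _ := by ring
  set g : Fin d → Fin d → E d → ℝ := fun c c' x => cellCov (cell U q (q x)) c c' with hg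
  have hgm : ∀ c c', Measurable (g c c') := fun c c' =>
    (measurable_of_countable fun k : ℕ => cellCov (cell U q k) c c').comp hq.measurable
  have hdiff : ∀ a b a' b' : ℕ, a + b ≤ 2 * t → a' + b' ≤ 2 * t →
      (∀ i c, ∫ ω, |gradCoord f i a b c ω - gradCoord f i a' b' c ω| ∂P ≤
        K / (t : ℝ) ^ (3 + ε)) →
      |centerLoss P f g a b - centerLoss P f g a' b'| ≤
        d ^ 2 * (κ * (18 * Λ * t ^ 2) * (4 * (K / (t : ℝ) ^ (3 + ε)))) := by
    intro a b a' b' h h' he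
    have hH : ∀ a b : ℕ, a + b ≤ 2 * t → 2 * Λ * ((a + b + 1 : ℕ) : ℝ) ^ 2 ≤ 18 * Λ * t ^ 2 := by
      intro a b h
      have : ((a + b + 1 : ℕ) : ℝ) ≤ 3 * t := by
        have : a + b + 1 ≤ 3 * t := by omega
        exact_mod_cast this
      calc _ ≤ 2 * Λ * (3 * t : ℝ) ^ 2 := by gcongr
        _ = _ := by ring
    exact S.abs_centerLoss_sub_le hb hgm hκ0 hκ hΛ (hH _ _ h) (hH _ _ h') he
  have htel := abs_sum_antidiagonal_sub_le (w := centerLoss P f g) (t := t)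
    (e := d ^ 2 * (κ * (18 * Λ * t ^ 2) * (4 * (K / (t : ℝ) ^ (3 + ε)))))
    (fun j hj => hdiff _ _ _ _ (by omega) (by omega) fun i c =>
      hK i j j (2 * t - 1 - j) 1 t ht le_rfl (Or.inl rfl) (Or.inr (by omega)) (by omega) c)
    (fun j hj => hdiff _ _ _ _ (by omega) (by omega) fun i c =>
      hK i (t + j) (t + j + 1) (t - 1 - j) 0 t ht (by omega) (Or.inr (by omega)) (Or.inl rfl)
        (by omega) c)
  have hpow : (t : ℝ) ^ (3 + ε) = t ^ 3 * (t : ℝ) ^ ε := by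
    rw [Real.rpow_add (by linarith)]
    congr 1
    exact_mod_cast Real.rpow_natCast (t : ℝ) 3
  -- There are 2t differences, each of order κ t² · t^{-(3+ε)}: sup bound times forgetting of the
  -- gradients in mean. The total is of order κ t^{-ε}.
  have htel' : 2 * t * (d ^ 2 * (κ * (18 * Λ * t ^ 2) * (4 * (K / (t : ℝ) ^ (3 + ε))))) =
      144 * d ^ 2 * Λ * K * (κ / (t : ℝ) ^ ε) := by
    have h1 : (t : ℝ) ^ ε ≠ 0 := (Real.rpow_pos_of_pos (by linarith) _).ne'
    rw [hpow]
    field_simp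
    ring
  rw [htel'] at htel
  have b1 := hblock (2 * t + 1) le_rfl
  have b2 := hblock (2 * t) (by omega)
  have hp1 : 0 ≤ (t : ℝ) ^ 3 * δ ^ 3 := by positivity
  have hp2 : 0 ≤ κ / (t : ℝ) ^ ε := by positivity
  have hx1 : 0 ≤ 72 * d ^ 2 * Λ * K * ((t : ℝ) ^ 3 * δ ^ 3) := by positivity
  have hx2 : 0 ≤ 54 * A₁ * (κ / (t : ℝ) ^ ε) := by positivity
  rw [abs_le] at *
  constructor <;> nlinarith [b1.1, b1.2, b2.1, b2.2, htel.1, htel.2]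

end IsSystem

/-! ### The limit -/

theorem integral_abs_mul_le {Ω : Type*} [MeasurableSpace Ω] {μ : Measure Ω} {X Y : Ω → ℝ}
    (hX : MemLp X 2 μ) (hY : MemLp Y 2 μ) :
    ∫ ω, |X ω| * |Y ω| ∂μ ≤ ‖hX.toLp X‖ * ‖hY.toLp Y‖ := by
  have e : ∀ {X : Ω → ℝ} (hX : MemLp X 2 μ), ‖hX.norm.toLp‖ = ‖hX.toLp X‖ := fun hX => by
    rw [Lp.norm_toLp, Lp.norm_toLp, eLpNorm_norm]
  have h := real_inner_le_norm hX.norm.toLp hY.norm.toLp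
  rw [e hX, e hY, L2.inner_def] at h
  refine le_trans (le_of_eq (integral_congr_ae ?_)) h
  filter_upwards [hX.norm.coeFn_toLp, hY.norm.coeFn_toLp] with ω h1 h2
  rw [h1, h2]
  simp [mul_comm]

theorem integrable_abs_mul {Ω : Type*} [MeasurableSpace Ω] {μ : Measure Ω} {X Y : Ω → ℝ}
    (hX : MemLp X 2 μ) (hY : MemLp Y 2 μ) : Integrable (fun ω => |X ω| * |Y ω|) μ :=
  MemLp.integrable_mul hX.norm hY.norm

theorem integrable_mul_coeff_mul {Ω : Type*} [MeasurableSpace Ω] {μ : Measure Ω} {X Y G : Ω → ℝ}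
    (hX : MemLp X 2 μ) (hY : MemLp Y 2 μ) (hG : AEStronglyMeasurable G μ) {κ : ℝ}
    (hκ : ∀ᵐ ω ∂μ, |G ω| ≤ κ) : Integrable (fun ω => X ω * G ω * Y ω) μ := by
  refine ((integrable_abs_mul hX hY).const_mul κ).mono'
    ((hX.aestronglyMeasurable.mul hG).mul hY.aestronglyMeasurable) (hκ.mono fun ω h => ?_)
  rw [Real.norm_eq_abs, abs_mul, abs_mul]
  calc |X ω| * |G ω| * |Y ω| ≤ |X ω| * κ * |Y ω| := by gcongr
    _ = _ := by ring

theorem abs_integral_mul_coeff_mul_le {Ω : Type*} [MeasurableSpace Ω] {μ : Measure Ω}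
    {X Y G : Ω → ℝ} (hX : MemLp X 2 μ) (hY : MemLp Y 2 μ) (hG : AEStronglyMeasurable G μ) {κ : ℝ}
    (hκ0 : 0 ≤ κ) (hκ : ∀ᵐ ω ∂μ, |G ω| ≤ κ) :
    |∫ ω, X ω * G ω * Y ω ∂μ| ≤ κ * (‖hX.toLp X‖ * ‖hY.toLp Y‖) := by
  refine abs_integral_le_integral_abs.trans ?_
  calc _ ≤ ∫ ω, κ * (|X ω| * |Y ω|) ∂μ := by
        refine integral_mono_ae (integrable_mul_coeff_mul hX hY hG hκ).abs
          ((integrable_abs_mul hX hY).const_mul κ) (hκ.mono fun ω h => ?_)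
        beta_reduce
        rw [abs_mul, abs_mul]
        calc |X ω| * |G ω| * |Y ω| ≤ |X ω| * κ * |Y ω| := by gcongr
          _ = _ := by ring
    _ = κ * ∫ ω, |X ω| * |Y ω| ∂μ := integral_const_mul _ _
    _ ≤ _ := by gcongr; exact integral_abs_mul_le hX hY

/-- The product is trilinear, so the three factors are replaced one at a time: the coefficient in
sup norm, the two others in L² by the Cauchy–Schwarz inequality. -/
theorem tendsto_integral_mul_coeff_mul {Ω : Type*} [MeasurableSpace Ω] {μ : Measure Ω}
    {X Y G : ℕ → Ω → ℝ} {X₀ Y₀ G₀ : Ω → ℝ} (hX : ∀ N, MemLp (X N) 2 μ) (hY : ∀ N, MemLp (Y N) 2 μ)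
    (hX₀ : MemLp X₀ 2 μ) (hY₀ : MemLp Y₀ 2 μ) (hG : ∀ᶠ N in atTop, AEStronglyMeasurable (G N) μ)
    (hG₀ : AEStronglyMeasurable G₀ μ) {κ : ℝ} (hκ0 : 0 ≤ κ) (hκ : ∀ᵐ ω ∂μ, |G₀ ω| ≤ κ)
    (hGlim : ∀ η > 0, ∀ᶠ N in atTop, ∀ᵐ ω ∂μ, |G N ω - G₀ ω| ≤ η)
    (hXlim : Tendsto (fun N => ‖(hX N).toLp - hX₀.toLp‖) atTop (𝓝 0))
    (hYlim : Tendsto (fun N => ‖(hY N).toLp - hY₀.toLp‖) atTop (𝓝 0)) :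
    Tendsto (fun N => ∫ ω, X N ω * G N ω * Y N ω ∂μ) atTop (𝓝 (∫ ω, X₀ ω * G₀ ω * Y₀ ω ∂μ)) := by
  set R := ‖hX₀.toLp‖ + 1 with hR
  set R' := ‖hY₀.toLp‖ + 1 with hR'
  have hR0 : 0 < R := by positivity
  have hR0' : 0 < R' := by positivity
  rw [tendsto_iff_norm_sub_tendsto_zero]
  refine (Metric.tendsto_nhds (α := ℝ)).2 fun e he => ?_
  set η : ℝ := e / (2 * (R * R' + κ * R' + κ * R + 1)) with hη
  have hη0 : 0 < η := by positivity
  have hX1 := hXlim.eventually_lt_const (lt_min hη0 one_pos)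
  have hY1 := hYlim.eventually_lt_const (lt_min hη0 one_pos)
  filter_upwards [hX1, hY1, hGlim η hη0, hG] with N h1 h2 h3 hG
  have h3b : ∀ᵐ ω ∂μ, |G N ω| ≤ κ + η := by
    filter_upwards [h3, hκ] with ω h h'
    have := abs_sub_abs_le_abs_sub (G N ω) (G₀ ω)
    linarith
  have nX : ‖(hX N).toLp‖ ≤ R := by
    have := norm_sub_norm_le (hX N).toLp hX₀.toLp
    have := h1.trans_le (min_le_right _ _)
    rw [hR]; linarith
  have nY : ‖(hY N).toLp‖ ≤ R' := by
    have := norm_sub_norm_le (hY N).toLp hY₀.toLp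
    have := h2.trans_le (min_le_right _ _)
    rw [hR']; linarith
  have nX0 : ‖hX₀.toLp‖ ≤ R := by rw [hR]; linarith
  have i1 := integrable_mul_coeff_mul (hX N) (hY N) hG h3b
  have i2 := integrable_mul_coeff_mul hX₀ hY₀ hG₀ hκ
  have j1 := integrable_mul_coeff_mul (hX N) (hY N) (hG.sub hG₀) h3
  have j2 := integrable_mul_coeff_mul ((hX N).sub hX₀) (hY N) hG₀ hκ
  have j3 := integrable_mul_coeff_mul hX₀ ((hY N).sub hY₀) hG₀ hκ
  have b1 := abs_integral_mul_coeff_mul_le (hX N) (hY N) (hG.sub hG₀) hη0.le h3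
  have b2 := abs_integral_mul_coeff_mul_le ((hX N).sub hX₀) (hY N) hG₀ hκ0 hκ
  have b3 := abs_integral_mul_coeff_mul_le hX₀ ((hY N).sub hY₀) hG₀ hκ0 hκ
  have e1 : ∫ ω, X N ω * G N ω * Y N ω ∂μ - ∫ ω, X₀ ω * G₀ ω * Y₀ ω ∂μ =
      ∫ ω, X N ω * (G N - G₀) ω * Y N ω ∂μ + ∫ ω, (X N - X₀) ω * G₀ ω * Y N ω ∂μ +
        ∫ ω, X₀ ω * G₀ ω * (Y N - Y₀) ω ∂μ := by
    have j12 : Integrable (fun ω => X N ω * (G N - G₀) ω * Y N ω +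
        (X N - X₀) ω * G₀ ω * Y N ω) μ := j1.add j2
    rw [← integral_sub i1 i2, ← integral_add j1 j2, ← integral_add j12 j3]
    refine integral_congr_ae (Eventually.of_forall fun ω => ?_)
    simp only [Pi.sub_apply]
    ring
  rw [MemLp.toLp_sub (hX N) hX₀] at b2
  rw [MemLp.toLp_sub (hY N) hY₀] at b3
  have h1' := (h1.trans_le (min_le_left _ _)).le
  have h2' := (h2.trans_le (min_le_left _ _)).le
  rw [dist_zero_right, norm_norm, Real.norm_eq_abs, e1]
  calc _ ≤ η * (R * R') + κ * (η * R') + κ * (R * η) := by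
        refine (abs_add_three _ _ _).trans ?_
        gcongr
        · exact b1.trans (by gcongr)
        · exact b2.trans (by gcongr)
        · exact b3.trans (by gcongr)
    _ = η * (R * R' + κ * R' + κ * R) := by ring
    _ ≤ η * (R * R' + κ * R' + κ * R + 1) :=
        mul_le_mul_of_nonneg_left (by linarith) hη0.le
    _ = e / 2 := by
        rw [hη]
        have : 0 < R * R' + κ * R' + κ * R + 1 := by positivity
        field_simp
    _ < e := by linarith

/-! ### Choice of the block length and passage to the limit -/

/-- Block lengths that grow at a suitable rate. -/
theorem exists_block_length {ε : ℝ} (hε : 0 < ε) {x : ℕ → ℝ} (hx : Tendsto x atTop atTop) :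
    ∃ t : ℕ → ℕ, Tendsto t atTop atTop ∧
      Tendsto (fun N => (t N : ℝ) ^ 3 / x N) atTop (𝓝 0) ∧
      Tendsto (fun N => x N ^ 2 / (1 + (2 * t N : ℕ) : ℝ) ^ (6 + ε)) atTop (𝓝 0) := by
  -- With t of order x^α the two limits require 3α < 1 and α(6+ε) > 2. The interval is nonempty
  -- because ε > 0.
  obtain ⟨α, hα1, hα2⟩ : ∃ α : ℝ, 2 / (6 + ε) < α ∧ α < 1 / 3 :=
    exists_between (by rw [div_lt_div_iff₀ (by positivity) (by norm_num)]; linarith)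
  have hα0 : 0 < α := lt_trans (by positivity) hα1
  have hα6 : 2 < α * (6 + ε) := by rwa [div_lt_iff₀ (by positivity)] at hα1
  have hx1 : ∀ᶠ N in atTop, 1 ≤ x N := hx.eventually_ge_atTop 1
  refine ⟨fun N => ⌈x N ^ α⌉₊, ?_, ?_, ?_⟩
  · exact tendsto_nat_ceil_atTop.comp ((tendsto_rpow_atTop hα0).comp hx)
  · have h := ((tendsto_rpow_neg_atTop (y := 1 - 3 * α) (by linarith)).comp hx).const_mul 8
    rw [mul_zero] at h
    refine squeeze_zero' (hx1.mono fun N h => by positivity) ?_ h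
    filter_upwards [hx1] with N hN
    have hpos : 0 < x N := by linarith
    have h1 : 1 ≤ x N ^ α := Real.one_le_rpow hN hα0.le
    have h2 : (⌈x N ^ α⌉₊ : ℝ) ≤ 2 * x N ^ α := by
      have := (Nat.ceil_lt_add_one (zero_le_one.trans h1)).le
      linarith
    have h3 : (x N ^ α) ^ 3 / x N = x N ^ (-(1 - 3 * α)) := by
      rw [← Real.rpow_natCast, ← Real.rpow_mul hpos.le]
      nth_rewrite 2 [← Real.rpow_one (x N)]
      rw [← Real.rpow_sub hpos]
      congr 1
      push_cast
      ring
    calc (⌈x N ^ α⌉₊ : ℝ) ^ 3 / x N ≤ (2 * x N ^ α) ^ 3 / x N := by gcongr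
      _ = 8 * ((x N ^ α) ^ 3 / x N) := by ring
      _ = _ := by rw [h3]; rfl
  · have h := (tendsto_rpow_neg_atTop (y := α * (6 + ε) - 2) (by linarith)).comp hx
    refine squeeze_zero' (hx1.mono fun N h => by positivity) ?_ h
    filter_upwards [hx1] with N hN
    have hpos : 0 < x N := by linarith
    have h2 : x N ^ α ≤ 1 + ((2 * ⌈x N ^ α⌉₊ : ℕ) : ℝ) := by
      have := Nat.le_ceil (x N ^ α)
      push_cast
      linarith [Nat.cast_nonneg (α := ℝ) ⌈x N ^ α⌉₊]
    have h3 : x N ^ 2 / (x N ^ α) ^ (6 + ε) = x N ^ (-(α * (6 + ε) - 2)) := by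
      rw [← Real.rpow_mul hpos.le, ← Real.rpow_natCast, ← Real.rpow_sub hpos]
      congr 1
      push_cast
      ring
    calc _ ≤ x N ^ 2 / (x N ^ α) ^ (6 + ε) := by gcongr
      _ = _ := by rw [h3]; rfl

/-- The expected log-likelihood ratio of a quantized block. -/
def quantDivergence (U : Set (E d)) (f : Fin 2 → (n : ℕ) → (Fin n → E d) → ℝ) (q : E d → ℕ)
    (n : ℕ) : ℝ :=
  ∫ y, quantLogRatio U q (fun i => f i n) (label q y) ∂blockLaw U (f 0 n)

namespace IsSystem

variable {U : Set (E d)} {P : Measure (Traj d)} {f : Fin 2 → (n : ℕ) → (Fin n → E d) → ℝ}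
  {C D C₁ ρ : ℝ} {u₀ : E d} {Ce ε : ℝ} (S : IsSystem U P f C D C₁ ρ u₀ Ce ε)
  {Λ : ℝ}

include S

theorem memLp_ratioCoord (hb : ∀ n, HasBlockBounds U Λ n (fun i => f i n)) (m k : ℕ)
    (c : Fin d) : MemLp (ratioCoord f m k c) 2 P :=
  (S.memLp_gradCoord hb 0 m k c).sub (S.memLp_gradCoord hb 1 m k c)

/-- Chain rule and stationarity: the mean conditional log-ratio is the increment of the relative
entropy from length m to length m + 1. -/
theorem integral_logCondDens_sub (m : ℕ) :
    ∫ ω, (logCondDens f 0 m ω - logCondDens f 1 m ω) ∂P =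
      ∫ y, (f 0 (m + 1) y - f 1 (m + 1) y) ∂blockLaw U (f 0 (m + 1)) -
        ∫ y, (f 0 m y - f 1 m y) ∂blockLaw U (f 0 m) := by
  have h : ∀ n, ∫ y, (f 0 n y - f 1 n y) ∂blockLaw U (f 0 n) =
      ∫ ω, (logDens f 0 (-(m : ℤ)) n ω - logDens f 1 (-(m : ℤ)) n ω) ∂P := fun n => by
    have mp := S.measurePreserving_window (-(m : ℤ)) n
    have hm : Measurable fun y => f 0 n y - f 1 n y := (S.measurable 0 n).sub (S.measurable 1 n)
    rw [← mp.map_eq, integral_map mp.measurable.aemeasurable hm.aestronglyMeasurable]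
    rfl
  have i : ∀ n, Integrable (fun ω => logDens f 0 (-(m : ℤ)) n ω - logDens f 1 (-(m : ℤ)) n ω) P :=
    fun n => (S.integrable_logDens 0 _ n).sub (S.integrable_logDens 1 _ n)
  rw [h, h, ← integral_sub (i _) (i _)]
  refine integral_congr_ae (Eventually.of_forall fun ω => ?_)
  simp only [logCondDens]
  ring

/-- The rescaled loss of the error exponent converges. -/
theorem tendsto_rescaled_loss (hΛ : 0 ≤ Λ) (hb : ∀ n, HasBlockBounds U Λ n (fun i => f i n))
    {q : ℕ → E d → ℕ} {r : ℝ} (hr : 0 ≤ r)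
    (hq : ∀ N : ℕ, 2 ≤ N → IsFineQuantizer U (r / (N : ℝ) ^ (1 / (d : ℝ))) N (q N))
    {g : Fin d → Fin d → E d → ℝ} (hg : ∀ c c', Measurable (g c c')) {κ : ℝ} (hκ0 : 0 ≤ κ)
    (hκ : ∀ c c', ∀ x ∈ U, |g c c' x| ≤ κ)
    (hlim : ∀ c c', TendstoUniformlyOn
      (fun (N : ℕ) x => (N : ℝ) ^ (2 / (d : ℝ)) * cellCov (cell U (q N) (q N x)) c c') (g c c') atTop U)
    {L : Fin d → Traj d → ℝ} (hL : ∀ c, MemLp (L c) 2 P)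
    (hLlim : ∀ c, Tendsto (fun t => ‖(S.memLp_ratioCoord hb t t c).toLp - (hL c).toLp‖) atTop (𝓝 0))
    {K : ℝ} {KN : ℕ → ℝ} {Cq : ℝ}
    (hK : ∀ m : ℕ, |K - ∫ ω, (logCondDens f 0 m ω - logCondDens f 1 m ω) ∂P| ≤
      Cq / (1 + (m : ℝ)) ^ (6 + ε))
    (hKN : ∀ N, 2 ≤ N → ∀ m : ℕ,
      |KN N - (quantDivergence U f (q N) (m + 1) - quantDivergence U f (q N) m)| ≤
        Cq / (1 + (m : ℝ)) ^ (6 + ε)) :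
    Tendsto (fun N : ℕ => (N : ℝ) ^ (2 / (d : ℝ)) * (K - KN N)) atTop
      (𝓝 (1 / 2 * ∑ c, ∑ c', ∫ ω, L c ω * g c c' (ω 0) * L c' ω ∂P)) := by
  have := S.prob
  have hε := S.ε_pos
  have hd : (0 : ℝ) < d := by
    have := S.dim
    exact_mod_cast this
  obtain ⟨A, hA0, hA⟩ := S.exists_abs_blockGap_sub_le hΛ hb
  set x : ℕ → ℝ := fun N => (N : ℝ) ^ (1 / (d : ℝ)) with hx
  have hxtop : Tendsto x atTop atTop :=
    (tendsto_rpow_atTop (by positivity)).comp tendsto_natCast_atTop_atTop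
  have hx2 : ∀ N : ℕ, (N : ℝ) ^ (2 / (d : ℝ)) = x N ^ 2 := fun N => by
    rw [hx, ← Real.rpow_natCast, ← Real.rpow_mul (Nat.cast_nonneg N)]
    congr 1
    push_cast
    ring
  -- The variable x is N^{1/d}, the inverse scale of the cells.
  obtain ⟨t, ht, ht3, ht6⟩ := exists_block_length hε hxtop
  set G : ℕ → Fin d → Fin d → E d → ℝ := fun N c c' y => cellCov (cell U (q N) (q N y)) c c'
    with hG
  have hquad : Tendsto (fun N => x N ^ 2 * centerLoss P f (G N) (t N) (t N)) atTop
      (𝓝 (∑ c, ∑ c', ∫ ω, L c ω * g c c' (ω 0) * L c' ω ∂P)) := by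
    have e : ∀ N, x N ^ 2 * centerLoss P f (G N) (t N) (t N) = ∑ c, ∑ c',
        ∫ ω, ratioCoord f (t N) (t N) c ω * (x N ^ 2 * G N c c' (ω 0)) *
          ratioCoord f (t N) (t N) c' ω ∂P := fun N => by
      rw [centerLoss, Finset.mul_sum]
      refine Finset.sum_congr rfl fun c _ => ?_
      rw [Finset.mul_sum]
      refine Finset.sum_congr rfl fun c' _ => ?_
      rw [← integral_const_mul]
      refine integral_congr_ae (Eventually.of_forall fun ω => ?_)
      ring
    simp_rw [e]
    refine tendsto_finsetSum _ fun c _ => tendsto_finsetSum _ fun c' _ => ?_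
    have hGm : ∀ᶠ N in atTop, AEStronglyMeasurable (fun ω : Traj d => x N ^ 2 * G N c c' (ω 0)) P := by
      filter_upwards [eventually_ge_atTop 2] with N hN
      have : Measurable (G N c c') := (measurable_of_countable fun k : ℕ =>
        cellCov (cell U (q N) k) c c').comp (hq N hN).measurable
      exact ((this.comp (measurable_pi_apply 0)).const_mul _).aestronglyMeasurable
    refine tendsto_integral_mul_coeff_mul (μ := P) (G₀ := fun ω => g c c' (ω 0))
      (fun N => S.memLp_ratioCoord hb (t N) (t N) c)
      (fun N => S.memLp_ratioCoord hb (t N) (t N) c') (hL c) (hL c') hGm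
      ((hg c c').comp (measurable_pi_apply 0)).aestronglyMeasurable hκ0
      (S.ae_zero_mem.mono fun ω h => hκ c c' _ h) (fun η hη => ?_)
      ((hLlim c).comp ht) ((hLlim c').comp ht)
    filter_upwards [Metric.tendstoUniformlyOn_iff.1 (hlim c c') η hη] with N hN
    filter_upwards [S.ae_zero_mem] with ω hω
    have := hN _ hω
    rw [dist_comm, Real.dist_eq, hx2] at this
    exact this.le
  have hcov : ∀ᶠ N in atTop, ∀ c c', ∀ y ∈ U, |x N ^ 2 * G N c c' y| ≤ κ + 1 := by
    refine eventually_all.2 fun c => eventually_all.2 fun c' => ?_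
    filter_upwards [Metric.tendstoUniformlyOn_iff.1 (hlim c c') 1 one_pos] with N hN y hy
    have h1 := hN y hy
    rw [dist_comm, Real.dist_eq, hx2] at h1
    have h2 := abs_sub_abs_le_abs_sub (x N ^ 2 * G N c c' y) (g c c' y)
    have h3 := hκ c c' y hy
    linarith
  -- The three errors after multiplication by x²: forgetting for both exponents, then the expansion
  -- error t³δ³ with δ = r/x, then the cancellation error t^{-ε}, whose coefficient is bounded
  -- because the cell covariances are O(x^{-2}).
  set b : ℕ → ℝ := fun N => 2 * Cq * (x N ^ 2 / (1 + (2 * t N : ℕ) : ℝ) ^ (6 + ε)) +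
    A * (r ^ 3 * ((t N : ℝ) ^ 3 / x N) + (κ + 1) / (t N : ℝ) ^ ε) with hbdef
  have htR : Tendsto (fun N => (t N : ℝ)) atTop atTop := tendsto_natCast_atTop_atTop.comp ht
  have hb0 : Tendsto b atTop (𝓝 0) := by
    have h1 : Tendsto (fun N => (κ + 1) / (t N : ℝ) ^ ε) atTop (𝓝 0) :=
      ((tendsto_rpow_atTop hε).comp htR).const_div_atTop _
    have := (ht6.const_mul (2 * Cq)).add (((ht3.const_mul (r ^ 3)).add h1).const_mul A)
    simp only [mul_zero, add_zero] at this
    exact this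
  have hsmall : ∀ᶠ N in atTop,
      16 * (d + 1) * (Λ + 1) * ((2 * t N + 1 : ℕ) : ℝ) ^ 2 * (r / x N) ≤ 1 := by
    have h0 := ht3.const_mul (16 * (d + 1) * (Λ + 1) * 9 * r)
    rw [mul_zero] at h0
    filter_upwards [h0.eventually_le_const one_pos, ht.eventually_ge_atTop 1,
      hxtop.eventually_gt_atTop 0] with N h1 h2 h3
    have h2' : (1 : ℝ) ≤ t N := by exact_mod_cast h2
    refine le_trans ?_ h1
    have h4 : ((2 * t N + 1 : ℕ) : ℝ) ^ 2 ≤ 9 * (t N : ℝ) ^ 3 := by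
      push_cast
      have : (2 * t N + 1 : ℝ) ≤ 3 * t N := by linarith
      calc (2 * t N + 1 : ℝ) ^ 2 ≤ (3 * t N) ^ 2 := by gcongr
        _ = 9 * (t N : ℝ) ^ 2 := by ring
        _ ≤ 9 * (t N : ℝ) ^ 3 := by gcongr; norm_num [h2']
    calc _ ≤ 16 * (d + 1) * (Λ + 1) * (9 * (t N : ℝ) ^ 3) * (r / x N) := by gcongr
      _ = _ := by ring
  have hdiff : Tendsto (fun N : ℕ => (N : ℝ) ^ (2 / (d : ℝ)) * (K - KN N) -
      1 / 2 * (x N ^ 2 * centerLoss P f (G N) (t N) (t N))) atTop (𝓝 0) := by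
    refine squeeze_zero_norm' ?_ hb0
    filter_upwards [hcov, hsmall, ht.eventually_ge_atTop 1, hxtop.eventually_gt_atTop 0,
      hxtop.eventually_ge_atTop r, eventually_ge_atTop 2] with N h1 h2 h3 h4 h5 h6
    have hδ1 : r / x N ≤ 1 := by rwa [div_le_one h4]
    have hcov' : ∀ c c', ∀ y ∈ U, |cellCov (cell U (q N) (q N y)) c c'| ≤ (κ + 1) / x N ^ 2 := by
      intro c c' y hy
      have := h1 c c' y hy
      rw [abs_mul, abs_of_pos (by positivity)] at this
      rw [le_div_iff₀ (by positivity), mul_comm]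
      exact this
    have key := hA (q N) (r / x N) N ((κ + 1) / x N ^ 2) (t N) (hq N h6) (by positivity) hδ1 h3 h2
      (by positivity) hcov'
    -- An even past length 2t: with the present variable the block has 2t + 1 variables and an exact
    -- middle one.
    have k1 := hK (2 * t N)
    have k2 := hKN N h6 (2 * t N)
    rw [S.integral_logCondDens_sub] at k1
    have e1 : |K - KN N - 1 / 2 * centerLoss P f (G N) (t N) (t N)| ≤
        2 * (Cq / (1 + (2 * t N : ℕ) : ℝ) ^ (6 + ε)) +
          A * (t N ^ 3 * (r / x N) ^ 3 + (κ + 1) / x N ^ 2 / (t N : ℝ) ^ ε) := by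
      simp only [blockGap, quantDivergence] at key k2
      rw [abs_le] at key k1 k2 ⊢
      constructor <;> linarith [key.1, key.2, k1.1, k1.2, k2.1, k2.2]
    rw [Real.norm_eq_abs, hx2]
    have e2 : x N ^ 2 * (K - KN N) - 1 / 2 * (x N ^ 2 * centerLoss P f (G N) (t N) (t N)) =
        x N ^ 2 * (K - KN N - 1 / 2 * centerLoss P f (G N) (t N) (t N)) := by ring
    rw [e2, abs_mul, abs_of_pos (by positivity)]
    calc _ ≤ x N ^ 2 * _ := mul_le_mul_of_nonneg_left e1 (sq_nonneg _)
      _ = b N := by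
        rw [hbdef]
        have hT : (t N : ℝ) ^ ε ≠ 0 := (Real.rpow_pos_of_pos (by exact_mod_cast h3) _).ne'
        have hW : (1 + (2 * t N : ℕ) : ℝ) ^ (6 + ε) ≠ 0 :=
          (Real.rpow_pos_of_pos (by positivity) _).ne'
        have hX : x N ≠ 0 := h4.ne'
        beta_reduce
        generalize (t N : ℝ) ^ ε = T at hT ⊢
        generalize (1 + (2 * t N : ℕ) : ℝ) ^ (6 + ε) = W at hW ⊢
        generalize x N = X at hX ⊢
        field_simp
  have := hdiff.add (hquad.const_mul (1 / 2))
  simpa using this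

end IsSystem

/-! ### The system of log-densities on the interior of the domain -/

/-- The log-density of a block, set to `0` off `Uⁿ`. -/
def logDensOn (U : Set (E d)) (p : (n : ℕ) → (Fin n → E d) → ℝ) (n : ℕ) : (Fin n → E d) → ℝ :=
  (box U n).indicator fun y => Real.log (p n y)

theorem logDensOn_of_mem {U : Set (E d)} {p : (n : ℕ) → (Fin n → E d) → ℝ} {n : ℕ}
    {y : Fin n → E d} (hy : y ∈ box U n) : logDensOn U p n y = Real.log (p n y) :=
  Set.indicator_of_mem hy _

/-- If the interior were empty, a convex set would lie in the closure of its own null frontier and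
have zero volume. -/
theorem exists_isConvexDomain {Y : Set (E d)} (hc : Convex ℝ Y) (hb : Bornology.IsBounded Y)
    (h0 : volume Y ≠ 0) : ∃ D ρ u₀, IsConvexDomain (interior Y) D ρ u₀ := by
  have hne : (interior Y).Nonempty := by
    by_contra h
    rw [Set.not_nonempty_iff_eq_empty] at h
    have h1 := hc.addHaar_frontier (volume : Measure (E d))
    rw [frontier, h, Set.sdiff_empty] at h1
    exact h0 (measure_mono_null subset_closure h1)
  obtain ⟨u₀, hu₀⟩ := hne
  obtain ⟨r, hr, hball⟩ := Metric.isOpen_iff.1 isOpen_interior u₀ hu₀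
  refine ⟨max 1 (Metric.diam Y), r / 2, u₀, isOpen_interior, hc.interior, fun x hx y hy => ?_,
    le_max_left _ _, by positivity, fun v hv => hball ?_⟩
  · rw [← dist_eq_norm]
    exact (Metric.dist_le_diam_of_mem hb (interior_subset hx) (interior_subset hy)).trans
      (le_max_right _ _)
  · simp only [Metric.mem_ball, dist_self_add_left]
    linarith

theorem interior_ae_eq {Y : Set (E d)} (hc : Convex ℝ Y) :
    interior Y =ᵐ[(volume : Measure (E d))] Y :=
  interior_ae_eq_of_null_frontier (hc.addHaar_frontier volume)

theorem measurable_logDensOn {U : Set (E d)} (hU : IsOpen U) {p : (n : ℕ) → (Fin n → E d) → ℝ}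
    {n : ℕ} (h : ContinuousOn (fun y => Real.log (p n y)) (box U n)) :
    Measurable (logDensOn U p n) := by
  classical
  have := h.measurable_piecewise (continuousOn_const (c := (0 : ℝ)))
    (isOpen_box hU n).measurableSet
  rw [logDensOn, ← Set.piecewise_eq_indicator]
  exact this

theorem abs_apply_single_le {n : ℕ} {L : (Fin n → E d) →L[ℝ] ℝ} {k : Fin n} {B : ℝ}
    (h : ∀ a, |L (basisVec k a)| ≤ B) (x : E d) : |L (Pi.single k x)| ≤ d * B * ‖x‖ :=
  abs_apply_le_of_basis (L := L.comp (ContinuousLinearMap.single ℝ (fun _ : Fin n => E d) k)) h x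

theorem hasBoundedThird_logDensOn {Y : Set (E d)} {p : (n : ℕ) → (Fin n → E d) → ℝ} {n : ℕ}
    (hc : ContDiffOn ℝ 3 (p n) (box Y n)) (hpos : ∀ y ∈ box Y n, 0 < p n y) {C : ℝ}
    (hC : ∀ y ∈ box Y n, ∀ k l r : Fin n, ∀ a b c : Fin d,
      |iteratedFDerivWithin ℝ 3 (fun y => Real.log (p n y)) (box Y n) y
        ![basisVec k a, basisVec l b, basisVec r c]| ≤ C) :
    HasBoundedThird (interior Y) n (d ^ 3 * C) (logDensOn (interior Y) p n) := by
  have hsub : box (interior Y) n ⊆ box Y n := fun y hy j hj => interior_subset (hy j hj)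
  have hopen : IsOpen (box (interior Y) n) := isOpen_box isOpen_interior n
  have hcd : ContDiffOn ℝ 3 (fun y => Real.log (p n y)) (box (interior Y) n) :=
    (hc.log fun y hy => (hpos y hy).ne').mono hsub
  refine ⟨hcd.congr fun y hy => logDensOn_of_mem hy, fun y hy k l r x x' x'' => ?_⟩
  set T := fderiv ℝ (fderiv ℝ (fderiv ℝ (logDensOn (interior Y) p n))) y with hT
  have hbasis : ∀ a b c : Fin d, |T (basisVec k a) (basisVec l b) (basisVec r c)| ≤ C := by
    intro a b c
    have h1 := hC y (hsub hy) k l r a b c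
    -- At interior points derivatives within the block domain are ordinary derivatives, so the
    -- assumed bound applies. Expanding the three directions in the basis then costs d³.
    have h2 : iteratedFDerivWithin ℝ 3 (fun y => Real.log (p n y)) (box Y n) y =
        iteratedFDeriv ℝ 3 (logDensOn (interior Y) p n) y := by
      rw [iteratedFDerivWithin_congr_set (t := Set.univ) (Filter.eventuallyEq_univ.mpr
          (mem_of_superset (hopen.mem_nhds hy) hsub)), iteratedFDerivWithin_univ]
      refine Filter.EventuallyEq.eq_of_nhds (Filter.EventuallyEq.iteratedFDeriv ℝ ?_ 3)
      filter_upwards [hopen.mem_nhds hy] with z hz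
      exact (logDensOn_of_mem hz).symm
    rw [h2, iteratedFDeriv_succ_apply_right, iteratedFDeriv_two_apply] at h1
    exact h1
  have e1 : |T (Pi.single k x) (Pi.single l x') (Pi.single r x'')| ≤
      d * (d * (d * C * ‖x''‖) * ‖x'‖) * ‖x‖ := by
    have h1 : ∀ a b, |T (basisVec k a) (basisVec l b) (Pi.single r x'')| ≤ d * C * ‖x''‖ :=
      fun a b => abs_apply_single_le (hbasis a b) x''
    have h2 : ∀ a, |T (basisVec k a) (Pi.single l x') (Pi.single r x'')| ≤
        d * (d * C * ‖x''‖) * ‖x'‖ := fun a => by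
      have := abs_apply_single_le (L := (T (basisVec k a)).flip (Pi.single r x'')) (k := l)
        (fun b => by rw [ContinuousLinearMap.flip_apply]; exact h1 a b) x'
      rwa [ContinuousLinearMap.flip_apply] at this
    have := abs_apply_single_le (L := (T.flip (Pi.single l x')).flip (Pi.single r x'')) (k := k)
      (fun a => by
        rw [ContinuousLinearMap.flip_apply, ContinuousLinearMap.flip_apply]; exact h2 a) x
    rwa [ContinuousLinearMap.flip_apply, ContinuousLinearMap.flip_apply] at this
  exact e1.trans (le_of_eq (by ring))

/-- The gradient in one variable of a function that is differentiable at an interior point. -/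
theorem inner_partialGrad {Y : Set (E d)} {n : ℕ} {F : (Fin n → E d) → ℝ} {j : Fin n}
    {y : Fin n → E d} {L : (Fin n → E d) →L[ℝ] ℝ} (hF : HasFDerivAt F L y)
    (hy : y j ∈ interior Y) (x : E d) : inner ℝ (partialGrad Y F j y) x = L (Pi.single j x) := by
  have h1 : HasFDerivAt (fun x => F (Function.update y j x))
      (L.comp (ContinuousLinearMap.single ℝ (fun _ : Fin n => E d) j)) (y j) := by
    have h2 : HasFDerivAt (Function.update y j)
        (ContinuousLinearMap.single ℝ (fun _ : Fin n => E d) j) (y j) := by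
      have h3 := ((ContinuousLinearMap.single ℝ (fun _ : Fin n => E d) j).hasFDerivAt.comp (y j)
        ((hasFDerivAt_id (y j)).sub_const (y j))).const_add y
      refine (h3.congr_of_eventuallyEq (Eventually.of_forall fun x => ?_))
      exact update_eq_add_single y j x
    refine HasFDerivAt.comp (y j) ?_ h2
    rwa [Function.update_eq_self]
  rw [partialGrad, gradientWithin, fderivWithin_of_mem_nhds (mem_interior_iff_mem_nhds.1 hy),
    h1.fderiv]
  simp

/-! ### Almost sure passage to the interior and identification of the gradients -/

section

variable {Y : Set (E d)} {P : Fin 2 → Measure (Traj d)}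
  {p : Fin 2 → (n : ℕ) → (Fin n → E d) → ℝ}

theorem restrict_interior_eq (hc : Convex ℝ Y) :
    (volume : Measure (E d)).restrict (interior Y) = volume.restrict Y :=
  Measure.restrict_congr_set (interior_ae_eq hc)

theorem box_interior_subset (n : ℕ) : box (interior Y) n ⊆ box Y n :=
  fun _ hy j hj => interior_subset (hy j hj)

/-- The one-variable law has a density and the frontier is null. Stationarity extends this from time
1 to all times. -/
theorem ae_mem_interior (hModel : IsModel Y P) (hDens : HasDensities Y P p) (i : Fin 2) :
    ∀ᵐ ω ∂P i, ∀ k, ω k ∈ interior Y := by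
  have h1 : ∀ᵐ ω ∂P i, ω 1 ∈ interior Y := by
    have h2 : ∀ᵐ y ∂(P i).map (fun ω => window ω 1 1), y 0 ∈ interior Y := by
      rw [hDens.density]
      refine (withDensity_absolutelyContinuous _ _).ae_le ?_
      refine (Measure.quasiMeasurePreserving_eval
        (fun _ : Fin 1 => (volume : Measure (E d)).restrict Y) 0).ae ?_
      rw [← restrict_interior_eq hModel.convex]
      exact ae_restrict_mem isOpen_interior.measurableSet
    have h3 := ae_of_ae_map (measurable_window 1 1).aemeasurable h2
    filter_upwards [h3] with ω hω
    simpa [window] using hω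
  refine ae_all_iff.2 fun k => ?_
  have mp := measurePreserving_timeShift (hModel.ergodic i).toMeasurePreserving (k - 1)
  filter_upwards [mp.quasiMeasurePreserving.ae h1] with ω hω
  simpa [timeShift] using hω

theorem map_window_eq_blockLaw (hModel : IsModel Y P) (hDens : HasDensities Y P p) (i : Fin 2)
    (n : ℕ) : (P i).map (fun ω => window ω 1 n) =
      blockLaw (interior Y) (logDensOn (interior Y) (p i) n) := by
  rw [hDens.density, ← restrict_interior_eq hModel.convex, blockLaw, box, volume_pi,
    Measure.restrict_pi_pi]
  refine withDensity_congr_ae ?_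
  have : ∀ᵐ y ∂Measure.pi (fun _ : Fin n => (volume : Measure (E d)).restrict (interior Y)),
      y ∈ box (interior Y) n := by
    rw [← Measure.restrict_pi_pi]
    exact ae_restrict_mem (isOpen_box isOpen_interior n).measurableSet
  filter_upwards [this] with y hy
  rw [logDensOn_of_mem hy, Real.exp_log (hDens.pos i n y (box_interior_subset n hy))]

theorem logCond_eq (hDens : HasDensities Y P p) {ω : Traj d} (hω : ∀ k, ω k ∈ interior Y)
    (i : Fin 2) (m : ℕ) :
    logCond p i m ω = logCondDens (fun i n => logDensOn (interior Y) (p i) n) i m ω := by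
  have hw : ∀ a n, window ω a n ∈ box (interior Y) n := fun a n k _ => hω _
  have hpos : ∀ a n, 0 < p i n (window ω a n) := fun a n =>
    hDens.pos i n _ (box_interior_subset n (hw a n))
  simp only [logCondDens, logDens]
  rw [logDensOn_of_mem (hw _ _), logDensOn_of_mem (hw _ _), logCond, condDens]
  exact Real.log_div (hpos _ _).ne' (hpos (-(m : ℤ)) m).ne'

/-- The first `a` variables of a block. -/
def truncate (a b : ℕ) : (Fin (a + b) → E d) →L[ℝ] (Fin a → E d) :=
  ContinuousLinearMap.pi fun j => ContinuousLinearMap.proj (Fin.castAdd b j)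

theorem truncate_single_of_lt {a b m : ℕ} (h : m < a) (x : E d) :
    truncate a b (Pi.single ⟨m, h.trans_le (Nat.le_add_right a b)⟩ x) = Pi.single ⟨m, h⟩ x := by
  funext j
  simp only [truncate, ContinuousLinearMap.pi_apply, ContinuousLinearMap.proj_apply,
    Pi.single_apply, Fin.ext_iff, Fin.val_castAdd]

theorem truncate_single_of_le {a b m : ℕ} (h : a ≤ m) (h' : m < a + b) (x : E d) :
    truncate a b (Pi.single ⟨m, h'⟩ x) = 0 := by
  funext j
  have hj : (j : ℕ) ≠ m := by have := j.2; omega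
  simp [truncate, Fin.ext_iff, hj]

theorem hasFDerivAt_logDensOn (hDens : HasDensities Y P p) {i : Fin 2} {n : ℕ}
    (hc : ContDiffOn ℝ 3 (p i n) (box Y n)) {w : Fin n → E d} (hw : w ∈ box (interior Y) n) :
    HasFDerivAt (logDensOn (interior Y) (p i) n)
      (fderiv ℝ (logDensOn (interior Y) (p i) n) w) w := by
  have h1 : ContDiffOn ℝ 3 (logDensOn (interior Y) (p i) n) (box (interior Y) n) :=
    ((hc.log fun y hy => (hDens.pos i n y hy).ne').mono (box_interior_subset n)).congr
      fun y hy => logDensOn_of_mem hy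
  exact ((h1.contDiffAt ((isOpen_box isOpen_interior n).mem_nhds hw)).differentiableAt
    (by norm_num)).hasFDerivAt

theorem hasFDerivAt_log_condDens (hDens : HasDensities Y P p) {i : Fin 2} {a b : ℕ}
    (hc : ∀ n, ContDiffOn ℝ 3 (p i n) (box Y n)) {w : Fin (a + b) → E d}
    (hw : w ∈ box (interior Y) (a + b)) :
    HasFDerivAt (fun y => Real.log (condDens (p i) a b y))
      (fderiv ℝ (logDensOn (interior Y) (p i) (a + b)) w -
        (fderiv ℝ (logDensOn (interior Y) (p i) a) (truncate a b w)).comp (truncate a b)) w := by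
  have htr : ∀ y ∈ box (interior Y) (a + b), truncate a b y ∈ box (interior Y) a :=
    fun y hy j _ => hy (Fin.castAdd b j) trivial
  have h1 := hasFDerivAt_logDensOn hDens (hc (a + b)) hw
  have h2 := (hasFDerivAt_logDensOn hDens (hc a) (htr w hw)).comp w (truncate a b).hasFDerivAt
  refine (h1.sub h2).congr_of_eventuallyEq ?_
  filter_upwards [(isOpen_box isOpen_interior _).mem_nhds hw] with y hy
  simp only [Pi.sub_apply, Function.comp_apply]
  rw [logDensOn_of_mem hy, logDensOn_of_mem (htr y hy), condDens]
  exact Real.log_div (hDens.pos i _ y (box_interior_subset _ hy)).ne'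
    (hDens.pos i _ _ (box_interior_subset _ (htr y hy))).ne'

theorem inner_gradLast_zero (hDens : HasDensities Y P p) {i : Fin 2}
    (hc : ∀ n, ContDiffOn ℝ 3 (p i n) (box Y n)) {ω : Traj d} (hω : ∀ k, ω k ∈ interior Y) (m : ℕ)
    (x : E d) : inner ℝ (gradLast Y p i m 0 ω) x =
      dirDeriv (fun i n => logDensOn (interior Y) (p i) n) i m 0 ω x := by
  have hw : window ω (-(m : ℤ)) (m + 0 + 1) ∈ box (interior Y) (m + 0 + 1) := fun _ _ => hω _
  rw [gradLast, inner_partialGrad (hasFDerivAt_log_condDens hDens hc hw) (hω _),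
    sub_apply, ContinuousLinearMap.comp_apply,
    truncate_single_of_le (by simp), map_zero, sub_zero]
  rfl

/-- The conditional log-density of Y_{k+1} is the difference of two block log-densities, and the
derivative in y_0 of each of them counts. For k = 0 the conditioning block ends before time 0 and
contributes nothing, as in `inner_gradLast_zero`. -/
theorem inner_gradLast_succ (hDens : HasDensities Y P p) {i : Fin 2}
    (hc : ∀ n, ContDiffOn ℝ 3 (p i n) (box Y n)) {ω : Traj d} (hω : ∀ k, ω k ∈ interior Y)
    (m k : ℕ) (x : E d) : inner ℝ (gradLast Y p i m (k + 1) ω) x =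
      dirDeriv (fun i n => logDensOn (interior Y) (p i) n) i m (k + 1) ω x -
        dirDeriv (fun i n => logDensOn (interior Y) (p i) n) i m k ω x := by
  have hw : window ω (-(m : ℤ)) (m + (k + 1) + 1) ∈ box (interior Y) (m + (k + 1) + 1) :=
    fun _ _ => hω _
  rw [gradLast, inner_partialGrad (hasFDerivAt_log_condDens hDens hc hw) (hω _),
    sub_apply, ContinuousLinearMap.comp_apply,
    truncate_single_of_lt (by omega)]
  rfl

theorem inner_gradRatio (hDens : HasDensities Y P p)
    (hc : ∀ i n, ContDiffOn ℝ 3 (p i n) (box Y n)) {ω : Traj d} (hω : ∀ k, ω k ∈ interior Y)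
    (k : ℕ) (c : Fin d) : gradRatio Y p k ω c =
      ratioCoord (fun i n => logDensOn (interior Y) (p i) n) k k c ω := by
  have hw : window ω (-(k : ℤ)) (2 * k + 1) ∈ box (interior Y) (2 * k + 1) := fun j _ => hω _
  have h1 : HasFDerivAt (fun y => Real.log (p 0 (2 * k + 1) y / p 1 (2 * k + 1) y))
      (fderiv ℝ (logDensOn (interior Y) (p 0) (2 * k + 1)) (window ω (-(k : ℤ)) (2 * k + 1)) -
        fderiv ℝ (logDensOn (interior Y) (p 1) (2 * k + 1)) (window ω (-(k : ℤ)) (2 * k + 1)))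
      (window ω (-(k : ℤ)) (2 * k + 1)) := by
    refine ((hasFDerivAt_logDensOn hDens (hc 0 _) hw).sub
      (hasFDerivAt_logDensOn hDens (hc 1 _) hw)).congr_of_eventuallyEq ?_
    filter_upwards [(isOpen_box isOpen_interior _).mem_nhds hw] with y hy
    simp only [Pi.sub_apply]
    rw [logDensOn_of_mem hy, logDensOn_of_mem hy]
    exact Real.log_div (hDens.pos 0 _ y (box_interior_subset _ hy)).ne'
      (hDens.pos 1 _ y (box_interior_subset _ hy)).ne'
  have h2 := inner_partialGrad (Y := Y) (j := ⟨k, by omega⟩) h1 (hω _) (EuclideanSpace.single c 1)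
  rw [EuclideanSpace.inner_single_right] at h2
  simp only [one_mul, conj_trivial] at h2
  rw [gradRatio, h2, sub_apply]
  exact ratioGrad_window (fun i n => logDensOn (interior Y) (p i) n) ⟨k, by omega⟩
    (show 2 * k + 1 = k + k + 1 by ring) c ω

end

/-! ### The standing assumptions on the log-densities -/

section

variable {Y : Set (E d)} {P : Fin 2 → Measure (Traj d)}
  {p : Fin 2 → (n : ℕ) → (Fin n → E d) → ℝ} {q : ℕ → E d → ℕ}

theorem contDiffOn_block_zero (F : (Fin 0 → E d) → ℝ) (s : Set (Fin 0 → E d)) :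
    ContDiffOn ℝ 3 F s := by
  have : F = fun _ => F default := funext fun y => congrArg F (Subsingleton.elim _ _)
  rw [this]
  exact contDiffOn_const

theorem contDiffOn_dens (hReg : IsSmoothForgetting Y P p q) (i : Fin 2) (n : ℕ) :
    ContDiffOn ℝ 3 (p i n) (box Y n) := by
  rcases Nat.eq_zero_or_pos n with rfl | hn
  · exact contDiffOn_block_zero _ _
  · exact hReg.contDiffOn i n hn

theorem measurable_dirDeriv (f : Fin 2 → (n : ℕ) → (Fin n → E d) → ℝ) (i : Fin 2) (m k : ℕ)
    (x : E d) : Measurable fun ω => dirDeriv f i m k ω x :=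
  (measurable_fderiv_apply_single _ _).comp (measurable_window _ _)

/-- The gradient at y_0 of a block is the sum of the gradients of the conditional log-densities of
Y_0, …, Y_l, each bounded in mean by ψ. Summability of ψ makes the bound uniform in both lengths,
and it is the only a priori information on the size of the gradients. -/
theorem lintegral_dirDeriv_le (hModel : IsModel Y P) (hDens : HasDensities Y P p)
    (hReg : IsSmoothForgetting Y P p q) {ψ : ℕ → ℝ≥0} {i : Fin 2}
    (hψ : ∀ m k, ∫⁻ ω, ‖gradLast Y p i m k ω‖ₑ ∂P 0 ≤ ψ k) (m l : ℕ) (x : E d) :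
    ∫⁻ ω, ‖dirDeriv (fun i n => logDensOn (interior Y) (p i) n) i m l ω x‖ₑ ∂P 0 ≤
      (∑ k ∈ Finset.range (l + 1), (ψ k : ℝ≥0∞)) * ‖x‖ₑ := by
  have hmem := ae_mem_interior hModel hDens 0
  have hinner : ∀ k ω, ‖(inner ℝ (gradLast Y p i m k ω) x : ℝ)‖ₑ ≤
      ‖gradLast Y p i m k ω‖ₑ * ‖x‖ₑ := fun k ω => by
    have := norm_inner_le_norm (𝕜 := ℝ) (gradLast Y p i m k ω) x
    rw [← ofReal_norm, ← ofReal_norm, ← ofReal_norm,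
      ← ENNReal.ofReal_mul (norm_nonneg _)]
    exact ENNReal.ofReal_le_ofReal this
  have hlast : ∀ k, ∫⁻ ω, ‖gradLast Y p i m k ω‖ₑ * ‖x‖ₑ ∂P 0 ≤ ψ k * ‖x‖ₑ := fun k => by
    rw [lintegral_mul_const' _ _ enorm_ne_top]
    gcongr
    exact hψ m k
  induction l with
  | zero =>
    rw [zero_add, Finset.sum_range_one]
    refine le_trans (lintegral_mono_ae ?_) (hlast 0)
    filter_upwards [hmem] with ω hω
    rw [← inner_gradLast_zero hDens (contDiffOn_dens hReg i) hω]
    exact hinner 0 ω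
  | succ l ih =>
    rw [Finset.sum_range_succ, add_mul]
    calc _ ≤ ∫⁻ ω, (‖dirDeriv (fun i n => logDensOn (interior Y) (p i) n) i m l ω x‖ₑ +
          ‖gradLast Y p i m (l + 1) ω‖ₑ * ‖x‖ₑ) ∂P 0 := by
          refine lintegral_mono_ae ?_
          filter_upwards [hmem] with ω hω
          have h := inner_gradLast_succ hDens (contDiffOn_dens hReg i) hω m l x
          have e : dirDeriv (fun i n => logDensOn (interior Y) (p i) n) i m (l + 1) ω x =
              dirDeriv (fun i n => logDensOn (interior Y) (p i) n) i m l ω x +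
                inner ℝ (gradLast Y p i m (l + 1) ω) x := by rw [h]; ring
          rw [e]
          exact (enorm_add_le _ _).trans (add_le_add le_rfl (hinner _ ω))
      _ = ∫⁻ ω, ‖dirDeriv (fun i n => logDensOn (interior Y) (p i) n) i m l ω x‖ₑ ∂P 0 +
          ∫⁻ ω, ‖gradLast Y p i m (l + 1) ω‖ₑ * ‖x‖ₑ ∂P 0 :=
          lintegral_add_left (measurable_dirDeriv _ _ _ _ _).enorm _
      _ ≤ _ := add_le_add ih (hlast _)

theorem lintegral_fderiv_window_le (hModel : IsModel Y P) (hDens : HasDensities Y P p)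
    (hReg : IsSmoothForgetting Y P p q) {ψ : ℕ → ℝ≥0} (hsum : Summable ψ) {i : Fin 2}
    (hψ : ∀ m k, ∫⁻ ω, ‖gradLast Y p i m k ω‖ₑ ∂P 0 ≤ ψ k) (n : ℕ) (k : Fin n) (x : E d) :
    ∫⁻ ω, ‖fderiv ℝ (logDensOn (interior Y) (p i) n) (window ω 1 n) (Pi.single k x)‖ₑ ∂P 0 ≤
      ENNReal.ofReal (max 1 (∑' k, ψ k : ℝ≥0) * ‖x‖) := by
  obtain ⟨m, hm⟩ := k
  obtain ⟨l, rfl⟩ : ∃ l, n = m + l + 1 := ⟨n - m - 1, by omega⟩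
  -- The shift that places the variable m of a block starting at time 1 at time 0.
  have mp := measurePreserving_timeShift (hModel.ergodic 0).toMeasurePreserving (1 + (m : ℤ))
  have h1 := mp.lintegral_comp (measurable_dirDeriv
    (fun i n => logDensOn (interior Y) (p i) n) i m l x).enorm
  have h2 : ∀ ω : Traj d, dirDeriv (fun i n => logDensOn (interior Y) (p i) n) i m l
      (timeShift (1 + (m : ℤ)) ω) x = fderiv ℝ (logDensOn (interior Y) (p i) (m + l + 1))
        (window ω 1 (m + l + 1)) (Pi.single ⟨m, hm⟩ x) := fun ω => by
    rw [dirDeriv, window_timeShift, neg_add_eq_sub, add_sub_cancel_right]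
  simp only [h2] at h1
  rw [h1]
  refine (lintegral_dirDeriv_le hModel hDens hReg hψ m l x).trans ?_
  rw [← ofReal_norm, ENNReal.ofReal_mul (by positivity)]
  gcongr
  rw [← ENNReal.ofNNReal_finsetSum, ← ENNReal.ofReal_coe_nnreal]
  apply ENNReal.ofReal_le_ofReal
  refine le_trans ?_ (le_max_right _ _)
  exact_mod_cast hsum.sum_le_tsum _ fun _ _ => zero_le

theorem exists_isSystem (hd : 1 ≤ d) (hModel : IsModel Y P) (hDens : HasDensities Y P p)
    (hReg : IsSmoothForgetting Y P p q) (h0 : volume Y ≠ 0) :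
    ∃ C D C₁ ρ u₀ Ce ε, IsSystem (interior Y) (P 0)
      (fun i n => logDensOn (interior Y) (p i) n) C D C₁ ρ u₀ Ce ε ∧
      ∀ i N, 2 ≤ N → ∀ m : ℕ, etaQ Y P (q N) i m ≤
        ENNReal.ofReal (Ce / (1 + (m : ℝ)) ^ (6 + ε)) := by
  have := hModel.prob 0
  obtain ⟨D, ρ, u₀, hU⟩ := exists_isConvexDomain hModel.convex hModel.bounded h0
  obtain ⟨C, hC⟩ := hReg.third_bounded
  obtain ⟨Ce, ε, hε, hforget⟩ := hReg.forgetting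
  obtain ⟨φ, ψ, -, hψs, hψ⟩ := hReg.grad_forgetting
  have hmem := ae_mem_interior hModel hDens 0
  -- The constant is made nonnegative and the exponent is lowered so that the new ε is at most 1.
  have hrate : ∀ m : ℕ, ENNReal.ofReal (Ce / (1 + (m : ℝ)) ^ (6 + ε)) ≤
      ENNReal.ofReal (|Ce| / (1 + (m : ℝ)) ^ (6 + min ε 1)) := fun m => by
    apply ENNReal.ofReal_le_ofReal
    have : (1 : ℝ) ≤ 1 + m := le_add_of_nonneg_right (Nat.cast_nonneg m)
    gcongr
    · exact le_abs_self _
    exact min_le_left _ _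
  have hmeas : ∀ i n, Measurable (logDensOn (interior Y) (p i) n) := fun i n =>
    measurable_logDensOn isOpen_interior (((contDiffOn_dens hReg i n).log fun y hy =>
      (hDens.pos i n y hy).ne').continuousOn.mono (box_interior_subset n))
  -- The constant C₁ is the total mass of ψ, raised to at least 1.
  refine ⟨d ^ 3 * |C|, D, max 1 (∑' k, ψ k : ℝ≥0), ρ, u₀, |Ce|, min ε 1, ⟨hU, hd, this, hmem,
    (hModel.ergodic 0).toMeasurePreserving, map_window_eq_blockLaw hModel hDens 0, hmeas,
    fun i n => ?_, fun i => lintegral_fderiv_window_le hModel hDens hReg hψs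
      fun m k => (hψ i m m k le_rfl).2, fun i => ?_, fun i m m' hm => ?_, by positivity,
    le_max_left _ _, abs_nonneg _, lt_min hε one_pos, min_le_right _ _⟩, fun i N hN m => ?_⟩
  · rcases Nat.eq_zero_or_pos n with rfl | hn
    · exact ⟨contDiffOn_block_zero _ _, fun y _ k => k.elim0⟩
    · exact hasBoundedThird_logDensOn (contDiffOn_dens hReg i n) (hDens.pos i n)
        fun y hy k l r a b c => (hC i n hn y hy k l r a b c).trans (le_abs_self _)
  · have h1 : Integrable (logDens (fun i n => logDensOn (interior Y) (p i) n) i 0 1) (P 0) := by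
      refine (hDens.log_integrable i).congr ?_
      filter_upwards [hmem] with ω hω
      exact (logDensOn_of_mem fun k _ => hω _).symm
    have h2 : Integrable (logDens (fun i n => logDensOn (interior Y) (p i) n) i 0 0) (P 0) := by
      have : logDens (fun i n => logDensOn (interior Y) (p i) n) i 0 0 =
          fun _ => logDensOn (interior Y) (p i) 0 (fun _ => u₀) := by
        ext ω; simp only [logDens]; congr 1; exact Subsingleton.elim _ _
      rw [this]
      exact integrable_const _
    exact h1.sub h2
  · have h1 : ∫⁻ ω, ‖logCondDens (fun i n => logDensOn (interior Y) (p i) n) i m ω -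
        logCondDens (fun i n => logDensOn (interior Y) (p i) n) i m' ω‖ₑ ∂P 0 =
        ∫⁻ ω, ‖logCond p i m ω - logCond p i m' ω‖ₑ ∂P 0 := by
      refine lintegral_congr_ae ?_
      filter_upwards [hmem] with ω hω
      rw [logCond_eq hDens hω, logCond_eq hDens hω]
    rw [h1]
    -- The assumption is stated with the maximum over both processes. The unquantized part does not
    -- involve N, so N = 2 serves.
    refine le_trans ?_ (((le_max_left _ _).trans (hforget i 2 le_rfl m)).trans (hrate m))
    exact le_iSup₂ (f := fun m' (_ : m ≤ m') =>
      ∫⁻ ω, ‖logCond p i m ω - logCond p i m' ω‖ₑ ∂P 0) m' hm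
  · exact ((le_max_right _ _).trans (hforget i N hN m)).trans (hrate m)

end

/-! ### Error exponents -/

theorem exists_limit_of_abs_sub_le {u r : ℕ → ℝ} (hr : Tendsto r atTop (𝓝 0))
    (h : ∀ m m', m ≤ m' → |u m - u m'| ≤ r m) :
    ∃ K, Tendsto u atTop (𝓝 K) ∧ ∀ m, |K - u m| ≤ r m := by
  have hc : CauchySeq u := by
    refine cauchySeq_of_le_tendsto_0 (fun n => 2 * r n) (fun n m N hn hm => ?_)
      (by simpa using hr.const_mul 2)
    have h1 := h N n hn
    have h2 := h N m hm
    rw [Real.dist_eq]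
    rw [abs_le] at *
    constructor <;> linarith [h1.1, h1.2, h2.1, h2.2]
  obtain ⟨K, hK⟩ := cauchySeq_tendsto_of_complete hc
  refine ⟨K, hK, fun m => ?_⟩
  refine le_of_tendsto ((hK.sub_const (u m)).abs) ?_
  filter_upwards [eventually_ge_atTop m] with m' hm'
  rw [abs_sub_comm]
  exact h m m' hm'

theorem tendsto_rate {Ce ε : ℝ} (hε : 0 < ε) :
    Tendsto (fun m : ℕ => Ce / (1 + (m : ℝ)) ^ (6 + ε)) atTop (𝓝 0) :=
  ((tendsto_rpow_atTop (by linarith)).comp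
    (tendsto_atTop_add_const_left _ 1 tendsto_natCast_atTop_atTop)).const_div_atTop Ce

theorem cell_indicator {U : Set (E d)} {q : E d → ℕ} (j : ℕ) :
    cell U (U.indicator q) j = cell U q j := by
  ext y
  simp only [cell, Set.mem_ofPred_eq]
  refine and_congr_right fun hy => ?_
  rw [Set.indicator_of_mem hy]

theorem label_indicator {U : Set (E d)} {q : E d → ℕ} {n : ℕ} {y : Fin n → E d}
    (hy : y ∈ box U n) : label (U.indicator q) y = fun k => q (y k) :=
  funext fun k => Set.indicator_of_mem (hy k trivial) _

section

variable {Y : Set (E d)}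

theorem cell_interior_ae_eq (hc : Convex ℝ Y) (q : E d → ℕ) (j : ℕ) :
    cell (interior Y) q j =ᵐ[(volume : Measure (E d))] cell Y q j :=
  (interior_ae_eq hc).inter (ae_eq_refl {y | q y = j})

/-- Labels are reset to 0 off the interior. This changes nothing almost surely and makes the
quantizer a globally measurable map with values below N, 0 being a legitimate label. -/
theorem isFineQuantizer_indicator (hc : Convex ℝ Y) (hb : Bornology.IsBounded Y) {N : ℕ}
    (hN : 2 ≤ N) {q : E d → ℕ} (hq : IsQuantizer Y N q) {δ : ℝ}
    (hδ : ∀ j < N, Metric.diam (cell Y q j) ≤ δ) :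
    IsFineQuantizer (interior Y) δ N ((interior Y).indicator q) where
  measurable := by
    have hcell : ∀ j, MeasurableSet (cell (interior Y) q j) := fun j => by
      rcases lt_or_ge j N with hj | hj
      · have : cell (interior Y) q j = interior Y ∩ cell Y q j := by
          ext y
          exact ⟨fun h => ⟨h.1, interior_subset h.1, h.2⟩, fun h => ⟨h.1, h.2.2⟩⟩
        rw [this]
        exact isOpen_interior.measurableSet.inter (hq.measurable_cell j hj)
      · have : cell (interior Y) q j = ∅ := by
          refine Set.eq_empty_of_forall_notMem fun y hy => ?_
          have := hq.lt y (interior_subset hy.1)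
          have := hy.2
          omega
        rw [this]
        exact MeasurableSet.empty
    refine measurable_to_countable' fun j => ?_
    have : (interior Y).indicator q ⁻¹' {j} = cell (interior Y) q j ∪
        ((interior Y)ᶜ ∩ {_y | j = 0}) := by
      ext y
      by_cases hy : y ∈ interior Y
      · simp [cell, hy]
      · simp [cell, hy, eq_comm]
    rw [this]
    exact (hcell j).union (isOpen_interior.measurableSet.compl.inter (MeasurableSet.const _))
  lt y := by
    by_cases hy : y ∈ interior Y
    · rw [Set.indicator_of_mem hy]
      exact hq.lt y (interior_subset hy)
    · rw [Set.indicator_of_notMem hy]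
      omega
  volume_ne_zero j hj := by
    rw [cell_indicator, measure_congr (cell_interior_ae_eq hc q j)]
    exact hq.volume_ne_zero j hj
  norm_sub_le y hy y' hy' h := by
    rw [Set.indicator_of_mem hy, Set.indicator_of_mem hy'] at h
    rw [← dist_eq_norm]
    have hyY := interior_subset hy
    exact (Metric.dist_le_diam_of_mem (hb.subset fun z hz => hz.1)
      (show y ∈ cell Y q (q y) from ⟨hyY, rfl⟩)
      (show y' ∈ cell Y q (q y) from ⟨interior_subset hy', h.symm⟩)).trans (hδ _ (hq.lt y hyY))

end

section

variable {U : Set (E d)} {D ρ δ : ℝ} {u₀ : E d} {n N : ℕ} {q : E d → ℕ}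

/-- A product cell has positive volume and the density exp F is positive on it. Hence quotients of
cell probabilities are never degenerate and their logarithms split. -/
theorem measureReal_blockCell_pos (hU : IsConvexDomain U D ρ u₀) (hq : IsFineQuantizer U δ N q)
    {F : (Fin n → E d) → ℝ} (hF : Measurable F) [IsFiniteMeasure (blockLaw U F)] {z : Fin n → ℕ}
    (hz : ∀ j, z j < N) :
    0 < (blockLaw U F).real (blockCell U q z) := by
  refine ENNReal.toReal_pos (fun h => ?_) (measure_ne_top _ _)
  have hsub : blockCell U q z ⊆ box U n := fun y hy => (mem_blockCell.1 hy).1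
  have hm : MeasurableSet (blockCell U q z) :=
    MeasurableSet.univ_pi fun j => measurableSet_cell hU.isOpen hq.measurable _
  rw [blockLaw, withDensity_apply_eq_zero hF.exp.ennreal_ofReal] at h
  have h2 : {y | ENNReal.ofReal (Real.exp (F y)) ≠ 0} = Set.univ :=
    Set.eq_univ_of_forall fun y => by simp [Real.exp_pos]
  rw [h2, Set.univ_inter, Measure.restrict_apply hm, Set.inter_eq_left.2 hsub, blockCell,
    volume_pi_pi] at h
  exact Finset.prod_ne_zero_iff.2 (fun j _ => hq.volume_ne_zero _ (hz j)) h

end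

section

variable {Y : Set (E d)} {P : Fin 2 → Measure (Traj d)}
  {p : Fin 2 → (n : ℕ) → (Fin n → E d) → ℝ} {C D C₁ ρ : ℝ} {u₀ : E d} {Ce ε δ : ℝ} {N : ℕ}
  {q : E d → ℕ}

theorem quantProb_eq (hModel : IsModel Y P) (hDens : HasDensities Y P p)
    (hq : Measurable ((interior Y).indicator q)) (i : Fin 2) (n : ℕ) (z : Fin n → ℕ) :
    quantProb Y P q i n z = (blockLaw (interior Y) (logDensOn (interior Y) (p i) n)).real
      (blockCell (interior Y) ((interior Y).indicator q) z) := by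
  have hm : MeasurableSet (blockCell (interior Y) ((interior Y).indicator q) z) :=
    MeasurableSet.univ_pi fun j => measurableSet_cell isOpen_interior hq _
  rw [quantProb, ← map_window_eq_blockLaw hModel hDens, Measure.real, Measure.real,
    Measure.map_apply (measurable_window 1 n) hm]
  congr 1
  refine measure_congr ?_
  filter_upwards [ae_mem_interior hModel hDens i] with ω hω
  refine propext ?_
  change (∀ k, window ω 1 n k ∈ cell Y q (z k)) ↔ window ω 1 n ∈ blockCell _ _ z
  rw [blockCell, Set.mem_univ_pi]
  refine forall_congr' fun k => ?_
  rw [cell_indicator]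
  exact ⟨fun h => ⟨hω _, h.2⟩, fun h => ⟨interior_subset h.1, h.2⟩⟩

/-- The conditional log-probability of the quantized process as a function of labels. -/
def labelLogCond (U : Set (E d)) (f : Fin 2 → (n : ℕ) → (Fin n → E d) → ℝ) (q : E d → ℕ)
    (i : Fin 2) (m : ℕ) (z : Fin (m + 1) → ℕ) : ℝ :=
  Real.log ((blockLaw U (f i (m + 1))).real (blockCell U q z) /
    (blockLaw U (f i m)).real (blockCell U q fun k => z (Fin.castAdd 1 k)))

theorem logCondQ_eq (hModel : IsModel Y P) (hDens : HasDensities Y P p)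
    (hq : Measurable ((interior Y).indicator q)) (i : Fin 2) (m : ℕ) {ω : Traj d}
    (hω : ∀ k, ω k ∈ interior Y) :
    logCondQ Y P q i m ω = labelLogCond (interior Y) (fun i n => logDensOn (interior Y) (p i) n)
      ((interior Y).indicator q) i m
      (label ((interior Y).indicator q) (window ω (-(m : ℤ)) (m + 1))) := by
  have hw : window ω (-(m : ℤ)) (m + 1) ∈ box (interior Y) (m + 1) := fun _ _ => hω _
  rw [logCondQ, quantProb_eq hModel hDens hq, quantProb_eq hModel hDens hq, labelLogCond,
    label_indicator hw]
  rfl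

/-- The error exponent of the quantized test exists and is approximated by finite blocks. -/
theorem exists_isExponentQ (hModel : IsModel Y P) (hDens : HasDensities Y P p)
    (S : IsSystem (interior Y) (P 0) (fun i n => logDensOn (interior Y) (p i) n)
      C D C₁ ρ u₀ Ce ε)
    (hq : IsFineQuantizer (interior Y) δ N ((interior Y).indicator q))
    (heta : ∀ i, ∀ m : ℕ, etaQ Y P q i m ≤ ENNReal.ofReal (Ce / (1 + (m : ℝ)) ^ (6 + ε))) :
    ∃ K, IsExponentQ Y P q K ∧ ∀ m : ℕ, |K - (quantDivergence (interior Y)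
        (fun i n => logDensOn (interior Y) (p i) n) ((interior Y).indicator q) (m + 1) -
      quantDivergence (interior Y) (fun i n => logDensOn (interior Y) (p i) n)
        ((interior Y).indicator q) m)| ≤ 2 * Ce / (1 + (m : ℝ)) ^ (6 + ε) := by
  have := S.prob
  have := hModel.prob
  have hCe := S.Ce_nonneg
  set U := interior Y with hU
  set f : Fin 2 → (n : ℕ) → (Fin n → E d) → ℝ := fun i n => logDensOn U (p i) n with hf
  set q' := U.indicator q with hq'
  have hmem := ae_mem_interior hModel hDens 0
  have hae : ∀ i m, logCondQ Y P q i m =ᵐ[P 0] fun ω =>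
      labelLogCond U f q' i m (label q' (window ω (-(m : ℤ)) (m + 1))) := fun i m =>
    hmem.mono fun ω hω => logCondQ_eq hModel hDens hq.measurable i m hω
  have hlm : ∀ (a : ℤ) (n : ℕ), Measurable fun ω : Traj d => label q' (window ω a n) := fun a n =>
    (measurable_label hq.measurable).comp (measurable_window a n)
  have hcomp : ∀ (a : ℤ) (n : ℕ) (g : (Fin n → ℕ) → ℝ),
      Integrable (fun ω => g (label q' (window ω a n))) (P 0) := fun a n g => by
    obtain ⟨K, hK⟩ := exists_abs_label_le (n := n) hq.lt g
    exact integrable_of_abs_le ((measurable_of_countable g).comp (hlm a n))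
      (Eventually.of_forall fun ω => hK _)
  have hint : ∀ i m, Integrable (logCondQ Y P q i m) (P 0) := fun i m =>
    (hcomp _ _ _).congr (hae i m).symm
  have hprob : ∀ i n, IsProbabilityMeasure (blockLaw U (f i n)) := fun i n => by
    rw [← map_window_eq_blockLaw hModel hDens]
    exact Measure.isProbabilityMeasure_map (measurable_window 1 n).aemeasurable
  have hpos : ∀ i n (z : Fin n → ℕ), (∀ j, z j < N) →
      0 < (blockLaw U (f i n)).real (blockCell U q' z) := fun i n z hz =>
    measureReal_blockCell_pos S.domain hq (S.measurable i n) hz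
  have hdiff : ∀ m, ∫ ω, (logCondQ Y P q 0 m ω - logCondQ Y P q 1 m ω) ∂P 0 =
      quantDivergence U f q' (m + 1) - quantDivergence U f q' m := by
    intro m
    have h1 : ∀ n, quantDivergence U f q' n = ∫ ω, quantLogRatio U q' (fun i => f i n)
        (label q' (window ω (-(m : ℤ)) n)) ∂P 0 := fun n => by
      have mp := S.measurePreserving_window (-(m : ℤ)) n
      rw [quantDivergence, ← mp.map_eq, integral_map mp.measurable.aemeasurable]
      exact ((measurable_of_countable (quantLogRatio U q' fun i => f i n)).comp
        (measurable_label hq.measurable)).aestronglyMeasurable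
    rw [h1, h1, ← integral_sub (hcomp _ _ _) (hcomp _ _ _)]
    refine integral_congr_ae ?_
    filter_upwards [hae 0 m, hae 1 m] with ω h0 h1
    rw [h0, h1]
    simp only [labelLogCond, quantLogRatio]
    have hz : ∀ j, label q' (window ω (-(m : ℤ)) (m + 1)) j < N := fun j => hq.lt _
    have hz' : ∀ j, label q' (window ω (-(m : ℤ)) m) j < N := fun j => hq.lt _
    have e : (fun k => label q' (window ω (-(m : ℤ)) (m + 1)) (Fin.castAdd 1 k)) =
      label q' (window ω (-(m : ℤ)) m) := rfl
    -- All cell probabilities are positive, so both sides are the same alternating sum of four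
    -- logarithms.
    rw [e, Real.log_div (hpos _ _ _ hz).ne' (hpos _ _ _ hz').ne',
      Real.log_div (hpos _ _ _ hz).ne' (hpos _ _ _ hz').ne',
      Real.log_div (hpos _ _ _ hz).ne' (hpos _ _ _ hz).ne',
      Real.log_div (hpos _ _ _ hz').ne' (hpos _ _ _ hz').ne']
    ring
  have habs : ∀ i m m', m ≤ m' → ∫ ω, |logCondQ Y P q i m ω - logCondQ Y P q i m' ω| ∂P 0 ≤
      Ce / (1 + (m : ℝ)) ^ (6 + ε) := by
    intro i m m' hm
    have h1 : ∫⁻ ω, ‖logCondQ Y P q i m ω - logCondQ Y P q i m' ω‖ₑ ∂P 0 ≤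
        ENNReal.ofReal (Ce / (1 + (m : ℝ)) ^ (6 + ε)) :=
      le_trans (le_iSup₂ (f := fun m' (_ : m ≤ m') =>
        ∫⁻ ω, ‖logCondQ Y P q i m ω - logCondQ Y P q i m' ω‖ₑ ∂P 0) m' hm) (heta i m)
    have hi : Integrable (fun ω => |logCondQ Y P q i m ω - logCondQ Y P q i m' ω|) (P 0) :=
      ((hint i m).sub (hint i m')).abs
    rw [integral_eq_lintegral_of_nonneg_ae (Eventually.of_forall fun _ => abs_nonneg _)
      hi.aestronglyMeasurable]
    simp only [Real.enorm_eq_ofReal_abs] at h1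
    exact ENNReal.toReal_le_of_le_ofReal (by positivity) h1
  obtain ⟨K, hK, hKle⟩ := exists_limit_of_abs_sub_le
    (u := fun m => ∫ ω, (logCondQ Y P q 0 m ω - logCondQ Y P q 1 m ω) ∂P 0)
    (tendsto_rate (Ce := 2 * Ce) S.ε_pos) (fun m m' hm => by
      have i0 := (hint 0 m).sub (hint 0 m')
      have i1 := (hint 1 m).sub (hint 1 m')
      have e : ∫ ω, (logCondQ Y P q 0 m ω - logCondQ Y P q 1 m ω) ∂P 0 -
          ∫ ω, (logCondQ Y P q 0 m' ω - logCondQ Y P q 1 m' ω) ∂P 0 =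
          ∫ ω, (logCondQ Y P q 0 m ω - logCondQ Y P q 0 m' ω) ∂P 0 -
          ∫ ω, (logCondQ Y P q 1 m ω - logCondQ Y P q 1 m' ω) ∂P 0 := by
        rw [integral_sub (hint _ _) (hint _ _), integral_sub (hint _ _) (hint _ _),
          integral_sub (hint _ _) (hint _ _), integral_sub (hint _ _) (hint _ _)]
        ring
      rw [e]
      refine (abs_sub _ _).trans ?_
      have h0 := abs_integral_le_integral_abs.trans (habs 0 m m' hm)
      have h1 := abs_integral_le_integral_abs.trans (habs 1 m m' hm)
      have e2 : 2 * Ce / (1 + (m : ℝ)) ^ (6 + ε) = Ce / (1 + (m : ℝ)) ^ (6 + ε) +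
        Ce / (1 + (m : ℝ)) ^ (6 + ε) := by ring
      rw [e2]
      exact add_le_add h0 h1)
  refine ⟨K, ⟨fun m => (hint 0 m).sub (hint 1 m), hK⟩, fun m => ?_⟩
  rw [← hdiff]
  exact hKle m

/-- The error exponent of the unquantized test exists and is approximated by finite blocks. -/
theorem exists_isExponent (hModel : IsModel Y P) (hDens : HasDensities Y P p)
    (S : IsSystem (interior Y) (P 0) (fun i n => logDensOn (interior Y) (p i) n)
      C D C₁ ρ u₀ Ce ε) :
    ∃ K, IsExponent P p K ∧ ∀ m : ℕ, |K - ∫ ω, (logCondDens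
        (fun i n => logDensOn (interior Y) (p i) n) 0 m ω -
      logCondDens (fun i n => logDensOn (interior Y) (p i) n) 1 m ω) ∂P 0| ≤
        2 * Ce / (1 + (m : ℝ)) ^ (6 + ε) := by
  set f : Fin 2 → (n : ℕ) → (Fin n → E d) → ℝ := fun i n => logDensOn (interior Y) (p i) n with hf
  have hint := S.integrable_logCondDens
  have hae : ∀ m, (fun ω => logCond p 0 m ω - logCond p 1 m ω) =ᵐ[P 0]
      fun ω => logCondDens f 0 m ω - logCondDens f 1 m ω := fun m => by
    filter_upwards [ae_mem_interior hModel hDens 0] with ω hω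
    rw [logCond_eq hDens hω, logCond_eq hDens hω]
  obtain ⟨K, hK, hKle⟩ := exists_limit_of_abs_sub_le
    (u := fun m => ∫ ω, (logCondDens f 0 m ω - logCondDens f 1 m ω) ∂P 0)
    (tendsto_rate (Ce := 2 * Ce) S.ε_pos) (fun m m' hm => by
      have e : ∫ ω, (logCondDens f 0 m ω - logCondDens f 1 m ω) ∂P 0 -
          ∫ ω, (logCondDens f 0 m' ω - logCondDens f 1 m' ω) ∂P 0 =
          ∫ ω, (logCondDens f 0 m ω - logCondDens f 0 m' ω) ∂P 0 -
          ∫ ω, (logCondDens f 1 m ω - logCondDens f 1 m' ω) ∂P 0 := by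
        rw [integral_sub (hint _ _) (hint _ _), integral_sub (hint _ _) (hint _ _),
          integral_sub (hint _ _) (hint _ _), integral_sub (hint _ _) (hint _ _)]
        ring
      rw [e]
      refine (abs_sub _ _).trans ?_
      have h0 := abs_integral_le_integral_abs.trans (S.integral_abs_logCondDens_sub_le 0 hm)
      have h1 := abs_integral_le_integral_abs.trans (S.integral_abs_logCondDens_sub_le 1 hm)
      have e2 : 2 * Ce / (1 + (m : ℝ)) ^ (6 + ε) = Ce / (1 + (m : ℝ)) ^ (6 + ε) +
        Ce / (1 + (m : ℝ)) ^ (6 + ε) := by ring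
      rw [e2]
      exact add_le_add h0 h1)
  refine ⟨K, ⟨fun m => ((hint 0 m).sub (hint 1 m)).congr (hae m).symm, ?_⟩, hKle⟩
  simp_rw [fun m => integral_congr_ae (hae m)]
  exact hK

end

/-! ### Limit of the rescaled cell covariances -/

theorem cellCov_congr {A B : Set (E d)} (h : A =ᵐ[(volume : Measure (E d))] B) (c c' : Fin d) :
    cellCov A c c' = cellCov B c c' := by
  have : ProbabilityTheory.cond (volume : Measure (E d)) A =
      ProbabilityTheory.cond (volume : Measure (E d)) B := by
    rw [ProbabilityTheory.cond, ProbabilityTheory.cond, Measure.restrict_congr_set h,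
      measure_congr h]
  rw [cellCov, cellCov, this]

theorem cellCov_eq_integral {A : Set (E d)} (hA : MeasurableSet A) (h0 : volume A ≠ 0)
    (hb : Bornology.IsBounded A) (c c' : Fin d) :
    cellCov A c c' = ((volume : Measure (E d)).real A)⁻¹ *
      ∫ x in A, (x c - (((volume : Measure (E d)).real A)⁻¹ • ∫ x in A, x : E d) c) *
        (x c' - (((volume : Measure (E d)).real A)⁻¹ • ∫ x in A, x : E d) c') := by
  have htop : volume A ≠ ∞ := hb.measure_lt_top.ne
  have : IsProbabilityMeasure (ProbabilityTheory.cond (volume : Measure (E d)) A) :=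
    ProbabilityTheory.cond_isProbabilityMeasure_of_finite h0 htop
  have : IsFiniteMeasure ((volume : Measure (E d)).restrict A) :=
    ⟨by simpa using hb.measure_lt_top⟩
  obtain ⟨R, hR⟩ := hb.exists_norm_le
  have hcond : ∀ g : E d → ℝ, ∫ x, g x ∂ProbabilityTheory.cond volume A =
      ((volume : Measure (E d)).real A)⁻¹ * ∫ x in A, g x := fun g => by
    rw [ProbabilityTheory.cond, integral_smul_measure, ENNReal.toReal_inv, smul_eq_mul]
    rfl
  have hmem : ∀ᵐ x ∂ProbabilityTheory.cond (volume : Measure (E d)) A, ‖x‖ ≤ R :=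
    (ProbabilityTheory.ae_cond_mem hA).mono hR
  have hm : ∀ c : Fin d, Measurable fun x : E d => x c := fun c =>
    (EuclideanSpace.proj (𝕜 := ℝ) c).continuous.measurable
  have hi : ∀ c : Fin d, Integrable (fun x : E d => x c)
      (ProbabilityTheory.cond (volume : Measure (E d)) A) := fun c =>
    integrable_of_abs_le (hm c) (hmem.mono fun x hx => (abs_coord_le x c).trans hx)
  have hi2 : Integrable (fun x : E d => x c * x c')
      (ProbabilityTheory.cond (volume : Measure (E d)) A) :=
    integrable_of_abs_le ((hm c).mul (hm c')) (K := R * R) (hmem.mono fun x hx => by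
      rw [abs_mul]
      exact mul_le_mul ((abs_coord_le x c).trans hx) ((abs_coord_le x c').trans hx)
        (abs_nonneg _) ((norm_nonneg x).trans hx))
  have hid : IntegrableOn (fun x : E d => x) A :=
    Integrable.of_bound measurable_id.aestronglyMeasurable R
      ((ae_restrict_mem hA).mono hR)
  have hξ : ∀ c : Fin d, (((volume : Measure (E d)).real A)⁻¹ • ∫ x in A, x : E d) c =
      ∫ x : E d, x c ∂ProbabilityTheory.cond volume A := fun c => by
    rw [hcond]
    have h : ∫ x in A, x c = (∫ x in A, x : E d) c :=
      (EuclideanSpace.proj (𝕜 := ℝ) c : E d →L[ℝ] ℝ).integral_comp_comm hid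
    rw [h]
    rfl
  rw [hξ, hξ, ← hcond, cellCov]
  set a := ∫ x : E d, x c ∂ProbabilityTheory.cond volume A
  set b := ∫ x : E d, x c' ∂ProbabilityTheory.cond volume A
  have e : ∀ x : E d, (x c - a) * (x c' - b) = x c * x c' - (b * x c + (a * x c' - a * b)) :=
    fun x => by ring
  simp_rw [e]
  have i1 : Integrable (fun x : E d => a * x c' - a * b)
      (ProbabilityTheory.cond (volume : Measure (E d)) A) :=
    ((hi c').const_mul a).sub (integrable_const _)
  have i2 : Integrable (fun x : E d => b * x c + (a * x c' - a * b))
      (ProbabilityTheory.cond (volume : Measure (E d)) A) := ((hi c).const_mul b).add i1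
  rw [integral_sub hi2 i2, integral_add ((hi c).const_mul b) i1,
    integral_sub ((hi c').const_mul a) (integrable_const _), integral_const_mul, integral_const_mul,
    integral_const, probReal_univ, one_smul]
  ring

theorem abs_rpow_neg_sub_le {s b x y : ℝ} (hs : 0 ≤ s) (hb : 0 < b) (hx : b ≤ x) (hy : b ≤ y) :
    |x ^ (-s) - y ^ (-s)| ≤ s * b ^ (-s - 1) * |x - y| := by
  have := (convex_Ici b).norm_image_sub_le_of_norm_hasDerivWithin_le (f := fun t : ℝ => t ^ (-s))
    (f' := fun t => -s * t ^ (-s - 1)) (C := s * b ^ (-s - 1))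
    (fun t ht => (Real.hasDerivAt_rpow_const (Or.inl (hb.trans_le ht).ne')).hasDerivWithinAt)
    (fun t ht => by
      have ht0 : 0 < t := hb.trans_le ht
      rw [norm_mul, norm_neg, Real.norm_of_nonneg hs, Real.norm_of_nonneg (by positivity)]
      exact mul_le_mul_of_nonneg_left (Real.rpow_le_rpow_of_nonpos hb ht (by linarith)) hs)
    (show y ∈ Set.Ici b from hy) (show x ∈ Set.Ici b from hx)
  simpa [Real.norm_eq_abs] using this

/-- Uniformly close to a limit that is at least b, the factors z N stay above b/2, where the
negative power is bounded and Lipschitz. Boundedness of W controls the other factor. -/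
theorem tendstoUniformlyOn_rpow_neg_mul {X : Type*} {A : Set X} {z : ℕ → X → ℝ} {ζ : X → ℝ}
    {w : ℕ → X → ℝ} {W : X → ℝ} {s b B : ℝ} (hs : 0 ≤ s) (hb : 0 < b) (hζ : ∀ x ∈ A, b ≤ ζ x)
    (hW : ∀ x ∈ A, |W x| ≤ B) (hz : TendstoUniformlyOn z ζ atTop A)
    (hw : TendstoUniformlyOn w W atTop A) :
    TendstoUniformlyOn (fun N x => z N x ^ (-s) * w N x) (fun x => ζ x ^ (-s) * W x) atTop A := by
  rw [Metric.tendstoUniformlyOn_iff] at *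
  intro η hη
  have hB : 0 ≤ max B 0 := le_max_right _ _
  set κ := (b / 2) ^ (-s) with hκ
  have hκ0 : 0 < κ := Real.rpow_pos_of_pos (by linarith) _
  set κ' := s * (b / 2) ^ (-s - 1) with hκ'
  have hκ'0 : 0 ≤ κ' := mul_nonneg hs (Real.rpow_nonneg (by linarith) _)
  have hden : 0 < κ + κ' * max B 0 + 1 := by positivity
  set e := η / (κ + κ' * max B 0 + 1) with he
  have he0 : 0 < e := div_pos hη hden
  filter_upwards [hz (b / 2) (by linarith), hz e he0, hw e he0] with N h1 h2 h3 x hx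
  have h1 := h1 x hx
  have h2 := h2 x hx
  have h3 := h3 x hx
  rw [Real.dist_eq] at *
  have hzx : b / 2 ≤ z N x := by
    have := (abs_lt.1 h1).2
    linarith [hζ x hx]
  have e1 : ζ x ^ (-s) * W x - z N x ^ (-s) * w N x =
      (ζ x ^ (-s) - z N x ^ (-s)) * W x + z N x ^ (-s) * (W x - w N x) := by ring
  have a1 := abs_rpow_neg_sub_le hs (half_pos hb) (show b / 2 ≤ ζ x by linarith [hζ x hx]) hzx
  have a2 : z N x ^ (-s) ≤ κ := Real.rpow_le_rpow_of_nonpos (half_pos hb) hzx (by linarith)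
  have a3 : 0 ≤ z N x ^ (-s) := Real.rpow_nonneg (by linarith) _
  calc |ζ x ^ (-s) * W x - z N x ^ (-s) * w N x|
      ≤ |ζ x ^ (-s) - z N x ^ (-s)| * |W x| + z N x ^ (-s) * |W x - w N x| := by
        rw [e1]
        refine (abs_add_le _ _).trans (le_of_eq ?_)
        rw [abs_mul, abs_mul, abs_of_nonneg a3]
    _ ≤ (κ' * e) * max B 0 + κ * e := by
        refine add_le_add (mul_le_mul (a1.trans ?_) ((hW x hx).trans (le_max_left _ _))
          (abs_nonneg _) (by positivity)) (mul_le_mul a2 h3.le (abs_nonneg _) hκ0.le)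
        exact mul_le_mul_of_nonneg_left h2.le hκ'0
    _ < (κ + κ' * max B 0 + 1) * e := by linarith
    _ = η := by
        rw [he]
        field_simp

/-- The covariance normalizes by V and the profile by V^{1+2/d}. The missing V^{2/d} combines with
N^{2/d} to (N V)^{2/d}, which is the point density to the power −2/d. -/
theorem rescaled_cellCov_eq {Y : Set (E d)} (hb : Bornology.IsBounded Y) {N : ℕ}
    (hN : 2 ≤ N) {q : E d → ℕ} (hq : IsQuantizer Y N q) {x : E d} (hx : x ∈ Y) (c c' : Fin d) :
    (N : ℝ) ^ (2 / (d : ℝ)) * cellCov (cell Y q (q x)) c c' =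
      pointDensity Y N q x ^ (-(2 / (d : ℝ))) * covProfile Y q x c c' := by
  have hlt := hq.lt x hx
  have hbc : Bornology.IsBounded (cell Y q (q x)) := hb.subset fun y hy => hy.1
  have hV : 0 < cellVol Y q (q x) :=
    ENNReal.toReal_pos (hq.volume_ne_zero _ hlt) hbc.measure_lt_top.ne
  have hN0 : (0 : ℝ) < N := by positivity
  rw [cellCov_eq_integral (hq.measurable_cell _ hlt) (hq.volume_ne_zero _ hlt) hbc, pointDensity,
    covProfile]
  change _ * ((cellVol Y q (q x))⁻¹ * ∫ y in cell Y q (q x),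
    (y c - centroid Y q (q x) c) * (y c' - centroid Y q (q x) c')) = _
  set I := ∫ y in cell Y q (q x), (y c - centroid Y q (q x) c) * (y c' - centroid Y q (q x) c')
  rw [one_div, Real.inv_rpow (by positivity), Real.rpow_neg (by positivity), inv_inv,
    Real.mul_rpow hN0.le hV.le, Real.rpow_add hV, Real.rpow_one]
  have := Real.rpow_pos_of_pos hV (2 / (d : ℝ))
  field_simp

/-- The limit of the rescaled covariance matrices of the cells, set to `0` off the domain. -/
def limitCov (U : Set (E d)) (ζ : E d → ℝ) (M : E d → Matrix (Fin d) (Fin d) ℝ)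
    (c c' : Fin d) : E d → ℝ :=
  U.indicator fun x => ζ x ^ (-(2 / (d : ℝ))) * M x c c'

section

variable {Y : Set (E d)} {q : ℕ → E d → ℕ} {ζ : E d → ℝ} {M : E d → Matrix (Fin d) (Fin d) ℝ}

theorem measurable_indicator_of_continuousOn {U : Set (E d)} (hU : IsOpen U) {g : E d → ℝ}
    (hg : ContinuousOn g U) : Measurable (U.indicator g) := by
  classical
  rw [← Set.piecewise_eq_indicator]
  exact hg.measurable_piecewise (continuousOn_const (c := (0 : ℝ))) hU.measurableSet

theorem IsHighRate.continuousOn_rpow (hRate : IsHighRate Y q ζ M) :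
    ContinuousOn (fun x => ζ x ^ (-(2 / (d : ℝ)))) Y := by
  obtain ⟨b, hb, hζ⟩ := hRate.ζ_lower
  exact hRate.continuousOn_ζ.rpow_const fun x hx => Or.inl (hb.trans_le (hζ x hx)).ne'

theorem IsHighRate.measurable_limitCov (hRate : IsHighRate Y q ζ M) (c c' : Fin d) :
    Measurable (limitCov (interior Y) ζ M c c') :=
  measurable_indicator_of_continuousOn isOpen_interior
    ((hRate.continuousOn_rpow.mul (hRate.continuousOn_M c c')).mono interior_subset)

theorem IsHighRate.exists_rpow_le (hRate : IsHighRate Y q ζ M) :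
    ∃ κ, 0 ≤ κ ∧ ∀ x ∈ Y, |ζ x ^ (-(2 / (d : ℝ)))| ≤ κ := by
  obtain ⟨b, hb, hζ⟩ := hRate.ζ_lower
  have hs : (0 : ℝ) ≤ 2 / d := by positivity
  refine ⟨b ^ (-(2 / (d : ℝ))), by positivity, fun x hx => ?_⟩
  rw [abs_of_nonneg (Real.rpow_nonneg (hb.le.trans (hζ x hx)) _)]
  exact Real.rpow_le_rpow_of_nonpos hb (hζ x hx) (by linarith)

theorem IsHighRate.exists_abs_limitCov_le (hRate : IsHighRate Y q ζ M) :
    ∃ κ, 0 ≤ κ ∧ ∀ c c', ∀ x ∈ interior Y, |limitCov (interior Y) ζ M c c' x| ≤ κ := by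
  obtain ⟨κ, hκ, h⟩ := hRate.exists_rpow_le
  obtain ⟨B, hB⟩ := hRate.M_bounded
  refine ⟨κ * max B 0, by positivity, fun c c' x hx => ?_⟩
  rw [limitCov, Set.indicator_of_mem hx, abs_mul]
  exact mul_le_mul (h x (interior_subset hx))
    ((hB x (interior_subset hx) c c').trans (le_max_left _ _)) (abs_nonneg _) hκ

theorem IsHighRate.tendsto_cellCov (hc : Convex ℝ Y) (hb : Bornology.IsBounded Y)
    (hRate : IsHighRate Y q ζ M) (c c' : Fin d) :
    TendstoUniformlyOn (fun (N : ℕ) x => (N : ℝ) ^ (2 / (d : ℝ)) *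
      cellCov (cell (interior Y) ((interior Y).indicator (q N)) ((interior Y).indicator (q N) x))
        c c') (limitCov (interior Y) ζ M c c') atTop (interior Y) := by
  obtain ⟨b, hb0, hζ⟩ := hRate.ζ_lower
  obtain ⟨B, hB⟩ := hRate.M_bounded
  have h := (tendstoUniformlyOn_rpow_neg_mul (s := 2 / (d : ℝ)) (by positivity) hb0 hζ
    (fun x hx => hB x hx c c') hRate.tendsto_pointDensity
    (hRate.tendsto_covProfile c c')).mono (interior_subset (s := Y))
  refine (h.congr_right fun x hx => ?_).congr ?_
  · rw [limitCov, Set.indicator_of_mem hx]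
  · filter_upwards [eventually_ge_atTop 2] with N hN x hx
    beta_reduce
    rw [cell_indicator, Set.indicator_of_mem hx, cellCov_congr (cell_interior_ae_eq hc _ _),
      rescaled_cellCov_eq hb hN (hRate.quantizer N hN) (interior_subset hx)]

theorem IsHighRate.exists_isFineQuantizer (hc : Convex ℝ Y) (hb : Bornology.IsBounded Y)
    (hRate : IsHighRate Y q ζ M) : ∃ r, 0 ≤ r ∧ ∀ N : ℕ, 2 ≤ N →
      IsFineQuantizer (interior Y) (r / (N : ℝ) ^ (1 / (d : ℝ))) N
        ((interior Y).indicator (q N)) := by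
  obtain ⟨r, hr⟩ := hRate.diam_le
  refine ⟨max r 0, le_max_right _ _, fun N hN =>
    isFineQuantizer_indicator hc hb hN (hRate.quantizer N hN) fun j hj => (hr N hN j hj).trans ?_⟩
  gcongr
  exact le_max_left _ _

theorem IsHighRate.volume_ne_zero (hRate : IsHighRate Y q ζ M) : volume Y ≠ 0 := fun h =>
  (hRate.quantizer 2 le_rfl).volume_ne_zero 0 (by norm_num)
    (measure_mono_null (fun _ hy => hy.1) h)

end

/-! ### The limit of the gradients of the log-likelihood ratio -/

section

variable {Ω : Type*} [MeasurableSpace Ω] {μ : Measure Ω}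

theorem memLp_vec {g : Ω → E d} (hg : ∀ c, MemLp (fun ω => g ω c) 2 μ) : MemLp g 2 μ := by
  have h : g = fun ω => ∑ c, g ω c • (EuclideanSpace.single c (1 : ℝ) : E d) :=
    funext fun ω => vec_eq_sum (g ω)
  rw [h]
  refine memLp_finsetSum _ fun c _ => ?_
  refine (hg c).of_le ((hg c).aestronglyMeasurable.smul_const _)
    (Eventually.of_forall fun ω => ?_)
  rw [norm_smul]
  simp

theorem eLpNorm_vec_le {g : Ω → E d} (hg : ∀ c, MemLp (fun ω => g ω c) 2 μ) :
    eLpNorm g 2 μ ≤ ∑ c, eLpNorm (fun ω => g ω c) 2 μ := by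
  have h : g = ∑ c, fun ω => g ω c • (EuclideanSpace.single c (1 : ℝ) : E d) := by
    funext ω
    rw [Finset.sum_apply]
    exact vec_eq_sum (g ω)
  conv_lhs => rw [h]
  refine (eLpNorm_sum_le (fun c _ => (hg c).aestronglyMeasurable.smul_const _)
    (by norm_num)).trans (Finset.sum_le_sum fun c _ => le_of_eq ?_)
  refine eLpNorm_congr_norm_ae (Eventually.of_forall fun ω => ?_)
  rw [norm_smul]
  simp

theorem eLpNorm_sub_eq_ofReal {f g : Ω → ℝ} (hf : MemLp f 2 μ) (hg : MemLp g 2 μ) :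
    eLpNorm (f - g) 2 μ = ENNReal.ofReal ‖hf.toLp - hg.toLp‖ := by
  rw [← MemLp.toLp_sub, Lp.norm_toLp, ENNReal.ofReal_toReal (hf.sub hg).2.ne]

end

namespace IsSystem

variable {U : Set (E d)} {P : Measure (Traj d)} {f : Fin 2 → (n : ℕ) → (Fin n → E d) → ℝ}
  {C D C₁ ρ : ℝ} {u₀ : E d} {Ce ε Λ : ℝ} (S : IsSystem U P f C D C₁ ρ u₀ Ce ε)
include S

theorem exists_limit_ratioCoord (hΛ : 0 ≤ Λ)
    (hb : ∀ n, HasBlockBounds U Λ n (fun i => f i n)) :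
    ∃ L : Fin d → Traj d → ℝ, ∃ hL : ∀ c, MemLp (L c) 2 P, ∀ c,
      Tendsto (fun t => ‖(S.memLp_ratioCoord hb t t c).toLp - (hL c).toLp‖) atTop (𝓝 0) := by
  obtain ⟨B, -, hB⟩ := S.exists_norm_gradCoord_sub_le hΛ hb
  choose X _ hX hXB using S.exists_limit_gradCoord hΛ hb
  have hlim : ∀ i c, Tendsto (fun t : ℕ =>
      ‖(S.memLp_gradCoord hb i t t c).toLp - (hX i c).toLp‖) atTop (𝓝 0) := fun i c => by
    have h0 : Tendsto (fun s : ℕ => 2 * B / √(s : ℝ)) atTop (𝓝 0) :=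
      (Real.tendsto_sqrt_atTop.comp tendsto_natCast_atTop_atTop).const_div_atTop _
    refine squeeze_zero' (Eventually.of_forall fun _ => norm_nonneg _) ?_ h0
    filter_upwards [eventually_ge_atTop 1] with t ht
    exact hXB i c B (fun a b s k h1 h2 => hB i a b c s k h1 h2) t t t ht le_rfl le_rfl
  refine ⟨fun c => X 0 c - X 1 c, fun c => (hX 0 c).sub (hX 1 c), fun c => ?_⟩
  have h := (hlim 0 c).add (hlim 1 c)
  rw [add_zero] at h
  refine squeeze_zero (fun _ => norm_nonneg _) (fun t => ?_) h
  have e : (S.memLp_ratioCoord hb t t c).toLp - ((hX 0 c).sub (hX 1 c)).toLp =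
      ((S.memLp_gradCoord hb 0 t t c).toLp - (hX 0 c).toLp) -
        ((S.memLp_gradCoord hb 1 t t c).toLp - (hX 1 c).toLp) := by
    have e1 : (S.memLp_ratioCoord hb t t c).toLp =
      (S.memLp_gradCoord hb 0 t t c).toLp - (S.memLp_gradCoord hb 1 t t c).toLp := rfl
    rw [e1, MemLp.toLp_sub (hX 0 c) (hX 1 c)]
    abel
  rw [e]
  exact norm_sub_le _ _

end IsSystem

/-- On the interior the coordinates of the gradient are `ratioCoord`, and convergence of each of the
finitely many coordinates in L² gives convergence of the vector. -/
theorem gradRatio_limit {Y : Set (E d)} {P : Fin 2 → Measure (Traj d)}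
    {p : Fin 2 → (n : ℕ) → (Fin n → E d) → ℝ} {q : ℕ → E d → ℕ} {C D C₁ ρ : ℝ} {u₀ : E d}
    {Ce ε Λ : ℝ} (hModel : IsModel Y P) (hDens : HasDensities Y P p)
    (hReg : IsSmoothForgetting Y P p q)
    (S : IsSystem (interior Y) (P 0) (fun i n => logDensOn (interior Y) (p i) n)
      C D C₁ ρ u₀ Ce ε)
    (hb : ∀ n, HasBlockBounds (interior Y) Λ n (fun i => logDensOn (interior Y) (p i) n))
    {L : Fin d → Traj d → ℝ} (hL : ∀ c, MemLp (L c) 2 (P 0))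
    (hlim : ∀ c, Tendsto (fun t => ‖(S.memLp_ratioCoord hb t t c).toLp - (hL c).toLp‖)
      atTop (𝓝 0)) {l : Traj d → E d} (hl : ∀ ω c, l ω c = L c ω) :
    (∀ k, MemLp (gradRatio Y p k) 2 (P 0)) ∧ MemLp l 2 (P 0) ∧
      Tendsto (fun k => eLpNorm (gradRatio Y p k - l) 2 (P 0)) atTop (𝓝 0) := by
  have hae : ∀ k c, (fun ω => gradRatio Y p k ω c) =ᵐ[P 0]
      ratioCoord (fun i n => logDensOn (interior Y) (p i) n) k k c := fun k c => by
    filter_upwards [ae_mem_interior hModel hDens 0] with ω hω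
    exact inner_gradRatio hDens (contDiffOn_dens hReg) hω k c
  have hG : ∀ k c, MemLp (fun ω => gradRatio Y p k ω c) 2 (P 0) := fun k c =>
    (memLp_congr_ae (hae k c)).2 (S.memLp_ratioCoord hb k k c)
  have hl' : ∀ c, MemLp (fun ω => l ω c) 2 (P 0) := fun c => by
    simp_rw [hl]
    exact hL c
  refine ⟨fun k => memLp_vec (hG k), memLp_vec hl', ?_⟩
  have h0 : Tendsto (fun k => ∑ c, ENNReal.ofReal
      ‖(S.memLp_ratioCoord hb k k c).toLp - (hL c).toLp‖) atTop (𝓝 0) := by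
    have := tendsto_finsetSum (Finset.univ : Finset (Fin d)) fun c _ =>
      ENNReal.tendsto_ofReal (hlim c)
    simpa using this
  refine tendsto_of_tendsto_of_tendsto_of_le_of_le tendsto_const_nhds h0
    (fun _ => zero_le) fun k => ?_
  refine (eLpNorm_vec_le fun c => (hG k c).sub (hl' c)).trans
    (Finset.sum_le_sum fun c _ => le_of_eq ?_)
  rw [← eLpNorm_sub_eq_ofReal]
  refine eLpNorm_congr_ae ?_
  filter_upwards [hae k c] with ω hω
  simp only [Pi.sub_apply, PiLp.sub_apply]
  rw [hω, hl]

/-! ### Conditioning on the present -/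

theorem exists_isCondExpGivenZero {μ : Measure (Traj d)} {X : Traj d → ℝ} (hX : Integrable X μ) :
    ∃ F, IsCondExpGivenZero μ X F := by
  obtain ⟨F, hF, h⟩ := (stronglyMeasurable_condExp (μ := μ) (f := X)
    (m := MeasurableSpace.comap (fun ω : Traj d => ω 0) inferInstance)).exists_eq_measurable_comp
  exact ⟨F, hX, hF.measurable, Eventually.of_forall fun ω => (congrFun h ω).symm⟩

/-- A function of Y_0 can be pulled out of the conditional expectation, whose mean is that of X. -/
theorem IsCondExpGivenZero.integral_mul {μ : Measure (Traj d)} [IsProbabilityMeasure μ]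
    {X : Traj d → ℝ} {F h : E d → ℝ} (hF : IsCondExpGivenZero μ X F) (hh : Measurable h)
    (hXh : Integrable (fun ω => X ω * h (ω 0)) μ) :
    Integrable (fun ω => F (ω 0) * h (ω 0)) μ ∧
      ∫ ω, F (ω 0) * h (ω 0) ∂μ = ∫ ω, X ω * h (ω 0) ∂μ := by
  have hm : MeasurableSpace.comap (fun ω : Traj d => ω 0) inferInstance ≤
      (inferInstance : MeasurableSpace (Traj d)) := (measurable_pi_apply 0).comap_le
  have hsm : StronglyMeasurable[MeasurableSpace.comap (fun ω : Traj d => ω 0) inferInstance]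
      fun ω : Traj d => h (ω 0) :=
    (hh.comp (comap_measurable fun ω : Traj d => ω 0)).stronglyMeasurable
  have h1 := condExp_mul_of_stronglyMeasurable_right hsm hXh hF.1
  have h2 : (fun ω => F (ω 0) * h (ω 0)) =ᵐ[μ]
      μ[X * (fun ω => h (ω 0)) | MeasurableSpace.comap (fun ω : Traj d => ω 0) inferInstance] := by
    filter_upwards [h1, hF.2.2] with ω e1 e2
    rw [e1, Pi.mul_apply, ← e2]
  refine ⟨integrable_condExp.congr h2.symm, ?_⟩
  rw [integral_congr_ae h2, integral_condExp hm]
  rfl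

theorem map_zero_eq_withDensity {Y : Set (E d)} {P : Fin 2 → Measure (Traj d)}
    {p : Fin 2 → (n : ℕ) → (Fin n → E d) → ℝ} (hModel : IsModel Y P)
    (hDens : HasDensities Y P p) :
    (P 0).map (fun ω => ω 0) = (volume.restrict Y).withDensity
      fun y => ENNReal.ofReal (p 0 1 fun _ => y) := by
  have hsh := (hModel.ergodic 0).toMeasurePreserving
  have hw : (fun ω : Traj d => ω 0) ∘ shift =
      (MeasurableEquiv.funUnique (Fin 1) (E d)) ∘ fun ω => window ω 1 1 := by
    funext ω
    simp [shift, window]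
  have hmp := measurePreserving_funUnique ((volume : Measure (E d)).restrict Y) (Fin 1)
  -- The densities are those of blocks starting at time 1; one shift brings the law to time 0.
  conv_lhs => rw [← hsh.map_eq, Measure.map_map (measurable_pi_apply 0) hsh.measurable, hw,
    ← Measure.map_map (MeasurableEquiv.measurable _) (measurable_window 1 1), hDens.density]
  ext s hs
  rw [Measure.map_apply (MeasurableEquiv.measurable _) hs,
    withDensity_apply _ (MeasurableEquiv.measurable _ hs), withDensity_apply _ hs,
    ← hmp.setLIntegral_comp_preimage_emb (MeasurableEquiv.measurableEmbedding _)]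
  refine lintegral_congr fun a => ?_
  congr 2
  funext j
  rw [Subsingleton.elim j default]
  rfl

theorem integral_zero_eq {Y : Set (E d)} {P : Fin 2 → Measure (Traj d)}
    {p : Fin 2 → (n : ℕ) → (Fin n → E d) → ℝ} (hModel : IsModel Y P)
    (hDens : HasDensities Y P p) (hp : ContinuousOn (p 0 1) (box Y 1)) {g : E d → ℝ}
    (hg : Measurable g) (hi : Integrable (fun ω => g (ω 0)) (P 0)) :
    IntegrableOn (fun y => p 0 1 (fun _ => y) * g y) (interior Y) ∧
      ∫ y in interior Y, p 0 1 (fun _ => y) * g y = ∫ ω, g (ω 0) ∂P 0 := by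
  have hmap := map_zero_eq_withDensity hModel hDens
  rw [← restrict_interior_eq hModel.convex] at hmap
  have hm0 : Measurable fun ω : Traj d => ω 0 := measurable_pi_apply 0
  have hpc : ContinuousOn (fun y : E d => p 0 1 fun _ => y) (interior Y) :=
    hp.comp (continuous_pi fun _ => continuous_id).continuousOn
      fun y hy _ _ => interior_subset hy
  have hae : AEMeasurable (fun y => ENNReal.ofReal (p 0 1 fun _ => y))
      (volume.restrict (interior Y)) :=
    (hpc.aemeasurable isOpen_interior.measurableSet).ennreal_ofReal
  have hlt : ∀ᵐ y ∂(volume : Measure (E d)).restrict (interior Y),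
      ENNReal.ofReal (p 0 1 fun _ => y) < ∞ := Eventually.of_forall fun _ => ENNReal.ofReal_lt_top
  have heq : ∀ᵐ y ∂(volume : Measure (E d)).restrict (interior Y),
      (ENNReal.ofReal (p 0 1 fun _ => y)).toReal • g y = p 0 1 (fun _ => y) * g y := by
    filter_upwards [ae_restrict_mem isOpen_interior.measurableSet] with y hy
    rw [ENNReal.toReal_ofReal (hDens.pos 0 1 _ fun _ _ => interior_subset hy).le, smul_eq_mul]
  have h1 : Integrable g ((P 0).map fun ω => ω 0) :=
    (integrable_map_measure hg.aestronglyMeasurable hm0.aemeasurable).2 hi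
  rw [hmap, integrable_withDensity_iff_integrable_smul₀' hae hlt] at h1
  refine ⟨h1.congr heq, ?_⟩
  rw [← integral_congr_ae heq, ← integral_withDensity_eq_integral_toReal_smul₀ hae hlt, ← hmap,
    integral_map hm0.aemeasurable hg.aestronglyMeasurable]

/-- The limit loss as an integral over the domain. -/
theorem exists_condExp_quadForm {Y : Set (E d)} {P : Fin 2 → Measure (Traj d)}
    {p : Fin 2 → (n : ℕ) → (Fin n → E d) → ℝ} (hModel : IsModel Y P)
    (hDens : HasDensities Y P p) (hp : ContinuousOn (p 0 1) (box Y 1))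
    {q : ℕ → E d → ℕ} {ζ : E d → ℝ} {M : E d → Matrix (Fin d) (Fin d) ℝ}
    (hRate : IsHighRate Y q ζ M) {L : Fin d → Traj d → ℝ} (hL : ∀ c, MemLp (L c) 2 (P 0))
    {l : Traj d → E d} (hl : ∀ ω c, l ω c = L c ω) :
    ∃ F, IsCondExpGivenZero (P 0) (fun ω => quadForm (M (ω 0)) (l ω)) F ∧
      IntegrableOn (fun y => p 0 1 (fun _ => y) * F y / (ζ y) ^ (2 / (d : ℝ))) Y ∧
      ∑ c, ∑ c', ∫ ω, L c ω * limitCov (interior Y) ζ M c c' (ω 0) * L c' ω ∂P 0 =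
        ∫ y in Y, p 0 1 (fun _ => y) * F y / (ζ y) ^ (2 / (d : ℝ)) := by
  have := hModel.prob 0
  set U := interior Y with hU
  obtain ⟨κ, hκ0, hκ⟩ := hRate.exists_abs_limitCov_le
  obtain ⟨B, hB⟩ := hRate.M_bounded
  obtain ⟨b, hb0, hζ⟩ := hRate.ζ_lower
  have hmem : ∀ᵐ ω ∂P 0, ω 0 ∈ U :=
    (ae_mem_interior hModel hDens 0).mono fun ω hω => hω 0
  have hM0 : ∀ c c', Integrable (fun ω => L c ω * U.indicator (fun x => M x c c') (ω 0) * L c' ω)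
      (P 0) := fun c c' =>
    integrable_mul_coeff_mul (hL c) (hL c')
      ((measurable_indicator_of_continuousOn isOpen_interior
        ((hRate.continuousOn_M c c').mono interior_subset)).comp
        (measurable_pi_apply 0)).aestronglyMeasurable
      (κ := B) (hmem.mono fun ω h => by
        have e : U.indicator (fun x => M x c c') (ω 0) = M (ω 0) c c' := Set.indicator_of_mem h _
        change |U.indicator (fun x => M x c c') (ω 0)| ≤ B
        rw [e]
        exact hB _ (interior_subset h) c c')
  have hC0 : ∀ c c', Integrable (fun ω => L c ω * limitCov U ζ M c c' (ω 0) * L c' ω) (P 0) :=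
    fun c c' => integrable_mul_coeff_mul (hL c) (hL c')
      ((hRate.measurable_limitCov c c').comp (measurable_pi_apply 0)).aestronglyMeasurable
      (κ := κ) (hmem.mono fun ω h => hκ c c' _ h)
  -- No measurability of M is assumed off the set on which it is continuous. The indicator of the
  -- interior supplies it and agrees with M almost surely.
  have hX : Integrable (fun ω => quadForm (M (ω 0)) (l ω)) (P 0) := by
    refine (integrable_finsetSum Finset.univ fun c _ =>
      integrable_finsetSum Finset.univ fun c' _ => hM0 c c').congr ?_
    filter_upwards [hmem] with ω hω
    simp only [quadForm, hl, Set.indicator_of_mem hω]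
  obtain ⟨F, hF⟩ := exists_isCondExpGivenZero hX
  set h : E d → ℝ := U.indicator fun x => ζ x ^ (-(2 / (d : ℝ))) with hh
  have hhm : Measurable h := measurable_indicator_of_continuousOn isOpen_interior
    (hRate.continuousOn_rpow.mono interior_subset)
  have hXh : (fun ω => ∑ c, ∑ c', L c ω * limitCov U ζ M c c' (ω 0) * L c' ω) =ᵐ[P 0]
      fun ω => quadForm (M (ω 0)) (l ω) * h (ω 0) := by
    filter_upwards [hmem] with ω hω
    simp only [quadForm, hl, hh, limitCov, Set.indicator_of_mem hω, Finset.sum_mul]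
    refine Finset.sum_congr rfl fun c _ => Finset.sum_congr rfl fun c' _ => by ring
  have hsum : Integrable (fun ω => ∑ c, ∑ c', L c ω * limitCov U ζ M c c' (ω 0) * L c' ω) (P 0) :=
    integrable_finsetSum Finset.univ fun c _ =>
      integrable_finsetSum Finset.univ fun c' _ => hC0 c c'
  -- The weight ζ^{-2/d} is a function of Y_0, so it separates from the quadratic form and only the
  -- conditional expectation F of the latter remains against the law of Y_0.
  obtain ⟨hi, heq⟩ := hF.integral_mul hhm (hsum.congr hXh)
  obtain ⟨hi2, heq2⟩ := integral_zero_eq hModel hDens hp (hF.2.1.mul hhm) hi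
  have hpt : ∀ᵐ y ∂(volume : Measure (E d)).restrict U,
      p 0 1 (fun _ => y) * (F * h) y = p 0 1 (fun _ => y) * F y / (ζ y) ^ (2 / (d : ℝ)) := by
    filter_upwards [ae_restrict_mem isOpen_interior.measurableSet] with y hy
    rw [Pi.mul_apply, hh, Set.indicator_of_mem hy,
      Real.rpow_neg (hb0.le.trans (hζ y (interior_subset hy))), mul_div_assoc, div_eq_mul_inv (F y)]
  refine ⟨F, hF, ?_, ?_⟩
  · rw [IntegrableOn, ← restrict_interior_eq hModel.convex]
    exact hi2.congr hpt
  · rw [← restrict_interior_eq hModel.convex, ← integral_congr_ae hpt, heq2]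
    refine Eq.trans ?_ heq.symm
    rw [← integral_congr_ae hXh, integral_finsetSum _ fun c _ =>
      integrable_finsetSum Finset.univ fun c' _ => hC0 c c']
    exact Finset.sum_congr rfl fun c _ => (integral_finsetSum _ fun c' _ => hC0 c c').symm

end QuantNP

end

theorem theorem2 {d : ℕ} (hd : 1 ≤ d) (Y : Set (E d))
    (P : Fin 2 → Measure (Traj d)) (hModel : IsModel Y P)
    (p : Fin 2 → (n : ℕ) → (Fin n → E d) → ℝ) (hDens : HasDensities Y P p)
    (q : ℕ → E d → ℕ) (ζ : E d → ℝ) (M : E d → Matrix (Fin d) (Fin d) ℝ)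
    (hRate : IsHighRate Y q ζ M) (hReg : IsSmoothForgetting Y P p q) :
    ∃ (K : ℝ) (KN : ℕ → ℝ) (l : Traj d → E d) (F : E d → ℝ),
      IsExponent P p K ∧
      (∀ N, 2 ≤ N → IsExponentQ Y P (q N) (KN N)) ∧
      ((∀ k, MemLp (gradRatio Y p k) 2 (P 0)) ∧ MemLp l 2 (P 0) ∧
        Tendsto (fun k => eLpNorm (gradRatio Y p k - l) 2 (P 0)) atTop (𝓝 0)) ∧
      IsCondExpGivenZero (P 0) (fun ω => quadForm (M (ω 0)) (l ω)) F ∧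
      IntegrableOn (fun y => p 0 1 (fun _ => y) * F y / (ζ y) ^ (2 / (d : ℝ))) Y ∧
      Tendsto (fun N : ℕ => (N : ℝ) ^ (2 / (d : ℝ)) * (K - KN N)) atTop
        (𝓝 (1 / 2 * ∫ y in Y, p 0 1 (fun _ => y) * F y / (ζ y) ^ (2 / (d : ℝ)))) := by
  obtain ⟨C, D, C₁, ρ, u₀, Ce, ε, S, heta⟩ :=
    exists_isSystem hd hModel hDens hReg hRate.volume_ne_zero
  obtain ⟨Λ, hΛ, hblock⟩ := exists_hasBlockBounds hd S.domain S.C_nonneg S.one_le_C₁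
  have hb := fun n => hblock n _ (S.isBlockPair n)
  obtain ⟨r, hr, hfine⟩ := hRate.exists_isFineQuantizer hModel.convex hModel.bounded
  obtain ⟨κ, hκ0, hκ⟩ := hRate.exists_abs_limitCov_le
  obtain ⟨L, hL, hlim⟩ := S.exists_limit_ratioCoord hΛ hb
  obtain ⟨K, hK, hKle⟩ := exists_isExponent hModel hDens S
  have hKQ := fun N (hN : 2 ≤ N) =>
    exists_isExponentQ hModel hDens S (hfine N hN) fun i m => heta i N hN m
  choose! KN hKN hKNle using hKQ
  have hl : ∀ ω c, (WithLp.toLp 2 fun c => L c ω : E d) c = L c ω := fun _ _ => rfl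
  obtain ⟨F, hF, hint, heq⟩ :=
    exists_condExp_quadForm hModel hDens (contDiffOn_dens hReg 0 1).continuousOn hRate hL hl
  refine ⟨K, KN, _, F, hK, hKN, gradRatio_limit hModel hDens hReg S hb hL hlim hl, hF, hint, ?_⟩
  rw [← heq]
  exact S.tendsto_rescaled_loss hΛ hb hr hfine (fun c c' => hRate.measurable_limitCov c c') hκ0 hκ
    (fun c c' => hRate.tendsto_cellCov hModel.convex hModel.bounded c c') hL hlim hKle hKNle
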